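/- **Proposition 1.3.** Let $X$ be a complex surface (a two-dimensional complex manifold) with complex structure $J$, and let $\Omega\Subset X$ be a relatively compact domain with $\mathcal C^3$-smooth Levi-flat boundary $M=\partial\Omega$; that is, near each point of $M$ there is a $\mathcal C^3$ function $\rho$ without critical points such that $\Omega=\{\rho<0\}$ and the Levi form of $\rho$ vanishes on $TM\cap J\,TM$. A *foliated chart* $U$ of the Levi foliation is a homeomorphism $(z_U,t_U)\colon U\to D_U\times T_U$ from an open set $U\subset M$ onto the product of a connected open set $D_U\subset\mathbb C$ and an open interval $T_U\subset\mathbb R$ whose inverse $\varphi_U\colon D_U\times T_U\to X$ is a $\mathcal C^3$ immersion that is holomorphic in $z$. The sets $\varphi_U(D_U\times\{t\})$ are its plaques, chains of plaques form the leaves, and a subset of $M$ is saturated if it is a union of leaves. Fix a continuous leafwise hermitian metric $\omega$ on the Levi foliation, with volume form $\mathrm{vol}_\omega$ on the leaves. Let $\delta$ be a $\mathcal C^3$-smooth boundary distance function of $\Omega$: a function that is $\mathcal C^3$ up to the boundary on $\overline\Omega$, with $\Omega=\{\delta>0\}$ and $d\delta\ne0$ on $M$. For $p\in M$ let $\eta_\delta(p)$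 be the supremum of all $\eta\in(0,1)$ such that $-\delta^\eta$ is strictly plurisubharmonic on $V\cap\Omega$ for some neighbourhood $V$ of $p$ in $X$ (and $\eta_\delta(p)=0$ if there is no such $\eta$). In a foliated chart put $h_\delta=\bigl|\bigl(J(\varphi_U)_*\tfrac{\partial}{\partial t}\bigr)\delta\bigr|$. Let $\mathcal M\subset M$ be a non-empty compact saturated set on which $\eta_\delta(p)$ is constant, equal to $\eta$ with $0<\eta<1$, and put $\alpha=(\eta^{-1}-1)^{-1}$. For a foliated chart $U$ write $\mathcal M_U=t_U(\mathcal M\cap U)\subset T_U$. Suppose that the transversals of $\mathcal M$ have positive and finite $\alpha$-dimensional Hausdorff measure: for every foliated chart $U$, $\mathcal H^\alpha(\mathcal M_U)>0$ if $\mathcal M_U\neq\emptyset$, and $\mathcal H^\alpha(\mathcal M_U\cap K)<\infty$ for every compact $K\subset T_U$. Then there is a non-zero Borel measure $\mu$ on $X$ that is given on every foliated chart $U$ by $$\mu|_U=h_\delta^{\alpha}\,\mathrm{vol}_\omega\otimes\bigl(\mathcal H^\alpha|_{\mathcal M_U}\bigr),$$ and $\mu$ is a conformal harmonic measure of exponent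 $\alpha$ on $\mathcal M$. The latter means that $\alpha>0$, that $\mu$ is supported on $\mathcal M$, and that there are a finite cover $\{U\}$ of $M$ by foliated charts, measures $\nu_U$ on $T_U$ and functions $h_U$ on $U$ with $\mu|_U=h_U\,\mathrm{vol}_\omega\otimes\nu_U$ such that * each $\nu_U$ is a finite Borel measure supported on $\mathcal M_U$, and $t_V^*(\nu_V)=\left|\frac{dt_V}{dt_U}\right|^\alpha\nu_U$ whenever $U$ and $V$ intersect; since $t_V$ is only locally a function of $t_U$, this means that, for every $z\in D_U$ and every Borel set $B\subset T_U$ such that $\varphi_U(\{z\}\times B)\subset V$ and $\psi(t)=t_V(\varphi_U(z,t))$ is injective on $B$, one has $\nu_V(\psi(B))=\int_B|\psi'|^\alpha\,d\nu_U$; * $h_U\ge0$ is integrable with respect to $\mathrm{vol}_\omega\otimes\nu_U$, and on $\mathcal M\cap U$ it is positive with $\log h_U$ bounded; * for $\nu_U$-almost every $t$, $h_U$ is positive and harmonic ($\partial_b\overline\partial_b h_U=0$) on the plaque $t_U=t$. -/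

import Mathlib

open Set Filter Topology MeasureTheory
open scoped ContDiff Manifold ENNReal

namespace LeviFlat

/-! A complex surface is a manifold `X` modelled on `ℂ × ℂ` with holomorphic coordinate changes.
The real tangent space at `x` is read, as Mathlib does, as `ℂ × ℂ` through the preferred
holomorphic chart at `x`; the complex structure `J` is then multiplication by `Complex.I`. -/

noncomputable section

variable {X : Type*} [TopologicalSpace X] [ChartedSpace (ℂ × ℂ) X]

/-- The real differential `df_x : T_x X → ℝ` of a real function. -/
def diff (f : X → ℝ) (x : X) : (ℂ × ℂ) →L[ℝ] ℝ :=
  mfderiv 𝓘(ℝ, ℂ × ℂ) 𝓘(ℝ, ℝ) f x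

/-- The function `f` is of class `C³` (in the real sense) near `x`. -/
def C3At (f : X → ℝ) (x : X) : Prop :=
  ContMDiffAt 𝓘(ℝ, ℂ × ℂ) 𝓘(ℝ, ℝ) 3 f x

/-- The complex Hessian `∑ ∂²f/∂z_j∂z̄_k v_j v̄_k` of `f` at `x`, in a holomorphic chart; in real
terms it is `(D²f(v, v) + D²f(iv, iv)) / 4`. -/
def leviForm (f : X → ℝ) (x : X) (v : ℂ × ℂ) : ℝ :=
  let F : ℂ × ℂ → ℝ := f ∘ (chartAt (ℂ × ℂ) x).symm
  let a : ℂ × ℂ := chartAt (ℂ × ℂ) x x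
  (fderiv ℝ (fderiv ℝ F) a v v +
    fderiv ℝ (fderiv ℝ F) a (Complex.I • v) (Complex.I • v)) / 4

/-- Strict plurisubharmonicity on the open set `W`, for functions that are `C²` on `W`. -/
def StrictlyPsh (f : X → ℝ) (W : Set X) : Prop :=
  ∀ x ∈ W, ∀ v : ℂ × ℂ, v ≠ 0 → 0 < leviForm f x v

/-- `Ω` has a `C³`-smooth Levi-flat boundary: near each boundary point there is a `C³` local
defining function `ρ`, without critical points, with `Ω = {ρ < 0}`, whose Levi form vanishes on
the complex tangent spaces `{v | dρ(v) = dρ(iv) = 0}` of the boundary. -/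
def HasLeviFlatBoundary (Ω : Set X) : Prop :=
  ∀ p ∈ frontier Ω, ∃ (U : Set X) (ρ : X → ℝ), IsOpen U ∧ p ∈ U ∧
    (∀ q ∈ U, C3At ρ q ∧ diff ρ q ≠ 0 ∧ (q ∈ Ω ↔ ρ q < 0)) ∧
    ∀ q ∈ U ∩ frontier Ω, ∀ v : ℂ × ℂ,
      diff ρ q v = 0 → diff ρ q (Complex.I • v) = 0 → leviForm ρ q v = 0

/-- `δ` is a `C³`-smooth boundary distance function of `Ω`: it is `C³` up to the boundary (that is,
in a neighbourhood of `closure Ω`), `Ω = {δ > 0}` inside `closure Ω`, and `dδ ≠ 0` on the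
boundary. The values of `δ` off `closure Ω` play no role. -/
structure IsBoundaryDistance (Ω : Set X) (δ : X → ℝ) : Prop where
  smooth : ∀ x ∈ closure Ω, C3At δ x
  pos_iff : ∀ x ∈ closure Ω, (x ∈ Ω ↔ 0 < δ x)
  diff_ne_zero : ∀ x ∈ frontier Ω, diff δ x ≠ 0

/-- The local Diederich--Fornaess exponent `η_δ(p)`; it is `0` when no exponent is admissible,
since `sSup ∅ = 0`. -/
def localDFExponent (Ω : Set X) (δ : X → ℝ) (p : X) : ℝ :=
  sSup {η : ℝ | η ∈ Ioo (0 : ℝ) 1 ∧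
    ∃ U : Set X, IsOpen U ∧ p ∈ U ∧ StrictlyPsh (fun x => -(δ x ^ η)) (U ∩ Ω)}

/-- A foliated chart of the Levi foliation of `M`: a homeomorphism `(z, t)` from an open subset of
`M` onto `D × T`, with `D ⊆ ℂ` and `T ⊆ ℝ` open and connected, whose inverse is, as a map into `X`,
a `C³` immersion that is holomorphic in `z`. -/
structure FoliatedChart (M : Set X) where
  toHomeo : OpenPartialHomeomorph M (ℂ × ℝ)
  D : Set ℂ
  T : Set ℝ
  isOpen_D : IsOpen D
  isConnected_D : IsConnected D
  isOpen_T : IsOpen T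
  isConnected_T : IsConnected T
  target_eq : toHomeo.target = D ×ˢ T
  smooth : ContMDiffOn 𝓘(ℝ, ℂ × ℝ) 𝓘(ℝ, ℂ × ℂ) 3
    (fun p : ℂ × ℝ => (toHomeo.symm p : X)) (D ×ˢ T)
  immersion : ∀ p ∈ D ×ˢ T, Function.Injective
    (mfderiv 𝓘(ℝ, ℂ × ℝ) 𝓘(ℝ, ℂ × ℂ) (fun p : ℂ × ℝ => (toHomeo.symm p : X)) p)
  holomorphic : ∀ t ∈ T, MDifferentiableOn 𝓘(ℂ, ℂ) 𝓘(ℂ, ℂ × ℂ)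
    (fun z : ℂ => (toHomeo.symm (z, t) : X)) D

namespace FoliatedChart

variable {M : Set X} (c : FoliatedChart M)

/-- The parametrization `φ : D × T → U ⊆ M ⊆ X`. -/
def param (p : ℂ × ℝ) : X := c.toHomeo.symm p

/-- The image `U` of the parametrization, as a subset of `X`. -/
def dom : Set X := c.param '' (c.D ×ˢ c.T)

/-- The differential `φ_*` at `p`. -/
def dparam (p : ℂ × ℝ) : (ℂ × ℝ) →L[ℝ] (ℂ × ℂ) :=
  mfderiv 𝓘(ℝ, ℂ × ℝ) 𝓘(ℝ, ℂ × ℂ) c.param p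

/-- The real leafwise coordinate vector `φ_*(∂/∂x)`, where `z = x + iy`. -/
def leafVec (p : ℂ × ℝ) : ℂ × ℂ := c.dparam p (1, 0)

/-- The transverse coordinate vector `φ_*(∂/∂t)`. -/
def transVec (p : ℂ × ℝ) : ℂ × ℂ := c.dparam p (0, 1)

/-- The expression `h_δ = |(J φ_*(∂/∂t)) δ|` in the chart of the metric of the normal bundle of the
Levi foliation induced by `δ`. -/
def normalMetric (δ : X → ℝ) (p : ℂ × ℝ) : ℝ :=
  |diff δ (c.param p) (Complex.I • c.transVec p)|

/-- The transversal `𝓜_U = t_U(𝓜 ∩ U) ⊆ T` of a subset `𝓜`. -/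
def transversal (S : Set X) : Set ℝ :=
  {t | t ∈ c.T ∧ ∃ z ∈ c.D, c.param (z, t) ∈ S}

/-- The transition `t_U ↦ t_V` between transverse coordinates, taken along the transversal
`{z} × T_U` of the first chart. -/
def transition (c' : FoliatedChart M) (z : ℂ) (t : ℝ) : ℝ :=
  (c'.toHomeo (c.toHomeo.symm (z, t))).2

end FoliatedChart

/-- Two points lie in a common plaque. -/
def SamePlaque (M : Set X) (x y : X) : Prop :=
  ∃ (c : FoliatedChart M) (t : ℝ) (z w : ℂ), t ∈ c.T ∧ z ∈ c.D ∧ w ∈ c.D ∧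
    c.param (z, t) = x ∧ c.param (w, t) = y

/-- The leaf through `x`: the points that are joined to `x` by a chain of plaques. -/
def leaf (M : Set X) (x : X) : Set X := {y | Relation.EqvGen (SamePlaque M) x y}

/-- `S ⊆ M` is saturated: a union of leaves. -/
def IsSaturated (M S : Set X) : Prop := S ⊆ M ∧ ∀ x ∈ S, leaf M x ⊆ S

/-- The complex line tangent to the leaf at `x`. -/
def leafTangent (M : Set X) (x : X) : Set (ℂ × ℂ) :=
  {v | ∃ (c : FoliatedChart M), ∃ p ∈ c.D ×ˢ c.T, c.param p = x ∧ ∃ a : ℂ, v = a • c.leafVec p}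

/-- A continuous leafwise hermitian metric on the Levi foliation of `M`. For each `x ∈ M` only the
restriction of `form x` to the tangent line of the leaf matters. -/
structure LeafwiseMetric (M : Set X) where
  form : X → (ℂ × ℂ) →ₗ⋆[ℂ] (ℂ × ℂ) →ₗ[ℂ] ℂ
  hermitian : ∀ x ∈ M, ∀ v ∈ leafTangent M x, ∀ w ∈ leafTangent M x,
    form x v w = (starRingEnd ℂ) (form x w v)
  pos : ∀ x ∈ M, ∀ v ∈ leafTangent M x, v ≠ 0 → 0 < (form x v v).re
  continuous : ∀ c : FoliatedChart M,
    ContinuousOn (fun p => form (c.param p) (c.leafVec p) (c.leafVec p)) (c.D ×ˢ c.T)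

variable {M : Set X}

/-- The density of `vol_g` with respect to Lebesgue measure `dx dy` on the plaques of a chart, that
is `|φ_*(∂/∂x)|²_g` (the metric is conformal on each plaque). -/
def LeafwiseMetric.density (g : LeafwiseMetric M) (c : FoliatedChart M) (p : ℂ × ℝ) : ℝ :=
  (g.form (c.param p) (c.leafVec p) (c.leafVec p)).re

/-- The measure `vol_g ⊗ ν` on `D × T`, for a measure `ν` on `T`. -/
def LeafwiseMetric.volProd (g : LeafwiseMetric M) (c : FoliatedChart M) (ν : Measure ℝ) :
    Measure (ℂ × ℝ) :=
  ((volume.restrict c.D).prod ν).withDensity (fun p => ENNReal.ofReal (g.density c p))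

/-- The measure `h vol_g ⊗ ν` on the domain of a chart, as a measure on `X`. -/
def LeafwiseMetric.localMeasure [MeasurableSpace X] (g : LeafwiseMetric M) (c : FoliatedChart M)
    (ν : Measure ℝ) (h : ℂ × ℝ → ℝ) : Measure X :=
  ((g.volProd c ν).withDensity (fun p => ENNReal.ofReal (h p))).map c.param

/-- A collection of transverse measures that is conformal of exponent `α` and adapted to `S`:
finite Borel measures `ν_U` carried by the transversals of `S`, such that
`t_V^* ν_V = |dt_V/dt_U|^α ν_U` on overlaps. As `t_V` is only locally a function of `t_U`, the
relation is tested on Borel pieces `B` of the transversals `{z} × T_U` that lie in `V` and on which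
`t_U ↦ t_V` is injective. -/
structure IsConformalFamily (S : Set X) (α : ℝ) {n : ℕ} (c : Fin n → FoliatedChart M)
    (ν : Fin n → Measure ℝ) : Prop where
  exponent_pos : 0 < α
  finite : ∀ i, IsFiniteMeasure (ν i)
  supported : ∀ i, ν i ((c i).transversal S)ᶜ = 0
  conformal : ∀ (i j : Fin n) (z : ℂ) (B : Set ℝ), z ∈ (c i).D → B ⊆ (c i).T → MeasurableSet B →
    (∀ t ∈ B, (c i).param (z, t) ∈ (c j).dom) → InjOn ((c i).transition (c j) z) B →
    ν j ((c i).transition (c j) z '' B) =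
      ∫⁻ t in B, ENNReal.ofReal (|deriv ((c i).transition (c j) z) t| ^ α) ∂(ν i)

/-- `μ` is a conformal harmonic measure of exponent `α` supported on the compact saturated set `S`
of the Levi foliation of `M`. -/
def IsConformalHarmonicMeasure [MeasurableSpace X] (g : LeafwiseMetric M) (S : Set X) (α : ℝ)
    (μ : Measure X) : Prop :=
  μ Sᶜ = 0 ∧
  ∃ (n : ℕ) (c : Fin n → FoliatedChart M) (ν : Fin n → Measure ℝ) (h : Fin n → ℂ × ℝ → ℝ),
    M = (⋃ i, (c i).dom) ∧
    (∀ i, μ.restrict (c i).dom = g.localMeasure (c i) (ν i) (h i)) ∧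
    IsConformalFamily S α c ν ∧
    (∀ i, (∀ p ∈ (c i).D ×ˢ (c i).T, 0 ≤ h i p) ∧ Integrable (h i) (g.volProd (c i) (ν i))) ∧
    (∀ i, ∃ C : ℝ, ∀ p ∈ (c i).D ×ˢ (c i).transversal S, 0 < h i p ∧ |Real.log (h i p)| ≤ C) ∧
    (∀ i, ∀ᵐ t ∂(ν i), (∀ z ∈ (c i).D, 0 < h i (z, t)) ∧
      InnerProductSpace.HarmonicOnNhd (fun z => h i (z, t)) (c i).D)

/-- The transversals of `S` have positive finite `α`-dimensional Hausdorff measure: in each foliated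
chart `U` that meets `S` the transversal `t_U(S ∩ U)` has positive measure, and its part in each
compact subset of `T_U` has finite measure. -/
def HasPosFiniteTransversals (M S : Set X) (α : ℝ) : Prop :=
  ∀ c : FoliatedChart M,
    ((c.transversal S).Nonempty → 0 < Measure.hausdorffMeasure α (c.transversal S)) ∧
    ∀ K ⊆ c.T, IsCompact K → Measure.hausdorffMeasure α (c.transversal S ∩ K) < ⊤

end

end LeviFlat

/-! The measure is prescribed chart by chart, so the content is that the local measures exist, agree
on overlaps, and have densities that are harmonic along the leaves.

Gluing. Under a change of foliated chart the leafwise area density is multiplied by the squared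
modulus of the holomorphic derivative along the plaque, and `h_δ` by `|dt'/dt|`, because `J` of a
leaf vector is again tangent to the boundary and is killed by `dδ`. On the line, `𝓗^α` is multiplied
by `|dt'/dt|^α` (`hausdorffMeasure_image_eq_lintegral`). The factors balance exactly
(`weight_trans`), so `chartMeasure_restrict_overlap` holds; the last rule alone says that the
measures `𝓗^α` form a conformal family.

Harmonicity. Let `φ(z, t)` parametrize the boundary and let `s` be the height in the direction `i
φ_t`. Write `σ` for the derivative of `δ` along `i φ_t`, so that `|σ| = h_δ`. Up to a positive
factor the Levi form of `-δ^η` is the Hermitian form `dfForm`. It has size `s²` along the translated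
leaf, size `s` in the mixed direction and size `1` transversally. Its discriminant divided by `s²`
tends to `σ² E(η)` with `E(η) = -(1 - η) σ Δσ + (1 - 2η) |∇σ|²` (`tendsto_dfDisc`). If `E(η) > 0`,
then `-δ^η` is strictly plurisubharmonic on the nearby part of `Ω`; if `E(η) < 0`, it is not. As `E`
is continuous in `η`, it vanishes at the supremum of the admissible exponents
(`dfExcess_sSup_eq_zero`). Since `α - 1 = (2η - 1)/(1 - η)`, the equation `E(η) = 0` says that
`|σ|^α` has leafwise Laplacian zero (`leviBilin_abs_rpow_eq_zero`).

Existence of charts. Foliated charts of class `C³` have to be produced from the Levi-flat condition.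
Write the boundary as a graph `Im w = F(z, Re w)`. Its complex tangent lines have a slope `a` of
class `C²`, and the vanishing of the Levi form makes `du = Re (a dz)` completely integrable. Solving
this along rays gives leaves `w = f(z, t)` depending in a `C²` way on the data
(`exists_leaf_height`). The missing derivative comes from complex analysis: `f_t` is holomorphic in
`z` and its argument is `arctan F_x`, of class `C²`, so `log f_t` is recovered with the same
regularity by an integral formula (`contDiffAt_of_im`). Hence `f_t` and `f_z = a` are `C²` and `f`
is `C³`.

Compactness of the boundary then yields a finite cover by relatively compact charts, on which the
transverse measures are finite and `log h_δ^α` is bounded. Positivity of `h_δ` and of the Hausdorff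
measures makes the glued measure non-zero. -/

namespace LeviFlat

/-! ### Second derivatives of compositions. -/

section Calculus

variable {E F G : Type*} [NormedAddCommGroup E] [NormedSpace ℝ E] [NormedAddCommGroup F]
  [NormedSpace ℝ F] [NormedAddCommGroup G] [NormedSpace ℝ G]

theorem _root_.ContDiffAt.fderiv_eventually_hasFDerivAt {f : E → F} {a : E} {n : ℕ∞ω}
    (hf : ContDiffAt ℝ n f a) (hn : 1 ≤ n) : ∀ᶠ x in 𝓝 a, DifferentiableAt ℝ f x := by
  have h1 : ContDiffAt ℝ 1 f a := hf.of_le hn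
  exact (h1.eventually (by simp)).mono fun x hx => hx.differentiableAt (by simp)

theorem fderiv_fderiv_apply {f : E → F} {a : E} (hf : DifferentiableAt ℝ (fderiv ℝ f) a) (v w : E) :
    fderiv ℝ (fderiv ℝ f) a v w = fderiv ℝ (fun x => fderiv ℝ f x w) a v := by
  have h := hf.hasFDerivAt.clm_apply (hasFDerivAt_const w a)
  rw [h.fderiv]
  simp

theorem _root_.ContDiffAt.differentiableAt_fderiv {f : E → F} {a : E} (hf : ContDiffAt ℝ 2 f a) :
    DifferentiableAt ℝ (fderiv ℝ f) a :=
  (hf.fderiv_right (m := 1) (by norm_num)).differentiableAt (by simp)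

theorem _root_.ContDiffAt.fderiv_fderiv_symm {f : E → F} {a : E} (hf : ContDiffAt ℝ 2 f a)
    (v w : E) : fderiv ℝ (fderiv ℝ f) a v w = fderiv ℝ (fderiv ℝ f) a w v :=
  (hf.isSymmSndFDerivAt (by simp)).eq v w

/-- The chain rule for second derivatives. -/
theorem fderiv_fderiv_comp {f : F → G} {h : E → F} {a : E} (hf : ContDiffAt ℝ 2 f (h a))
    (hh : ContDiffAt ℝ 2 h a) (v w : E) :
    fderiv ℝ (fderiv ℝ (f ∘ h)) a v w =
      fderiv ℝ (fderiv ℝ f) (h a) (fderiv ℝ h a v) (fderiv ℝ h a w) +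
        fderiv ℝ f (h a) (fderiv ℝ (fderiv ℝ h) a v w) := by
  have e1 : fderiv ℝ (f ∘ h) =ᶠ[𝓝 a] fun x => (fderiv ℝ f (h x)).comp (fderiv ℝ h x) := by
    filter_upwards [hh.fderiv_eventually_hasFDerivAt (by norm_num),
      hh.continuousAt.eventually (hf.fderiv_eventually_hasFDerivAt (by norm_num))] with x h1 h2
    exact fderiv_comp x h2 h1
  rw [e1.fderiv_eq]
  have h1 : HasFDerivAt (fun x => fderiv ℝ f (h x)) _ a :=
    hf.differentiableAt_fderiv.hasFDerivAt.comp a (hh.differentiableAt (by simp)).hasFDerivAt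
  rw [(h1.clm_comp hh.differentiableAt_fderiv.hasFDerivAt).fderiv]
  simp [add_comm]

end Calculus

/-! ### Holomorphic invariance of the Levi form. -/

section Complex

variable {E F : Type*} [NormedAddCommGroup E] [NormedSpace ℂ E] [NormedAddCommGroup F]
  [NormedSpace ℂ F]

theorem fderiv_real_smul {h : E → F} {a : E} (hh : DifferentiableAt ℂ h a) (c : ℂ) (v : E) :
    fderiv ℝ h a (c • v) = c • fderiv ℝ h a v := by
  rw [hh.fderiv_restrictScalars ℝ]
  simp

/-- The `J`-invariant part `D²f(v, w) + D²f(iv, iw)` of the real Hessian of `f`. -/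
noncomputable def leviBilin (f : E → ℝ) (a v w : E) : ℝ :=
  fderiv ℝ (fderiv ℝ f) a v w + fderiv ℝ (fderiv ℝ f) a (Complex.I • v) (Complex.I • w)

/-- Near the point the differential of a holomorphic map is complex linear, so the second
differential is complex bilinear and two factors `i` give `-1`. This is what cancels the
second-order term of the chain rule in the Levi form. -/
theorem fderiv_fderiv_I_smul {h : E → F} {a : E} (hh : ∀ᶠ x in 𝓝 a, DifferentiableAt ℂ h x)
    (h2 : ContDiffAt ℝ 2 h a) (v w : E) :
    fderiv ℝ (fderiv ℝ h) a (Complex.I • v) (Complex.I • w) = -fderiv ℝ (fderiv ℝ h) a v w := by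
  have key : ∀ v w : E, fderiv ℝ (fderiv ℝ h) a v (Complex.I • w) =
      Complex.I • fderiv ℝ (fderiv ℝ h) a v w := by
    intro v w
    rw [fderiv_fderiv_apply h2.differentiableAt_fderiv, fderiv_fderiv_apply h2.differentiableAt_fderiv]
    have : (fun x => fderiv ℝ h x (Complex.I • w)) =ᶠ[𝓝 a]
        fun x => Complex.I • fderiv ℝ h x w := by
      filter_upwards [hh] with x hx using fderiv_real_smul hx _ _
    rw [this.fderiv_eq]
    have h3 : DifferentiableAt ℝ (fun x => fderiv ℝ h x w) a :=
      h2.differentiableAt_fderiv.clm_apply (differentiableAt_const _)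
    have h4 := h3.hasFDerivAt.const_smul Complex.I
    have h5 := h4.fderiv
    erw [h5]
    simp
  rw [key, h2.fderiv_fderiv_symm, key, h2.fderiv_fderiv_symm, smul_smul, Complex.I_mul_I, neg_one_smul]

/-- The Levi form is invariant under holomorphic maps. -/
theorem leviBilin_comp {f : F → ℝ} {h : E → F} {a : E} (hf : ContDiffAt ℝ 2 f (h a))
    (hh : ∀ᶠ x in 𝓝 a, DifferentiableAt ℂ h x) (h2 : ContDiffAt ℝ 2 h a) (v w : E) :
    leviBilin (f ∘ h) a v w = leviBilin f (h a) (fderiv ℝ h a v) (fderiv ℝ h a w) := by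
  unfold leviBilin
  rw [fderiv_fderiv_comp hf h2, fderiv_fderiv_comp hf h2, fderiv_fderiv_I_smul hh h2,
    fderiv_real_smul hh.self_of_nhds, fderiv_real_smul hh.self_of_nhds, map_neg]
  ring

theorem leviBilin_congr {f g : E → ℝ} {a : E} (h : f =ᶠ[𝓝 a] g) (v w : E) :
    leviBilin f a v w = leviBilin g a v w := by
  unfold leviBilin
  rw [(h.fderiv).fderiv_eq]

theorem leviBilin_symm {f : E → ℝ} {a : E} (hf : ContDiffAt ℝ 2 f a) (v w : E) :
    leviBilin f a v w = leviBilin f a w v := by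
  unfold leviBilin
  rw [hf.fderiv_fderiv_symm, hf.fderiv_fderiv_symm (Complex.I • v)]

theorem leviBilin_add_left (f : E → ℝ) (a v v' w : E) :
    leviBilin f a (v + v') w = leviBilin f a v w + leviBilin f a v' w := by
  simp [leviBilin]; ring

theorem leviBilin_real_smul_left (f : E → ℝ) (a v w : E) (r : ℝ) :
    leviBilin f a (r • v) w = r * leviBilin f a v w := by
  simp [leviBilin, smul_comm Complex.I r]; ring

theorem leviBilin_I_smul (f : E → ℝ) (a v w : E) :
    leviBilin f a (Complex.I • v) (Complex.I • w) = leviBilin f a v w := by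
  simp [leviBilin, smul_smul]; ring

end Complex

/-! ### Differentials and Levi forms read in one fixed holomorphic chart. -/

section Charts

/-- Holomorphic coordinate changes stay smooth after restriction of scalars; this opens the real
`C³` calculus on a complex surface. -/
theorem isManifold_real (X : Type*) [TopologicalSpace X] [ChartedSpace (ℂ × ℂ) X]
    [IsManifold 𝓘(ℂ, ℂ × ℂ) ω X] : IsManifold 𝓘(ℝ, ℂ × ℂ) 3 X := by
  apply isManifold_of_contDiffOn
  intro e e' he he'
  have h := (contDiffGroupoid ω 𝓘(ℂ, ℂ × ℂ)).compatible he he'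
  have h1 := (contDiffGroupoid ω 𝓘(ℂ, ℂ × ℂ)).compatible he he'
  rw [contDiffGroupoid, mem_groupoid_of_pregroupoid] at h1
  have h2 := h1.1
  simp only [contDiffPregroupoid] at h2
  exact (h2.restrict_scalars ℝ).of_le le_top

variable {X : Type*} [TopologicalSpace X] [ChartedSpace (ℂ × ℂ) X]

/-- The derivative at `x` of the chart at `x₀`, read in the preferred chart at `x`. -/
noncomputable def chartDeriv (x₀ x : X) : (ℂ × ℂ) →L[ℂ] (ℂ × ℂ) :=
  fderiv ℂ (chartAt (ℂ × ℂ) x₀ ∘ (chartAt (ℂ × ℂ) x).symm) (chartAt (ℂ × ℂ) x x)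

theorem chart_trans_self {x₀ x y : X} (hx : y ∈ (chartAt (ℂ × ℂ) x).source) :
    (chartAt (ℂ × ℂ) x₀ ∘ (chartAt (ℂ × ℂ) x).symm) (chartAt (ℂ × ℂ) x y) =
      chartAt (ℂ × ℂ) x₀ y := by
  simp [hx]

theorem chart_trans_eventually {x₀ x y : X} (hx₀ : y ∈ (chartAt (ℂ × ℂ) x₀).source)
    (hx : y ∈ (chartAt (ℂ × ℂ) x).source) :
    ∀ᶠ p in 𝓝 (chartAt (ℂ × ℂ) x y), p ∈ (chartAt (ℂ × ℂ) x).target ∧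
      (chartAt (ℂ × ℂ) x).symm p ∈ (chartAt (ℂ × ℂ) x₀).source := by
  have h1 : (chartAt (ℂ × ℂ) x).target ∈ 𝓝 (chartAt (ℂ × ℂ) x y) :=
    (chartAt (ℂ × ℂ) x).open_target.mem_nhds ((chartAt (ℂ × ℂ) x).map_source hx)
  have h2 := (chartAt (ℂ × ℂ) x).continuousAt_symm ((chartAt (ℂ × ℂ) x).map_source hx)
  refine (eventually_mem_set.2 h1).and (h2 ?_)
  rw [(chartAt (ℂ × ℂ) x).left_inv hx]
  exact (chartAt (ℂ × ℂ) x₀).open_source.mem_nhds hx₀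

variable [IsManifold 𝓘(ℂ, ℂ × ℂ) ω X]

theorem contDiffAt_chart_trans {x₀ x y : X} (hx₀ : y ∈ (chartAt (ℂ × ℂ) x₀).source)
    (hx : y ∈ (chartAt (ℂ × ℂ) x).source) :
    ContDiffAt ℂ ω (chartAt (ℂ × ℂ) x₀ ∘ (chartAt (ℂ × ℂ) x).symm) (chartAt (ℂ × ℂ) x y) := by
  have h1 := (contDiffGroupoid ω 𝓘(ℂ, ℂ × ℂ)).compatible (chart_mem_atlas (ℂ × ℂ) x)
    (chart_mem_atlas (ℂ × ℂ) x₀)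
  rw [contDiffGroupoid, mem_groupoid_of_pregroupoid] at h1
  have h2 := h1.1
  simp only [contDiffPregroupoid] at h2
  refine ContDiffOn.contDiffAt (s := _) h2 ?_
  simp only [modelWithCornersSelf_coe, modelWithCornersSelf_coe_symm, preimage_id, range_id,
    inter_univ]
  refine (OpenPartialHomeomorph.open_source _).mem_nhds ?_
  simp [hx₀, hx]

theorem chartDeriv_real {x₀ x : X} (hx : x ∈ (chartAt (ℂ × ℂ) x₀).source) (v : ℂ × ℂ) :
    fderiv ℝ (chartAt (ℂ × ℂ) x₀ ∘ (chartAt (ℂ × ℂ) x).symm) (chartAt (ℂ × ℂ) x x) v =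
      chartDeriv x₀ x v := by
  rw [((contDiffAt_chart_trans hx (mem_chart_source _ x)).differentiableAt
    (by simp)).fderiv_restrictScalars ℝ]
  rfl

/-- The coordinate change in the opposite direction has a differential that is a left inverse. -/
theorem chartDeriv_injective {x₀ x : X} (hx : x ∈ (chartAt (ℂ × ℂ) x₀).source) :
    Function.Injective (chartDeriv x₀ x) := by
  have h1 := (contDiffAt_chart_trans hx (mem_chart_source _ x)).differentiableAt (by simp)
  have h2 := (contDiffAt_chart_trans (mem_chart_source _ x) hx).differentiableAt (by simp)
  rw [← chart_trans_self (x₀ := x₀) (mem_chart_source (ℂ × ℂ) x)] at h2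
  have h3 := h2.hasFDerivAt.comp _ h1.hasFDerivAt
  have h4 : HasFDerivAt ((chartAt (ℂ × ℂ) x ∘ (chartAt (ℂ × ℂ) x₀).symm) ∘
      (chartAt (ℂ × ℂ) x₀ ∘ (chartAt (ℂ × ℂ) x).symm)) (ContinuousLinearMap.id ℂ (ℂ × ℂ))
      (chartAt (ℂ × ℂ) x x) := by
    refine (hasFDerivAt_id _).congr_of_eventuallyEq ?_
    filter_upwards [chart_trans_eventually hx (mem_chart_source _ x)] with p hp
    simp [hp.1, hp.2]
  have h5 := h3.unique h4
  intro v w hvw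
  have := congrArg (fun L => L v) h5
  have h6 := congrArg (fun L => L w) h5
  simp only [ContinuousLinearMap.comp_apply, ContinuousLinearMap.id_apply] at this h6
  rw [← this, ← h6]
  congr 1

theorem chartDeriv_surjective {x₀ x : X} (hx : x ∈ (chartAt (ℂ × ℂ) x₀).source) :
    Function.Surjective (chartDeriv x₀ x) :=
  LinearMap.surjective_of_injective (f := (chartDeriv x₀ x : (ℂ × ℂ) →ₗ[ℂ] (ℂ × ℂ)))
    (chartDeriv_injective hx)

theorem C3At.contDiffAt {f : X → ℝ} {x₀ x : X} (hf : C3At f x)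
    (hx : x ∈ (chartAt (ℂ × ℂ) x₀).source) :
    ContDiffAt ℝ 3 (f ∘ (chartAt (ℂ × ℂ) x₀).symm) (chartAt (ℂ × ℂ) x₀ x) := by
  have := isManifold_real X
  have h := (contMDiffAt_iff_source_of_mem_source (I := 𝓘(ℝ, ℂ × ℂ)) hx).1 hf
  simpa [contMDiffWithinAt_iff_contDiffWithinAt, contDiffWithinAt_univ] using h

theorem diff_eq {f : X → ℝ} {x₀ x : X} (hf : C3At f x)
    (hx : x ∈ (chartAt (ℂ × ℂ) x₀).source) (v : ℂ × ℂ) :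
    diff f x v = fderiv ℝ (f ∘ (chartAt (ℂ × ℂ) x₀).symm) (chartAt (ℂ × ℂ) x₀ x)
      (chartDeriv x₀ x v) := by
  have h0 : diff f x = fderiv ℝ (f ∘ (chartAt (ℂ × ℂ) x).symm) (chartAt (ℂ × ℂ) x x) := by
    refine (if_pos (ContMDiffAt.mdifferentiableAt hf (by simp))).trans ?_
    simp [writtenInExtChartAt, fderivWithin_univ]
    rfl
  have h1 := (hf.contDiffAt hx).differentiableAt (by simp)
  have h2 := ((contDiffAt_chart_trans hx (mem_chart_source _ x)).restrict_scalars ℝ).differentiableAt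
    (by simp)
  have e : f ∘ (chartAt (ℂ × ℂ) x).symm =ᶠ[𝓝 (chartAt (ℂ × ℂ) x x)]
      (f ∘ (chartAt (ℂ × ℂ) x₀).symm) ∘ (chartAt (ℂ × ℂ) x₀ ∘ (chartAt (ℂ × ℂ) x).symm) := by
    filter_upwards [chart_trans_eventually hx (mem_chart_source _ x)] with p hp
    simp [hp.2]
  rw [h0, e.fderiv_eq, fderiv_comp _ (by rw [chart_trans_self (mem_chart_source _ x)]; exact h1) h2,
    ContinuousLinearMap.comp_apply, chartDeriv_real hx, chart_trans_self (mem_chart_source _ x)]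

/-- The Levi form at `x` is defined through the preferred chart at `x`, which jumps with `x`. Limits
as `x` varies need a single chart at `x₀`, and holomorphic invariance allows the switch. -/
theorem leviForm_eq {f : X → ℝ} {x₀ x : X}
    (hx : x ∈ (chartAt (ℂ × ℂ) x₀).source)
    (hf : ContDiffAt ℝ 2 (f ∘ (chartAt (ℂ × ℂ) x₀).symm) (chartAt (ℂ × ℂ) x₀ x)) (v : ℂ × ℂ) :
    leviForm f x v = leviBilin (f ∘ (chartAt (ℂ × ℂ) x₀).symm) (chartAt (ℂ × ℂ) x₀ x)
      (chartDeriv x₀ x v) (chartDeriv x₀ x v) / 4 := by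
  have h0 : leviForm f x v = leviBilin (f ∘ (chartAt (ℂ × ℂ) x).symm) (chartAt (ℂ × ℂ) x x) v v / 4 :=
    rfl
  have e : f ∘ (chartAt (ℂ × ℂ) x).symm =ᶠ[𝓝 (chartAt (ℂ × ℂ) x x)]
      (f ∘ (chartAt (ℂ × ℂ) x₀).symm) ∘ (chartAt (ℂ × ℂ) x₀ ∘ (chartAt (ℂ × ℂ) x).symm) := by
    filter_upwards [chart_trans_eventually hx (mem_chart_source _ x)] with p hp
    simp [hp.2]
  have hc := contDiffAt_chart_trans hx (mem_chart_source _ x)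
  rw [h0, leviBilin_congr e, leviBilin_comp (by rwa [chart_trans_self (mem_chart_source _ x)])
    _ ((hc.restrict_scalars ℝ).of_le (by simp)), chartDeriv_real hx,
    chart_trans_self (mem_chart_source _ x)]
  have h1 : ContDiffAt ℂ 1 (chartAt (ℂ × ℂ) x₀ ∘ (chartAt (ℂ × ℂ) x).symm)
    (chartAt (ℂ × ℂ) x x) := hc.of_le (by simp)
  exact (h1.eventually (by simp)).mono fun p hp => hp.differentiableAt (by simp)

theorem fderiv_chart_comp {E : Type*} [NormedAddCommGroup E] [NormedSpace ℝ E] {γ : E → X} {p : E}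
    {x₀ : X} (hγ : MDifferentiableAt 𝓘(ℝ, E) 𝓘(ℝ, ℂ × ℂ) γ p)
    (hx : γ p ∈ (chartAt (ℂ × ℂ) x₀).source) (v : E) :
    fderiv ℝ (chartAt (ℂ × ℂ) x₀ ∘ γ) p v =
      chartDeriv x₀ (γ p) (mfderiv 𝓘(ℝ, E) 𝓘(ℝ, ℂ × ℂ) γ p v) := by
  have h0 : mfderiv 𝓘(ℝ, E) 𝓘(ℝ, ℂ × ℂ) γ p = fderiv ℝ (chartAt (ℂ × ℂ) (γ p) ∘ γ) p := by
    refine (if_pos hγ).trans ?_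
    simp [writtenInExtChartAt, fderivWithin_univ, Function.comp_def]
    rfl
  have h1 : DifferentiableAt ℝ (chartAt (ℂ × ℂ) (γ p) ∘ γ) p := by
    have := hγ.differentiableWithinAt_writtenInExtChartAt
    simp only [writtenInExtChartAt, extChartAt, mfld_simps,
      differentiableWithinAt_univ] at this
    exact this
  have h2 := ((contDiffAt_chart_trans hx (mem_chart_source _ (γ p))).restrict_scalars
    ℝ).differentiableAt (by simp)
  have e : chartAt (ℂ × ℂ) x₀ ∘ γ =ᶠ[𝓝 p]
      (chartAt (ℂ × ℂ) x₀ ∘ (chartAt (ℂ × ℂ) (γ p)).symm) ∘ (chartAt (ℂ × ℂ) (γ p) ∘ γ) := by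
    have := hγ.continuousAt ((chartAt (ℂ × ℂ) (γ p)).open_source.mem_nhds (mem_chart_source _ (γ p)))
    filter_upwards [this] with q hq
    have hq' : γ q ∈ (chartAt (ℂ × ℂ) (γ p)).source := hq
    simp [hq']
  rw [e.fderiv_eq, fderiv_comp (f := chartAt (ℂ × ℂ) (γ p) ∘ γ) p h2 h1,
    ContinuousLinearMap.comp_apply, h0]
  exact chartDeriv_real hx _

end Charts

end LeviFlat

/-! ### Foliated charts: frames, transition maps and transformation rules. -/

namespace LeviFlat

/-- A continuous lift of a `C^n` map through a `C^n` immersion is `C^n`. -/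
theorem contDiffAt_of_comp_immersion {E F H : Type*} [NormedAddCommGroup E] [NormedSpace ℝ E]
    [FiniteDimensional ℝ E] [NormedAddCommGroup F] [NormedSpace ℝ F] [FiniteDimensional ℝ F]
    [NormedAddCommGroup H] [NormedSpace ℝ H] {n : ℕ∞ω} (hn : n ≠ 0) {f : E → F} {τ : H → E} {p : H}
    (hf : ContDiffAt ℝ n f (τ p)) (hinj : Function.Injective (fderiv ℝ f (τ p)))
    (hτ : ContinuousAt τ p) (hfτ : ContDiffAt ℝ n (f ∘ τ) p) : ContDiffAt ℝ n τ p := by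
  have : CompleteSpace E := FiniteDimensional.complete ℝ E
  -- A linear left inverse of the differential turns `f` into a local diffeomorphism `L ∘ f` of `E`.
  -- Then `τ` is the local inverse of `L ∘ f` applied to `L ∘ (f ∘ τ)`, and continuity of `τ` keeps
  -- it in the branch of that inverse.
  obtain ⟨L, hL⟩ := LinearMap.exists_leftInverse_of_injective (fderiv ℝ f (τ p) : E →ₗ[ℝ] F)
    (LinearMap.ker_eq_bot.2 hinj)
  let L' : F →L[ℝ] E := LinearMap.toContinuousLinearMap L
  have h1 : ContDiffAt ℝ n (L' ∘ f) (τ p) := L'.contDiff.contDiffAt.comp _ hf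
  have h2 : HasFDerivAt (L' ∘ f) ((ContinuousLinearEquiv.refl ℝ E : E ≃L[ℝ] E) : E →L[ℝ] E)
      (τ p) := by
    have := L'.hasFDerivAt.comp (τ p) (hf.differentiableAt hn).hasFDerivAt
    convert this
    ext v
    exact (congrArg (fun M => M v) hL).symm
  have h3 := h1.to_localInverse h2 hn
  have h4 : ContDiffAt ℝ n (h1.localInverse h2 hn ∘ L' ∘ (f ∘ τ)) p :=
    ContDiffAt.comp p (by exact h3) (L'.contDiff.contDiffAt.comp _ hfτ)
  refine h4.congr_of_eventuallyEq ?_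
  have h5 := (h1.hasStrictFDerivAt' h2 hn).eventually_left_inverse
  filter_upwards [hτ.eventually h5] with q hq
  exact hq.symm

variable {X : Type*} [TopologicalSpace X] [ChartedSpace (ℂ × ℂ) X] {M : Set X}

namespace FoliatedChart

variable (c c' : FoliatedChart M)

theorem isOpen_prod : IsOpen (c.D ×ˢ c.T) := c.isOpen_D.prod c.isOpen_T

theorem prod_mem_nhds {p : ℂ × ℝ} (hp : p ∈ c.D ×ˢ c.T) : c.D ×ˢ c.T ∈ 𝓝 p :=
  c.isOpen_prod.mem_nhds hp

theorem param_mem (p : ℂ × ℝ) : c.param p ∈ M := (c.toHomeo.symm p).2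

theorem contMDiffAt_param {p : ℂ × ℝ} (hp : p ∈ c.D ×ˢ c.T) :
    ContMDiffAt 𝓘(ℝ, ℂ × ℝ) 𝓘(ℝ, ℂ × ℂ) 3 c.param p :=
  c.smooth.contMDiffAt (c.prod_mem_nhds hp)

theorem mdifferentiableAt_param {p : ℂ × ℝ} (hp : p ∈ c.D ×ˢ c.T) :
    MDifferentiableAt 𝓘(ℝ, ℂ × ℝ) 𝓘(ℝ, ℂ × ℂ) c.param p :=
  (c.contMDiffAt_param hp).mdifferentiableAt (by simp)

theorem injOn_param : InjOn c.param (c.D ×ˢ c.T) := by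
  intro p hp q hq h
  rw [← c.target_eq] at hp hq
  exact c.toHomeo.symm.injOn hp hq (Subtype.ext h)

theorem dom_eq : c.dom = Subtype.val '' c.toHomeo.source := by
  have : c.toHomeo.source = c.toHomeo.symm '' c.toHomeo.target :=
    (c.toHomeo.symm_image_target_eq_source).symm
  rw [this, image_image, c.target_eq]
  rfl

theorem dom_subset : c.dom ⊆ M := by
  rintro _ ⟨p, _, rfl⟩
  exact c.param_mem p

theorem param_mem_dom {p : ℂ × ℝ} (hp : p ∈ c.D ×ˢ c.T) : c.param p ∈ c.dom := mem_image_of_mem _ hp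

theorem symm_mem_source_iff {m : M} : (m : X) ∈ c.dom ↔ m ∈ c.toHomeo.source := by
  rw [c.dom_eq]
  simp

theorem continuousOn_param : ContinuousOn c.param (c.D ×ˢ c.T) := c.smooth.continuousOn

/-- The change of coordinates between two foliated charts. -/
noncomputable def trans (p : ℂ × ℝ) : ℂ × ℝ := c'.toHomeo (c.toHomeo.symm p)

/-- The part of the domain of the first chart on which the second one is defined. -/
def overlap : Set (ℂ × ℝ) := {p | p ∈ c.D ×ˢ c.T ∧ c.param p ∈ c'.dom}

theorem transition_eq (z : ℂ) (t : ℝ) : c.transition c' z t = (c.trans c' (z, t)).2 := rfl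

theorem overlap_eq : c.overlap c' = (c.toHomeo.symm.trans c'.toHomeo).source := by
  ext p
  simp only [overlap, mem_ofPred_eq, OpenPartialHomeomorph.trans_source,
    OpenPartialHomeomorph.symm_source, c.target_eq, mem_inter_iff, mem_preimage]
  rw [← symm_mem_source_iff]
  rfl

theorem isOpen_overlap : IsOpen (c.overlap c') := by
  rw [overlap_eq]
  exact OpenPartialHomeomorph.open_source _

variable {c c'}

theorem trans_mem {p : ℂ × ℝ} (hp : p ∈ c.overlap c') : c.trans c' p ∈ c'.D ×ˢ c'.T := by
  rw [← c'.target_eq]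
  exact c'.toHomeo.map_source (c'.symm_mem_source_iff.1 hp.2)

theorem param_trans {p : ℂ × ℝ} (hp : p ∈ c.overlap c') : c'.param (c.trans c' p) = c.param p := by
  have h := c'.symm_mem_source_iff.1 (show ((c.toHomeo.symm p : M) : X) ∈ c'.dom from hp.2)
  exact congrArg Subtype.val (c'.toHomeo.left_inv h)

theorem trans_mem_overlap {p : ℂ × ℝ} (hp : p ∈ c.overlap c') :
    c.trans c' p ∈ c'.overlap c := by
  refine ⟨trans_mem hp, ?_⟩
  rw [param_trans hp]
  exact c.param_mem_dom hp.1

theorem trans_trans {p : ℂ × ℝ} (hp : p ∈ c.overlap c') : c'.trans c (c.trans c' p) = p := by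
  have h1 := trans_mem_overlap hp
  refine c.injOn_param (trans_mem h1) hp.1 ?_
  rw [param_trans h1, param_trans hp]

theorem continuousOn_trans : ContinuousOn (c.trans c') (c.overlap c') := by
  rw [overlap_eq]
  exact (c.toHomeo.symm.trans c'.toHomeo).continuousOn

theorem continuousAt_trans {p : ℂ × ℝ} (hp : p ∈ c.overlap c') : ContinuousAt (c.trans c') p :=
  continuousOn_trans.continuousAt ((c.isOpen_overlap c').mem_nhds hp)

variable [IsManifold 𝓘(ℂ, ℂ × ℂ) ω X]

theorem contDiffAt_chart_param {x₀ : X} {p : ℂ × ℝ} (hp : p ∈ c.D ×ˢ c.T)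
    (hx : c.param p ∈ (chartAt (ℂ × ℂ) x₀).source) :
    ContDiffAt ℝ 3 (chartAt (ℂ × ℂ) x₀ ∘ c.param) p := by
  have := isManifold_real X
  have h1 : ContMDiffAt 𝓘(ℝ, ℂ × ℂ) 𝓘(ℝ, ℂ × ℂ) 3 (chartAt (ℂ × ℂ) x₀) (c.param p) :=
    (contMDiffOn_chart (I := 𝓘(ℝ, ℂ × ℂ))).contMDiffAt
      ((chartAt (ℂ × ℂ) x₀).open_source.mem_nhds hx)
  exact (h1.comp p (c.contMDiffAt_param hp)).contDiffAt

theorem differentiableAt_chart_param {x₀ : X} {p : ℂ × ℝ} (hp : p ∈ c.D ×ˢ c.T)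
    (hx : c.param p ∈ (chartAt (ℂ × ℂ) x₀).source) :
    DifferentiableAt ℂ (fun z => chartAt (ℂ × ℂ) x₀ (c.param (z, p.2))) p.1 := by
  have h1 : MDifferentiableAt 𝓘(ℂ, ℂ × ℂ) 𝓘(ℂ, ℂ × ℂ) (chartAt (ℂ × ℂ) x₀) (c.param p) := by
    have : ContMDiffAt 𝓘(ℂ, ℂ × ℂ) 𝓘(ℂ, ℂ × ℂ) ω (chartAt (ℂ × ℂ) x₀) (c.param p) :=
      (contMDiffOn_chart (I := 𝓘(ℂ, ℂ × ℂ))).contMDiffAt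
        ((chartAt (ℂ × ℂ) x₀).open_source.mem_nhds hx)
    exact this.mdifferentiableAt (by simp)
  have h2 : MDifferentiableAt 𝓘(ℂ, ℂ) 𝓘(ℂ, ℂ × ℂ) (fun z => c.param (z, p.2)) p.1 :=
    (c.holomorphic p.2 hp.2).mdifferentiableAt (c.isOpen_D.mem_nhds hp.1)
  exact mdifferentiableAt_iff_differentiableAt.1
    (MDifferentiableAt.comp (I' := 𝓘(ℂ, ℂ × ℂ)) p.1 h1 h2)

theorem fderiv_chart_param {x₀ : X} {p : ℂ × ℝ} (hp : p ∈ c.D ×ˢ c.T)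
    (hx : c.param p ∈ (chartAt (ℂ × ℂ) x₀).source) (v : ℂ × ℝ) :
    fderiv ℝ (chartAt (ℂ × ℂ) x₀ ∘ c.param) p v = chartDeriv x₀ (c.param p) (c.dparam p v) :=
  fderiv_chart_comp (c.mdifferentiableAt_param hp) hx v

theorem fderiv_chart_param_smul {x₀ : X} {p : ℂ × ℝ} (hp : p ∈ c.D ×ˢ c.T)
    (hx : c.param p ∈ (chartAt (ℂ × ℂ) x₀).source) (ζ a : ℂ) :
    fderiv ℝ (chartAt (ℂ × ℂ) x₀ ∘ c.param) p (ζ • a, 0) =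
      ζ • fderiv ℝ (chartAt (ℂ × ℂ) x₀ ∘ c.param) p (a, 0) := by
  have h1 : ∀ ζ : ℂ, fderiv ℝ (chartAt (ℂ × ℂ) x₀ ∘ c.param) p (ζ, 0) =
      fderiv ℝ (fun z => chartAt (ℂ × ℂ) x₀ (c.param (z, p.2))) p.1 ζ := by
    intro ζ
    have h2 := ((contDiffAt_chart_param hp hx).differentiableAt (by simp)).hasFDerivAt
    have h3 : HasFDerivAt (fun z : ℂ => (z, p.2)) (ContinuousLinearMap.inl ℝ ℂ ℝ) p.1 :=
      hasFDerivAt_prodMk_left p.1 p.2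
    have h4 := HasFDerivAt.comp (g := chartAt (ℂ × ℂ) x₀ ∘ c.param) p.1 h2 h3
    have h5 := h4.fderiv
    rw [show (fun z => chartAt (ℂ × ℂ) x₀ (c.param (z, p.2))) =
      (chartAt (ℂ × ℂ) x₀ ∘ c.param) ∘ fun z => (z, p.2) from rfl, h5]
    simp
  rw [h1, h1, fderiv_real_smul (differentiableAt_chart_param hp hx)]

theorem dparam_smul {p : ℂ × ℝ} (hp : p ∈ c.D ×ˢ c.T) (ζ a : ℂ) :
    c.dparam p (ζ • a, 0) = ζ • c.dparam p (a, 0) := by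
  have hx := mem_chart_source (ℂ × ℂ) (c.param p)
  apply chartDeriv_injective hx
  rw [map_smul, ← fderiv_chart_param hp hx, ← fderiv_chart_param hp hx,
    fderiv_chart_param_smul hp hx]

theorem dparam_apply {p : ℂ × ℝ} (hp : p ∈ c.D ×ˢ c.T) (ζ : ℂ) (r : ℝ) :
    c.dparam p (ζ, r) = ζ • c.leafVec p + (r : ℂ) • c.transVec p := by
  have h1 : ((ζ, r) : ℂ × ℝ) = (ζ • (1 : ℂ), 0) + r • ((0 : ℂ), (1 : ℝ)) := by simp
  rw [h1, map_add, map_smul, dparam_smul hp]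
  simp [leafVec, transVec]

theorem dparam_injective {p : ℂ × ℝ} (hp : p ∈ c.D ×ˢ c.T) : Function.Injective (c.dparam p) :=
  c.immersion p hp

/-- The immersion condition is only real injectivity on `ℂ × ℝ`. Dividing a complex relation by the
coefficient of the transverse vector makes that coefficient the real number `1`, so the relation
lands in the range of the real differential. -/
theorem leafVec_transVec_independent {p : ℂ × ℝ} (hp : p ∈ c.D ×ˢ c.T) {μ ν : ℂ}
    (h : μ • c.leafVec p + ν • c.transVec p = 0) : μ = 0 ∧ ν = 0 := by
  have hν : ν = 0 := by
    by_contra hν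
    have h1 : c.dparam p (μ / ν, 1) = 0 := by
      rw [dparam_apply hp]
      have := congrArg (fun v => ν⁻¹ • v) h
      simp only [smul_add, smul_smul, smul_zero, inv_mul_cancel₀ hν] at this
      rw [← this]
      simp [div_eq_inv_mul]
    have := c.dparam_injective hp (h1.trans (map_zero _).symm)
    simp at this
  subst hν
  refine ⟨?_, rfl⟩
  have h1 : c.dparam p (μ, 0) = 0 := by
    rw [dparam_apply hp]
    simpa using h
  have := c.dparam_injective hp (h1.trans (map_zero _).symm)
  simpa using this

theorem leafVec_ne_zero {p : ℂ × ℝ} (hp : p ∈ c.D ×ˢ c.T) : c.leafVec p ≠ 0 := by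
  intro h
  have := leafVec_transVec_independent hp (μ := 1) (ν := 0) (by simp [h])
  simp at this

theorem chart_param_eventually {x₀ : X} {p : ℂ × ℝ} (hp : p ∈ c.D ×ˢ c.T)
    (hx : c.param p ∈ (chartAt (ℂ × ℂ) x₀).source) :
    ∀ᶠ q in 𝓝 p, q ∈ c.D ×ˢ c.T ∧ c.param q ∈ (chartAt (ℂ × ℂ) x₀).source :=
  (eventually_mem_set.2 (c.prod_mem_nhds hp)).and
    ((c.continuousOn_param.continuousAt (c.prod_mem_nhds hp)).eventually
      ((chartAt (ℂ × ℂ) x₀).open_source.mem_nhds hx))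

/-- The transition map is a priori only a homeomorphism; it is a continuous lift of one `C³`
parametrization through another, which is an immersion. -/
theorem contDiffAt_trans {p : ℂ × ℝ} (hp : p ∈ c.overlap c') : ContDiffAt ℝ 3 (c.trans c') p := by
  set x := c.param p with hxdef
  have hx := mem_chart_source (ℂ × ℂ) x
  have hx' : c'.param (c.trans c' p) ∈ (chartAt (ℂ × ℂ) x).source := by rwa [param_trans hp]
  refine contDiffAt_of_comp_immersion (by simp) (contDiffAt_chart_param (trans_mem hp) hx') ?_
    (continuousAt_trans hp) ?_
  · intro v w hvw
    rw [fderiv_chart_param (trans_mem hp) hx', fderiv_chart_param (trans_mem hp) hx'] at hvw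
    exact c'.dparam_injective (trans_mem hp) (chartDeriv_injective hx' hvw)
  · refine (contDiffAt_chart_param hp.1 hx).congr_of_eventuallyEq ?_
    filter_upwards [(c.isOpen_overlap c').mem_nhds hp] with q hq
    simp [param_trans hq]

theorem dparam_trans {p : ℂ × ℝ} (hp : p ∈ c.overlap c') (v : ℂ × ℝ) :
    c.dparam p v = c'.dparam (c.trans c' p) (fderiv ℝ (c.trans c') p v) := by
  have hx := mem_chart_source (ℂ × ℂ) (c.param p)
  have hx' : c'.param (c.trans c' p) ∈ (chartAt (ℂ × ℂ) (c.param p)).source := by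
    rwa [param_trans hp]
  apply chartDeriv_injective hx
  rw [← fderiv_chart_param hp.1 hx]
  have e : chartAt (ℂ × ℂ) (c.param p) ∘ c.param =ᶠ[𝓝 p]
      (chartAt (ℂ × ℂ) (c.param p) ∘ c'.param) ∘ c.trans c' := by
    filter_upwards [(c.isOpen_overlap c').mem_nhds hp] with q hq
    simp [param_trans hq]
  rw [e.fderiv_eq, fderiv_comp p
    ((contDiffAt_chart_param (trans_mem hp) hx').differentiableAt (by simp))
    ((contDiffAt_trans hp).differentiableAt (by simp)), ContinuousLinearMap.comp_apply,
    fderiv_chart_param (trans_mem hp) hx', param_trans hp]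

/-- A transition map preserves the leaves to first order and is holomorphic along them: both
leafwise differentials are complex linear, while the transverse component has to be real. -/
theorem fderiv_trans_leaf {p : ℂ × ℝ} (hp : p ∈ c.overlap c') (ζ : ℂ) :
    fderiv ℝ (c.trans c') p (ζ, 0) = (ζ * (fderiv ℝ (c.trans c') p (1, 0)).1, 0) := by
  set L := fderiv ℝ (c.trans c') p with hL
  have h1 : ∀ ζ : ℂ, ζ • c'.dparam (c.trans c' p) (L (1, 0)) =
      c'.dparam (c.trans c' p) (L (ζ, 0)) := by
    intro ζ
    rw [← dparam_trans hp, ← dparam_trans hp, ← dparam_smul hp.1]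
    simp
  have h2 : ∀ ζ : ℂ, ζ * (L (1, 0)).1 = (L (ζ, 0)).1 ∧ ζ * (L (1, 0)).2 = ((L (ζ, 0)).2 : ℂ) := by
    intro ζ
    have h := h1 ζ
    rw [← Prod.mk.eta (p := L (1, 0)), ← Prod.mk.eta (p := L (ζ, 0)),
      dparam_apply (trans_mem hp), dparam_apply (trans_mem hp)] at h
    have := leafVec_transVec_independent (trans_mem hp) (μ := ζ * (L (1, 0)).1 - (L (ζ, 0)).1)
      (ν := ζ * (L (1, 0)).2 - (L (ζ, 0)).2) (by
      rw [sub_smul, sub_smul]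
      rw [smul_add, smul_smul, smul_smul] at h
      linear_combination (exp := 1) h)
    exact ⟨sub_eq_zero.1 this.1, sub_eq_zero.1 this.2⟩
  -- For `ζ = i` complex linearity says that `i` times a real number is real.
  have h3 : (L (1, 0)).2 = 0 := by
    have := congrArg Complex.im (h2 Complex.I).2
    simpa using this
  have h4 := (h2 ζ).2
  rw [h3] at h4
  refine Prod.ext (h2 ζ).1.symm ?_
  simpa using h4.symm

theorem leafVec_trans {p : ℂ × ℝ} (hp : p ∈ c.overlap c') :
    c.leafVec p = (fderiv ℝ (c.trans c') p (1, 0)).1 • c'.leafVec (c.trans c' p) := by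
  rw [leafVec, dparam_trans hp, fderiv_trans_leaf hp, dparam_apply (trans_mem hp)]
  simp

theorem transVec_trans {p : ℂ × ℝ} (hp : p ∈ c.overlap c') :
    c.transVec p = (fderiv ℝ (c.trans c') p (0, 1)).1 • c'.leafVec (c.trans c' p) +
      ((fderiv ℝ (c.trans c') p (0, 1)).2 : ℂ) • c'.transVec (c.trans c' p) := by
  rw [transVec, dparam_trans hp, ← dparam_apply (trans_mem hp)]

theorem fderiv_trans_injective {p : ℂ × ℝ} (hp : p ∈ c.overlap c') :
    Function.Injective (fderiv ℝ (c.trans c') p) := by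
  intro v w h
  apply c.dparam_injective hp.1
  rw [dparam_trans hp, dparam_trans hp, h]

theorem fderiv_trans_leaf_ne_zero {p : ℂ × ℝ} (hp : p ∈ c.overlap c') :
    (fderiv ℝ (c.trans c') p (1, 0)).1 ≠ 0 := by
  intro h
  have := leafVec_trans hp
  rw [h, zero_smul] at this
  exact leafVec_ne_zero hp.1 this

theorem fderiv_trans_transverse_ne_zero {p : ℂ × ℝ} (hp : p ∈ c.overlap c') :
    (fderiv ℝ (c.trans c') p (0, 1)).2 ≠ 0 := by
  intro h
  have h1 := transVec_trans hp
  rw [h] at h1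
  have h2 : fderiv ℝ (c.trans c') p ((fderiv ℝ (c.trans c') p (0, 1)).1 /
      (fderiv ℝ (c.trans c') p (1, 0)).1, 0) = fderiv ℝ (c.trans c') p (0, 1) := by
    rw [fderiv_trans_leaf hp, div_mul_cancel₀ _ (fderiv_trans_leaf_ne_zero hp)]
    exact Prod.ext rfl h.symm
  have := fderiv_trans_injective hp h2
  simp at this

theorem hasDerivAt_transition {z : ℂ} {t : ℝ} (hp : (z, t) ∈ c.overlap c') :
    HasDerivAt (c.transition c' z) (fderiv ℝ (c.trans c') (z, t) (0, 1)).2 t := by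
  have h1 := ((contDiffAt_trans hp).differentiableAt (by simp)).hasFDerivAt.snd
  have h2 : HasDerivAt (fun t : ℝ => (z, t)) ((0 : ℂ), (1 : ℝ)) t :=
    (hasDerivAt_const t z).prodMk (hasDerivAt_id t)
  exact h1.comp_hasDerivAt t h2

theorem hasDerivAt_trans_leaf {z : ℂ} {t : ℝ} (hp : (z, t) ∈ c.overlap c') :
    HasDerivAt (fun z => (c.trans c' (z, t)).1) (fderiv ℝ (c.trans c') (z, t) (1, 0)).1 z := by
  have h1 := ((contDiffAt_trans hp).differentiableAt (by simp)).hasFDerivAt.fst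
  have h2 := HasFDerivAt.comp (f := fun w : ℂ => (w, t)) (g := fun p => (c.trans c' p).1) z h1
    (hasFDerivAt_prodMk_left (𝕜 := ℝ) z t)
  rw [hasDerivAt_iff_hasFDerivAt]
  refine hasFDerivAt_of_restrictScalars ℝ h2 ?_
  ext1 ζ
  simp [fderiv_trans_leaf hp ζ]

theorem hasFDerivAt_trans_leaf_snd {z : ℂ} {t : ℝ} (hp : (z, t) ∈ c.overlap c') :
    HasFDerivAt (fun z => (c.trans c' (z, t)).2) (0 : ℂ →L[ℝ] ℝ) z := by
  have h1 := ((contDiffAt_trans hp).differentiableAt (by simp)).hasFDerivAt.snd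
  have h2 := HasFDerivAt.comp (f := fun w : ℂ => (w, t)) (g := fun p => (c.trans c' p).2) z h1
    (hasFDerivAt_prodMk_left (𝕜 := ℝ) z t)
  refine h2.congr_fderiv ?_
  ext1 ζ
  simp [fderiv_trans_leaf hp ζ]

/-- On a convex piece of a plaque the second transverse coordinate is constant. -/
theorem trans_snd_eq {D : Set ℂ} (hD : Convex ℝ D) {t : ℝ} (h : ∀ z ∈ D, (z, t) ∈ c.overlap c')
    {z w : ℂ} (hz : z ∈ D) (hw : w ∈ D) : (c.trans c' (z, t)).2 = (c.trans c' (w, t)).2 := by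
  have := hD.norm_image_sub_le_of_norm_hasFDerivWithin_le (C := 0)
    (f := fun z => (c.trans c' (z, t)).2) (f' := fun _ => 0)
    (fun x hx => (hasFDerivAt_trans_leaf_snd (h x hx)).hasFDerivWithinAt) (by simp) hw hz
  simpa [sub_eq_zero] using this

/-- The function `δ` vanishes identically on the parametrized hypersurface. -/
theorem diff_dparam {δ : X → ℝ} (hδ : ∀ x ∈ M, C3At δ x) (h0 : ∀ x ∈ M, δ x = 0) {p : ℂ × ℝ}
    (hp : p ∈ c.D ×ˢ c.T) (v : ℂ × ℝ) : diff δ (c.param p) (c.dparam p v) = 0 := by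
  have hx := mem_chart_source (ℂ × ℂ) (c.param p)
  rw [diff_eq (hδ _ (c.param_mem p)) hx, ← fderiv_chart_param hp hx]
  have h1 := ((hδ _ (c.param_mem p)).contDiffAt hx).differentiableAt (by simp)
  have h2 := (contDiffAt_chart_param hp hx).differentiableAt (by simp)
  have h3 := fderiv_comp p (g := δ ∘ (chartAt (ℂ × ℂ) (c.param p)).symm) h1 h2
  have h4 : (δ ∘ (chartAt (ℂ × ℂ) (c.param p)).symm) ∘ (chartAt (ℂ × ℂ) (c.param p) ∘ c.param)
      =ᶠ[𝓝 p] fun _ => (0 : ℝ) := by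
    filter_upwards [chart_param_eventually hp hx] with q hq
    simp [hq.2, h0 _ (c.param_mem q)]
  rw [h4.fderiv_eq] at h3
  have := congrArg (fun L => L v) h3
  simpa using this.symm

/-- The two transverse vectors differ by a leaf vector, and `i` times a leaf vector is still tangent
to the hypersurface, so `dδ` only sees the transverse factor. -/
theorem normalMetric_trans {δ : X → ℝ} (hδ : ∀ x ∈ M, C3At δ x) (h0 : ∀ x ∈ M, δ x = 0)
    {p : ℂ × ℝ} (hp : p ∈ c.overlap c') :
    c.normalMetric δ p =
      |(fderiv ℝ (c.trans c') p (0, 1)).2| * c'.normalMetric δ (c.trans c' p) := by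
  unfold normalMetric
  rw [transVec_trans hp, smul_add, map_add, smul_smul, param_trans hp,
    smul_comm Complex.I ((fderiv ℝ (c.trans c') p (0, 1)).2 : ℂ)]
  have h1 := diff_dparam hδ h0 (trans_mem hp)
    (Complex.I * (fderiv ℝ (c.trans c') p (0, 1)).1, 0)
  rw [dparam_apply (trans_mem hp), param_trans hp] at h1
  simp only [Complex.ofReal_zero, zero_smul, add_zero] at h1
  rw [h1, zero_add, Complex.coe_smul, map_smul, smul_eq_mul, abs_mul]

/-- If `dδ` killed `i φ_t` as well as the tangent space of the hypersurface, it would vanish on the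
whole tangent space, since `φ_z` and `φ_t` form a complex basis. -/
theorem normalMetric_pos {δ : X → ℝ} (hδ : ∀ x ∈ M, C3At δ x) (h0 : ∀ x ∈ M, δ x = 0)
    (hd : ∀ x ∈ M, diff δ x ≠ 0) {p : ℂ × ℝ} (hp : p ∈ c.D ×ˢ c.T) : 0 < c.normalMetric δ p := by
  refine abs_pos.2 fun h => hd _ (c.param_mem p) ?_
  have hspan : Function.Surjective (fun q : ℂ × ℂ => q.1 • c.leafVec p + q.2 • c.transVec p) := by
    let L : (ℂ × ℂ) →ₗ[ℂ] (ℂ × ℂ) :=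
      (LinearMap.fst ℂ ℂ ℂ).smulRight (c.leafVec p) + (LinearMap.snd ℂ ℂ ℂ).smulRight (c.transVec p)
    have hL : Function.Surjective L := by
      apply LinearMap.surjective_of_injective
      rw [← LinearMap.ker_eq_bot, LinearMap.ker_eq_bot']
      intro m hm
      have := leafVec_transVec_independent hp (μ := m.1) (ν := m.2) (by simpa [L] using hm)
      exact Prod.ext this.1 this.2
    intro v
    obtain ⟨q, hq⟩ := hL v
    exact ⟨q, by simpa [L] using hq⟩
  refine ContinuousLinearMap.ext fun v => ?_
  obtain ⟨⟨μ, ν⟩, rfl⟩ := hspan v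
  have h1 := diff_dparam hδ h0 hp (μ, ν.re)
  rw [dparam_apply hp] at h1
  have h2 : μ • c.leafVec p + ν • c.transVec p = (μ • c.leafVec p + (ν.re : ℂ) • c.transVec p) +
      ν.im • (Complex.I • c.transVec p) := by
    rw [add_assoc, ← Complex.coe_smul, smul_smul, ← add_smul, Complex.re_add_im]
  simp only
  rw [h2, map_add, h1, map_smul, h]
  simp

end FoliatedChart

variable [IsManifold 𝓘(ℂ, ℂ × ℂ) ω X]

theorem LeafwiseMetric.density_trans (g : LeafwiseMetric M) {c c' : FoliatedChart M} {p : ℂ × ℝ}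
    (hp : p ∈ c.overlap c') :
    g.density c p =
      ‖(fderiv ℝ (c.trans c') p (1, 0)).1‖ ^ 2 * g.density c' (c.trans c' p) := by
  unfold density
  rw [FoliatedChart.leafVec_trans hp, FoliatedChart.param_trans hp]
  simp only [map_smulₛₗ, LinearMap.smul_apply, smul_eq_mul, RingHom.id_apply]
  rw [← mul_assoc, Complex.mul_conj, Complex.re_ofReal_mul,
    Complex.normSq_eq_norm_sq]

theorem LeafwiseMetric.density_pos (g : LeafwiseMetric M) {c : FoliatedChart M} {p : ℂ × ℝ}
    (hp : p ∈ c.D ×ˢ c.T) : 0 < g.density c p :=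
  g.pos _ (c.param_mem p) _ ⟨c, p, hp, rfl, 1, by simp⟩ (FoliatedChart.leafVec_ne_zero hp)

theorem LeafwiseMetric.continuousOn_density (g : LeafwiseMetric M) (c : FoliatedChart M) :
    ContinuousOn (g.density c) (c.D ×ˢ c.T) :=
  Complex.continuous_re.comp_continuousOn (g.continuous c)

end LeviFlat

/-! ### Change of variables for Hausdorff measure on the line. -/

namespace LeviFlat

open Measure in
/-- A map of the line with a non-zero strict derivative scales Hausdorff measure locally by the
power of the derivative, up to a factor as close to `1` as desired. -/
theorem _root_.HasStrictDerivAt.exists_hausdorffMeasure_image {ψ : ℝ → ℝ} {m t₀ : ℝ}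
    (hψ : HasStrictDerivAt ψ m t₀) (hm : m ≠ 0) {r : ℝ} (hr : 1 < r) {d : ℝ} (hd : 0 ≤ d) :
    ∃ U ∈ 𝓝 t₀, ∀ A ⊆ U,
      hausdorffMeasure d (ψ '' A) ≤ ENNReal.ofReal ((r * |m|) ^ d) * hausdorffMeasure d A ∧
      ENNReal.ofReal ((|m| / r) ^ d) * hausdorffMeasure d A ≤ hausdorffMeasure d (ψ '' A) := by
  have hm' : 0 < |m| := abs_pos.2 hm
  have hr0 : 0 < r := by linarith
  -- Chosen so that `|m| - ε = |m| / r`; then `|m| + ε ≤ r |m|` follows from `r + 1/r ≥ 2`. On `U`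
  -- the map is bi-Lipschitz with these two constants.
  set ε := |m| * (1 - 1 / r) with hε
  have h1r : 1 / r < 1 := by rw [div_lt_one hr0]; exact hr
  have hε0 : 0 < ε := mul_pos hm' (by linarith)
  have hup : |m| + ε ≤ r * |m| := by
    have : 2 ≤ r + 1 / r := by
      rw [ge_iff_le.symm, ge_iff_le, ← sub_nonneg]
      have : r + 1 / r - 2 = (r - 1) ^ 2 / r := by field_simp; ring
      rw [this]; positivity
    rw [hε]; nlinarith
  have hlo : |m| - ε = |m| / r := by rw [hε]; ring
  obtain ⟨U, hU, hUε⟩ : ∃ U ∈ 𝓝 t₀, ∀ x ∈ U, ∀ y ∈ U, |ψ x - ψ y - m * (x - y)| ≤ ε * |x - y| := by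
    have h1 := hψ.isLittleO.def hε0
    rw [nhds_prod_eq] at h1
    obtain ⟨U, hU, h2⟩ := Filter.eventually_prod_self_iff (r := fun x y => ‖ψ x - ψ y -
      (ContinuousLinearMap.toSpanSingleton ℝ m) (x - y)‖ ≤ ε * ‖x - y‖) |>.1 h1
    refine ⟨U, hU, fun x hx y hy => ?_⟩
    have := h2 x hx y hy
    simpa [mul_comm] using this
  have hLip : ∀ x ∈ U, ∀ y ∈ U, |ψ x - ψ y| ≤ r * |m| * |x - y| := by
    intro x hx y hy
    have h1 := hUε x hx y hy
    have h2 := abs_sub_abs_le_abs_sub (ψ x - ψ y) (m * (x - y))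
    rw [abs_mul] at h2
    nlinarith [abs_nonneg (x - y)]
  have hAnti : ∀ x ∈ U, ∀ y ∈ U, |m| / r * |x - y| ≤ |ψ x - ψ y| := by
    intro x hx y hy
    have h1 := hUε x hx y hy
    have h2 := abs_sub_abs_le_abs_sub (m * (x - y)) (ψ x - ψ y)
    rw [abs_sub_comm _ (ψ x - ψ y), abs_mul] at h2
    rw [← hlo]
    nlinarith
  have hmr : 0 < |m| / r := by positivity
  have hinj : InjOn ψ U := by
    intro x hx y hy hxy
    have := hAnti x hx y hy
    rw [hxy, sub_self, abs_zero] at this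
    have h3 : |x - y| ≤ 0 := by
      by_contra hlt
      push Not at hlt
      have := mul_pos hmr hlt
      linarith
    exact sub_eq_zero.1 (abs_eq_zero.1 (le_antisymm h3 (abs_nonneg _)))
  refine ⟨U, hU, fun A hA => ⟨?_, ?_⟩⟩
  · have hL : LipschitzOnWith (Real.toNNReal (r * |m|)) ψ A := by
      refine LipschitzOnWith.of_dist_le_mul fun x hx y hy => ?_
      rw [Real.coe_toNNReal _ (by positivity)]
      exact hLip x (hA hx) y (hA hy)
    refine (hL.hausdorffMeasure_image_le hd).trans_eq ?_
    rw [← ENNReal.ofReal_rpow_of_nonneg (by positivity) hd]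
    rfl
  · have hL : LipschitzOnWith (Real.toNNReal (|m| / r)⁻¹) (Function.invFunOn ψ U) (ψ '' A) := by
      refine LipschitzOnWith.of_dist_le_mul ?_
      rintro _ ⟨x, hx, rfl⟩ _ ⟨y, hy, rfl⟩
      rw [Real.coe_toNNReal _ (by positivity), hinj.leftInvOn_invFunOn (hA hx),
        hinj.leftInvOn_invFunOn (hA hy), ← div_eq_inv_mul, le_div_iff₀ hmr, mul_comm]
      exact hAnti x (hA hx) y (hA hy)
    have h1 := hL.hausdorffMeasure_image_le hd
    rw [(hinj.leftInvOn_invFunOn.mono hA).image_image] at h1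
    calc ENNReal.ofReal ((|m| / r) ^ d) * hausdorffMeasure d A
        ≤ ENNReal.ofReal ((|m| / r) ^ d) *
          (ENNReal.ofReal (((|m| / r)⁻¹) ^ d) * hausdorffMeasure d (ψ '' A)) := by
          gcongr
          refine h1.trans_eq ?_
          rw [← ENNReal.ofReal_rpow_of_nonneg (by positivity) hd]
          rfl
      _ = hausdorffMeasure d (ψ '' A) := by
          rw [← mul_assoc, ← ENNReal.ofReal_mul (by positivity), ← Real.mul_rpow hmr.le
            (by positivity), mul_inv_cancel₀ hmr.ne', Real.one_rpow, ENNReal.ofReal_one, one_mul]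

open Measure in
/-- Change of variables for Hausdorff measures on the line. -/
theorem hausdorffMeasure_image_eq_lintegral {d : ℝ} (hd : 0 ≤ d) {ψ ψ' : ℝ → ℝ} {B : Set ℝ}
    (hB : MeasurableSet B) (hψ : ∀ t ∈ B, HasStrictDerivAt ψ (ψ' t) t) (h0 : ∀ t ∈ B, ψ' t ≠ 0)
    (hc : ∀ t ∈ B, ContinuousAt ψ' t) (hinj : InjOn ψ B) :
    hausdorffMeasure d (ψ '' B) =
      ∫⁻ t in B, ENNReal.ofReal (|ψ' t| ^ d) ∂(hausdorffMeasure d) := by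
  rcases B.eq_empty_or_nonempty with rfl | hBne
  · simp
  -- Both inequalities with an error factor `(r r)^d`, to be sent to `1`. One factor `r` is the
  -- bi-Lipschitz distortion, the other the oscillation of the derivative on a small piece; a
  -- countable disjoint decomposition sums the local estimates.
  have key : ∀ r : ℝ, 1 < r →
      hausdorffMeasure d (ψ '' B) ≤ ENNReal.ofReal ((r * r) ^ d) *
        ∫⁻ t in B, ENNReal.ofReal (|ψ' t| ^ d) ∂(hausdorffMeasure d) ∧
      ∫⁻ t in B, ENNReal.ofReal (|ψ' t| ^ d) ∂(hausdorffMeasure d) ≤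
        ENNReal.ofReal ((r * r) ^ d) * hausdorffMeasure d (ψ '' B) := by
    intro r hr
    have hr0 : 0 < r := by linarith
    have hloc : ∀ t ∈ B, ∃ U, IsOpen U ∧ t ∈ U ∧ ∀ A ⊆ U ∩ B, MeasurableSet A →
        hausdorffMeasure d (ψ '' A) ≤ ENNReal.ofReal ((r * r) ^ d) *
          ∫⁻ t in A, ENNReal.ofReal (|ψ' t| ^ d) ∂(hausdorffMeasure d) ∧
        ∫⁻ t in A, ENNReal.ofReal (|ψ' t| ^ d) ∂(hausdorffMeasure d) ≤
          ENNReal.ofReal ((r * r) ^ d) * hausdorffMeasure d (ψ '' A) := by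
      intro t ht
      have hm' : 0 < |ψ' t| := abs_pos.2 (h0 t ht)
      obtain ⟨U, hU, hUA⟩ := (hψ t ht).exists_hausdorffMeasure_image (h0 t ht) hr hd
      have hlt : |ψ' t| < r * |ψ' t| := by nlinarith
      have hgt : |ψ' t| / r < |ψ' t| := by rw [div_lt_iff₀ hr0]; nlinarith
      have hV := ((hc t ht).abs.eventually (Ioo_mem_nhds hgt hlt))
      obtain ⟨W, hW, hWo, htW⟩ := mem_nhds_iff.1 (inter_mem hU hV)
      refine ⟨W, hWo, htW, fun A hA hAm => ?_⟩
      obtain ⟨h1, h2⟩ := hUA A (fun x hx => (hW (hA hx).1).1)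
      have hb : ∀ x ∈ A, |ψ' t| / r < |ψ' x| ∧ |ψ' x| < r * |ψ' t| := fun x hx => (hW (hA hx).1).2
      constructor
      · refine h1.trans ?_
        rw [← setLIntegral_const, ← lintegral_const_mul' _ _ ENNReal.ofReal_ne_top]
        refine setLIntegral_mono' hAm fun x hx => ?_
        rw [← ENNReal.ofReal_mul (by positivity), ← Real.mul_rpow (by positivity) (abs_nonneg _)]
        refine ENNReal.ofReal_le_ofReal (Real.rpow_le_rpow (by positivity) ?_ hd)
        have := (hb x hx).1
        rw [div_lt_iff₀ hr0] at this
        nlinarith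
      · refine le_trans ?_ (mul_le_mul_right h2 _)
        rw [← mul_assoc, ← ENNReal.ofReal_mul (by positivity), ← Real.mul_rpow (by positivity)
          (by positivity), ← setLIntegral_const]
        refine setLIntegral_mono' hAm fun x hx => ?_
        refine ENNReal.ofReal_le_ofReal (Real.rpow_le_rpow (by positivity) ?_ hd)
        have := (hb x hx).2
        have e : r * r * (|ψ' t| / r) = r * |ψ' t| := by field_simp
        rw [e]; exact this.le
    choose! U hUo hUm hUA using hloc
    obtain ⟨s, hsB, hsc, hBs⟩ := TopologicalSpace.countable_cover_nhdsWithin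
      (fun t ht => mem_nhdsWithin_of_mem_nhds ((hUo t ht).mem_nhds (hUm t ht)))
    have hsne : s.Nonempty := by
      obtain ⟨b, hb⟩ := hBne
      have := hBs hb
      simp only [mem_iUnion] at this
      obtain ⟨i, hi, _⟩ := this
      exact ⟨i, hi⟩
    obtain ⟨e, rfl⟩ := hsc.exists_eq_range hsne
    have he : ∀ n, e n ∈ B := fun n => hsB (mem_range_self n)
    set V : ℕ → Set ℝ := disjointed fun n => U (e n) with hV
    have hVm : ∀ n, MeasurableSet (V n) :=
      fun n => MeasurableSet.disjointed (fun i => (hUo _ (he i)).measurableSet) n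
    have hBV : B = ⋃ n, B ∩ V n := by
      rw [← inter_iUnion, hV, iUnion_disjointed]
      refine (inter_eq_left.2 (hBs.trans ?_)).symm
      simp
    have hdis : Pairwise (Function.onFun Disjoint fun n => B ∩ V n) := fun i j hij =>
      (disjoint_disjointed _ hij).mono inter_subset_right inter_subset_right
    have hm : ∀ n, MeasurableSet (B ∩ V n) := fun n => hB.inter (hVm n)
    have hcont : ContinuousOn ψ B :=
      fun t ht => (hψ t ht).hasDerivAt.continuousAt.continuousWithinAt
    have him : hausdorffMeasure d (ψ '' B) = ∑' n, hausdorffMeasure d (ψ '' (B ∩ V n)) := by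
      conv_lhs => rw [hBV, image_iUnion]
      refine measure_iUnion ?_ fun n => ?_
      · intro i j hij
        exact (hdis hij).image hinj inter_subset_left inter_subset_left
      · exact (hm n).image_of_continuousOn_injOn (hcont.mono inter_subset_left)
          (hinj.mono inter_subset_left)
    have hint : ∫⁻ t in B, ENNReal.ofReal (|ψ' t| ^ d) ∂(hausdorffMeasure d) =
        ∑' n, ∫⁻ t in B ∩ V n, ENNReal.ofReal (|ψ' t| ^ d) ∂(hausdorffMeasure d) := by
      conv_lhs => rw [hBV]
      exact lintegral_iUnion hm hdis _
    have hsub : ∀ n, B ∩ V n ⊆ U (e n) ∩ B := fun n x hx => ⟨disjointed_subset _ n hx.2, hx.1⟩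
    rw [him, hint, ← ENNReal.tsum_mul_left, ← ENNReal.tsum_mul_left]
    exact ⟨ENNReal.tsum_le_tsum fun n => (hUA _ (he n) _ (hsub n) (hm n)).1,
      ENNReal.tsum_le_tsum fun n => (hUA _ (he n) _ (hsub n) (hm n)).2⟩
  have hlim : ∀ b : ℝ≥0∞, Tendsto (fun r : ℝ => ENNReal.ofReal ((r * r) ^ d) * b) (𝓝[>] 1) (𝓝 b) := by
    intro b
    have h1 : Tendsto (fun r : ℝ => ENNReal.ofReal ((r * r) ^ d)) (𝓝[>] 1) (𝓝 1) := by
      have : ContinuousAt (fun r : ℝ => (r * r) ^ d) 1 :=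
        (continuousAt_id.mul continuousAt_id).rpow_const (by simp)
      have h2 := (ENNReal.continuous_ofReal.continuousAt.comp this).tendsto
      simp only [Function.comp_def, mul_one, Real.one_rpow, ENNReal.ofReal_one] at h2
      exact h2.mono_left nhdsWithin_le_nhds
    simpa using ENNReal.Tendsto.mul_const h1 (Or.inl one_ne_zero) (b := b)
  apply le_antisymm
  · refine ge_of_tendsto (hlim _) ?_
    filter_upwards [self_mem_nhdsWithin] with r hr using (key r hr).1
  · refine ge_of_tendsto (hlim _) ?_
    filter_upwards [self_mem_nhdsWithin] with r hr using (key r hr).2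

end LeviFlat

/-! ### Transversals of saturated sets and the local measures. -/

namespace LeviFlat

/-- Finiteness is assumed only on compact subsets of the open set `T`. As `T` is σ-compact, a
compact exhaustion, enlarged by the null set `Aᶜ`, exhausts the line; this makes Tonelli's theorem
available. -/
theorem sigmaFinite_restrict_of_isOpen {T A : Set ℝ} {μ : Measure ℝ} (hT : IsOpen T) (hA : A ⊆ T)
    (hAm : MeasurableSet A) (h : ∀ K ⊆ T, IsCompact K → μ (A ∩ K) < ⊤) :
    SigmaFinite (μ.restrict A) := by
  have : LocallyCompactSpace T := hT.locallyCompactSpace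
  obtain ⟨K, hK, hKT⟩ : IsSigmaCompact T := by
    have := (isSigmaCompact_univ (X := T)).image continuous_subtype_val
    simpa using this
  refine ⟨⟨⟨fun n => K n ∪ Aᶜ, fun _ => trivial, fun n => ?_, ?_⟩⟩⟩
  · rw [Measure.restrict_apply' hAm, union_inter_distrib_right, compl_inter_self, union_empty,
      inter_comm]
    exact h _ (hKT ▸ subset_iUnion K n) (hK n)
  · rw [← iUnion_union, hKT]
    exact eq_univ_of_forall fun x => (em (x ∈ A)).imp (fun h => hA h) id

theorem measurableSet_inter_preimage {α β : Type*} [TopologicalSpace α] [MeasurableSpace α]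
    [OpensMeasurableSpace α] [TopologicalSpace β] [MeasurableSpace β] [BorelSpace β] {f : α → β}
    {s : Set α} (hf : ContinuousOn f s) (hs : MeasurableSet s) {A : Set β} (hA : MeasurableSet A) :
    MeasurableSet (s ∩ f ⁻¹' A) := by
  have h1 : Measurable (s.domRestrict f) := (continuousOn_iff_continuous_domRestrict.1 hf).measurable
  have h2 := hs.subtype_image (h1 hA)
  convert h2 using 1
  ext x
  simp [domRestrict, and_comm]

theorem measurable_indicator_of_continuousOn {α : Type*} [TopologicalSpace α] [MeasurableSpace α]
    [OpensMeasurableSpace α] {f : α → ℝ≥0∞} {s : Set α} (hf : ContinuousOn f s)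
    (hs : MeasurableSet s) : Measurable (s.indicator f) := by
  classical
  rw [← piecewise_eq_indicator]
  exact hf.measurable_piecewise continuousOn_const hs

variable {X : Type*} [TopologicalSpace X] [ChartedSpace (ℂ × ℂ) X] {M S : Set X}

namespace FoliatedChart

variable {c c' : FoliatedChart M}

theorem param_mem_of_isSaturated (hS : IsSaturated M S) {t : ℝ} (ht : t ∈ c.T) {z w : ℂ}
    (hz : z ∈ c.D) (hw : w ∈ c.D) (h : c.param (z, t) ∈ S) : c.param (w, t) ∈ S :=
  hS.2 _ h (Relation.EqvGen.rel _ _ ⟨c, t, z, w, ht, hz, hw, rfl, rfl⟩)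

theorem mem_transversal_iff (hS : IsSaturated M S) {z : ℂ} {t : ℝ} (hp : (z, t) ∈ c.D ×ˢ c.T) :
    t ∈ c.transversal S ↔ c.param (z, t) ∈ S :=
  ⟨fun ⟨_, _, hw, h⟩ => param_mem_of_isSaturated hS hp.2 hw hp.1 h, fun h => ⟨hp.2, z, hp.1, h⟩⟩

theorem transversal_subset : c.transversal S ⊆ c.T := fun _ h => h.1

theorem measurableSet_transversal (hS : IsSaturated M S) (hSc : IsClosed S) :
    MeasurableSet (c.transversal S) := by
  obtain ⟨z, hz⟩ := c.isConnected_D.nonempty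
  have : c.transversal S = c.T ∩ (fun t => c.param (z, t)) ⁻¹' S := by
    ext t
    constructor
    · exact fun h => ⟨h.1, (mem_transversal_iff hS (show (z, t) ∈ c.D ×ˢ c.T from ⟨hz, h.1⟩)).1 h⟩
    · exact fun h => (mem_transversal_iff hS (show (z, t) ∈ c.D ×ˢ c.T from ⟨hz, h.1⟩)).2 h.2
  borelize X
  rw [this]
  refine measurableSet_inter_preimage ?_ c.isOpen_T.measurableSet hSc.measurableSet
  exact c.continuousOn_param.comp (by fun_prop) fun t ht => ⟨hz, ht⟩

theorem transition_mem_transversal_iff (hS : IsSaturated M S) {z : ℂ} {t : ℝ}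
    (hp : (z, t) ∈ c.overlap c') :
    c.transition c' z t ∈ c'.transversal S ↔ t ∈ c.transversal S := by
  rw [mem_transversal_iff hS hp.1, ← param_trans hp, transition_eq]
  exact mem_transversal_iff hS (trans_mem hp)

variable [IsManifold 𝓘(ℂ, ℂ × ℂ) ω X]

theorem normalMetric_eq {δ : X → ℝ} {x₀ : X} {p : ℂ × ℝ} (hδ : C3At δ (c.param p))
    (hp : p ∈ c.D ×ˢ c.T) (hx : c.param p ∈ (chartAt (ℂ × ℂ) x₀).source) :
    c.normalMetric δ p = |fderiv ℝ (δ ∘ (chartAt (ℂ × ℂ) x₀).symm) (chartAt (ℂ × ℂ) x₀ (c.param p))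
      (Complex.I • fderiv ℝ (chartAt (ℂ × ℂ) x₀ ∘ c.param) p (0, 1))| := by
  rw [normalMetric, diff_eq hδ hx, map_smul, fderiv_chart_param hp hx, transVec]

/-- One derivative is spent on `d` and one on `φ`, so `C³` data leave exactly the `C²` regularity
needed for a leafwise Laplacian. -/
theorem contDiffAt_signedMetric {d : ℂ × ℂ → ℝ} {φ : ℂ × ℝ → ℂ × ℂ} {p : ℂ × ℝ}
    (hd : ContDiffAt ℝ 3 d (φ p)) (hφ : ContDiffAt ℝ 3 φ p) :
    ContDiffAt ℝ 2 (fun p => fderiv ℝ d (φ p) (Complex.I • fderiv ℝ φ p (0, 1))) p := by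
  have h1 : ContDiffAt ℝ 2 (fun p => fderiv ℝ d (φ p)) p :=
    (hd.fderiv_right (m := 2) (by norm_num)).comp p (hφ.of_le (by norm_num))
  have h2 : ContDiffAt ℝ 2 (fderiv ℝ φ) p := hφ.fderiv_right (by norm_num)
  exact h1.clm_apply ((h2.clm_apply contDiffAt_const).const_smul Complex.I)

theorem continuousOn_normalMetric {δ : X → ℝ} (hδ : ∀ x ∈ M, C3At δ x) :
    ContinuousOn (c.normalMetric δ) (c.D ×ˢ c.T) := by
  intro p hp
  have hx := mem_chart_source (ℂ × ℂ) (c.param p)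
  have h1 := (contDiffAt_signedMetric ((hδ _ (c.param_mem p)).contDiffAt hx)
    (contDiffAt_chart_param hp hx)).continuousAt.abs
  refine (h1.congr ?_).continuousWithinAt
  filter_upwards [chart_param_eventually hp hx] with q hq
  exact (normalMetric_eq (hδ _ (c.param_mem q)) hq.1 hq.2).symm

end FoliatedChart

/-- The density of `h vol_g ⊗ ν` with respect to Lebesgue measure on plaques. -/
noncomputable def LeafwiseMetric.weight (g : LeafwiseMetric M) (c : FoliatedChart M)
    (h : ℂ × ℝ → ℝ) (p : ℂ × ℝ) : ℝ≥0∞ :=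
  ENNReal.ofReal (g.density c p) * ENNReal.ofReal (h p)

section LocalMeasure

variable [MeasurableSpace X] [BorelSpace X] (g : LeafwiseMetric M) (c : FoliatedChart M)
  {ν : Measure ℝ} [SFinite ν] {h : ℂ × ℝ → ℝ}

theorem continuousOn_ofReal_density :
    ContinuousOn (fun p => ENNReal.ofReal (g.density c p)) (c.D ×ˢ c.T) :=
  ENNReal.continuous_ofReal.comp_continuousOn
    (Complex.continuous_re.comp_continuousOn (g.continuous c))

theorem continuousOn_weight (hh : ContinuousOn h (c.D ×ˢ c.T)) :
    ContinuousOn (g.weight c h) (c.D ×ˢ c.T) := by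
  have : g.weight c h = fun p => ENNReal.ofReal (g.density c p * max (h p) 0) := by
    ext p
    rw [LeafwiseMetric.weight, ENNReal.ofReal_mul' (le_max_right _ _), ENNReal.ofReal_max]
    simp
  rw [this]
  exact ENNReal.continuous_ofReal.comp_continuousOn
    ((Complex.continuous_re.comp_continuousOn (g.continuous c)).mul
      (hh.sup continuousOn_const))

theorem ae_mem_prod (hν : ν c.Tᶜ = 0) :
    ∀ᵐ p ∂((volume.restrict c.D).prod ν), p ∈ c.D ×ˢ c.T := by
  have h0 : (volume.restrict c.D) c.Dᶜ = 0 := by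
    rw [Measure.restrict_apply c.isOpen_D.measurableSet.compl]
    simp
  rw [ae_iff]
  refine measure_mono_null (t := c.Dᶜ ×ˢ univ ∪ univ ×ˢ c.Tᶜ) ?_ ?_
  · intro p hp
    simp only [mem_ofPred_eq, mem_prod, not_and_or] at hp
    simpa using hp
  · rw [measure_union_null_iff, Measure.prod_prod, Measure.prod_prod, h0, hν]
    simp

theorem restrict_prod_eq (hν : ν c.Tᶜ = 0) :
    ((volume.restrict c.D).prod ν).restrict (c.D ×ˢ c.T) = (volume.restrict c.D).prod ν :=
  Measure.restrict_eq_self_of_ae_mem (ae_mem_prod c hν)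

/-- Parametrizations and densities take arbitrary values off `D × T`, but the product measure is
carried by that set. -/
theorem aemeasurable_of_continuousOn {β : Type*} [TopologicalSpace β] [MeasurableSpace β]
    [BorelSpace β] {f : ℂ × ℝ → β} (hν : ν c.Tᶜ = 0) (hf : ContinuousOn f (c.D ×ˢ c.T)) :
    AEMeasurable f ((volume.restrict c.D).prod ν) := by
  rw [← restrict_prod_eq c hν]
  have hm : MeasurableSet (c.D ×ˢ c.T) := c.isOpen_prod.measurableSet
  have : MeasurableEmbedding (Subtype.val : (c.D ×ˢ c.T : Set (ℂ × ℝ)) → ℂ × ℝ) :=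
    MeasurableEmbedding.subtype_coe hm
  rw [← map_comap_subtype_coe hm, this.aemeasurable_map_iff]
  exact (continuousOn_iff_continuous_domRestrict.1 hf).measurable.aemeasurable

theorem withDensity_volProd (hν : ν c.Tᶜ = 0) (hh : ContinuousOn h (c.D ×ˢ c.T)) :
    (g.volProd c ν).withDensity (fun p => ENNReal.ofReal (h p)) =
      ((volume.restrict c.D).prod ν).withDensity (g.weight c h) :=
  (withDensity_mul₀ (aemeasurable_of_continuousOn c hν (continuousOn_ofReal_density g c))
    (aemeasurable_of_continuousOn c hν (ENNReal.continuous_ofReal.comp_continuousOn hh))).symm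

/-- Tonelli with the plaque integral inside, so that changes of chart can be made first in `z` on
each plaque and then in `t`. -/
theorem localMeasure_apply (hν : ν c.Tᶜ = 0) (hh : ContinuousOn h (c.D ×ˢ c.T)) {A : Set X}
    (hA : MeasurableSet A) :
    g.localMeasure c ν h A =
      ∫⁻ t, ∫⁻ z : ℂ, ((c.D ×ˢ c.T) ∩ c.param ⁻¹' A).indicator (g.weight c h) (z, t) ∂volume ∂ν := by
  have hm : MeasurableSet (c.D ×ˢ c.T) := c.isOpen_prod.measurableSet
  have hW := measurableSet_inter_preimage c.continuousOn_param hm hA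
  have hpar : AEMeasurable c.param (((volume.restrict c.D).prod ν).withDensity (g.weight c h)) :=
    (aemeasurable_of_continuousOn c hν c.continuousOn_param).mono_ac
      (withDensity_absolutelyContinuous _ _)
  rw [LeafwiseMetric.localMeasure, withDensity_volProd g c hν hh,
    Measure.map_apply_of_aemeasurable hpar hA, withDensity_apply']
  have h1 : (c.param ⁻¹' A : Set (ℂ × ℝ)) =ᵐ[(volume.restrict c.D).prod ν]
      ((c.D ×ˢ c.T) ∩ c.param ⁻¹' A : Set (ℂ × ℝ)) := by
    filter_upwards [ae_mem_prod c hν] with p hp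
    exact propext ⟨fun h => ⟨hp, h⟩, fun h => h.2⟩
  rw [setLIntegral_congr h1, ← lintegral_indicator hW]
  have hmeas : Measurable (((c.D ×ˢ c.T) ∩ c.param ⁻¹' A).indicator (g.weight c h)) :=
    measurable_indicator_of_continuousOn ((continuousOn_weight g c hh).mono inter_subset_left) hW
  rw [lintegral_prod_symm' _ hmeas]
  refine lintegral_congr fun t => ?_
  rw [← lintegral_indicator c.isOpen_D.measurableSet]
  refine lintegral_congr fun z => ?_
  by_cases hz : z ∈ c.D
  · rw [indicator_of_mem hz]
  · rw [indicator_of_notMem hz, indicator_of_notMem]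
    exact fun h => hz h.1.1

end LocalMeasure

end LeviFlat

/-! ### The local measures under a change of chart. -/

namespace LeviFlat

-- The change of variables for sets identifies the restricted Hausdorff measure with a weighted
-- push-forward, which then integrates arbitrary measurable functions.
open Measure in
theorem setLIntegral_hausdorffMeasure_image {d : ℝ} (hd : 0 ≤ d) {ψ ψ' : ℝ → ℝ} {B : Set ℝ}
    (hB : MeasurableSet B) (hψ : ∀ t ∈ B, HasStrictDerivAt ψ (ψ' t) t) (h0 : ∀ t ∈ B, ψ' t ≠ 0)
    (hc : ∀ t ∈ B, ContinuousAt ψ' t) (hinj : InjOn ψ B) {G : ℝ → ℝ≥0∞} (hG : Measurable G) :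
    ∫⁻ s in ψ '' B, G s ∂(hausdorffMeasure d) =
      ∫⁻ t in B, ENNReal.ofReal (|ψ' t| ^ d) * G (ψ t) ∂(hausdorffMeasure d) := by
  have hcont : ContinuousOn ψ B :=
    fun t ht => (hψ t ht).hasDerivAt.continuousAt.continuousWithinAt
  have hψm : AEMeasurable ψ ((hausdorffMeasure d : Measure ℝ).restrict B) := hcont.aemeasurable hB
  have hw : AEMeasurable (fun t => ENNReal.ofReal (|ψ' t| ^ d))
      ((hausdorffMeasure d : Measure ℝ).restrict B) := by
    refine ContinuousOn.aemeasurable (fun t ht => ?_) hB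
    exact (ENNReal.continuous_ofReal.continuousAt.comp
      ((hc t ht).abs.rpow_const (Or.inr hd))).continuousWithinAt
  have key : (hausdorffMeasure d : Measure ℝ).restrict (ψ '' B) =
      (((hausdorffMeasure d : Measure ℝ).restrict B).withDensity
        (fun t => ENNReal.ofReal (|ψ' t| ^ d))).map ψ := by
    ext E hE
    have hE' : NullMeasurableSet (ψ ⁻¹' E) ((hausdorffMeasure d : Measure ℝ).restrict B) :=
      hψm.nullMeasurable hE
    have hBE : MeasurableSet (B ∩ ψ ⁻¹' E) := measurableSet_inter_preimage hcont hB hE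
    rw [Measure.restrict_apply hE, Measure.map_apply_of_aemeasurable
      (hψm.mono_ac (withDensity_absolutelyContinuous _ _)) hE, withDensity_apply₀ _ hE',
      Measure.restrict_restrict₀ hE', inter_comm E, ← image_inter_preimage, inter_comm _ B,
      hausdorffMeasure_image_eq_lintegral hd hBE (fun t ht => hψ t ht.1) (fun t ht => h0 t ht.1)
        (fun t ht => hc t ht.1) (hinj.mono inter_subset_left)]
  rw [key, lintegral_map' hG.aemeasurable (hψm.mono_ac (withDensity_absolutelyContinuous _ _)),
    lintegral_withDensity_eq_lintegral_mul₀ hw (g := fun a => G (ψ a)) (hG.comp_aemeasurable hψm)]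
  rfl

/-- The real Jacobian of multiplication by `a` is the field norm of `a`. -/
theorem det_smul_one (a : ℂ) : (a • (1 : ℂ →L[ℝ] ℂ)).det = ‖a‖ ^ 2 := by
  have : ((a • (1 : ℂ →L[ℝ] ℂ) : ℂ →L[ℝ] ℂ) : ℂ →ₗ[ℝ] ℂ) = Algebra.lmul ℝ ℂ a := by
    ext <;> simp
  rw [ContinuousLinearMap.det, this, ← Complex.normSq_eq_norm_sq, ← Algebra.norm_complex_apply]
  rfl

variable {X : Type*} [TopologicalSpace X] [ChartedSpace (ℂ × ℂ) X] {M S : Set X}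

namespace FoliatedChart

variable [IsManifold 𝓘(ℂ, ℂ × ℂ) ω X] {c c' : FoliatedChart M}

theorem contDiffAt_transition {z : ℂ} {t : ℝ} (hp : (z, t) ∈ c.overlap c') :
    ContDiffAt ℝ 3 (c.transition c' z) t :=
  contDiff_snd.contDiffAt.comp (f := fun t => c.trans c' (z, t)) t
    (ContDiffAt.comp (g := c.trans c') (f := fun t : ℝ => (z, t)) t (contDiffAt_trans hp)
      (contDiffAt_const.prodMk contDiffAt_id))

theorem hasStrictDerivAt_transition {z : ℂ} {t : ℝ} (hp : (z, t) ∈ c.overlap c') :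
    HasStrictDerivAt (c.transition c' z) (deriv (c.transition c' z) t) t :=
  (contDiffAt_transition hp).hasStrictDerivAt (by simp)

theorem deriv_transition_ne_zero {z : ℂ} {t : ℝ} (hp : (z, t) ∈ c.overlap c') :
    deriv (c.transition c' z) t ≠ 0 := by
  rw [(hasDerivAt_transition hp).deriv]
  exact fderiv_trans_transverse_ne_zero hp

theorem continuousAt_deriv_transition {z : ℂ} {t : ℝ} (hp : (z, t) ∈ c.overlap c') :
    ContinuousAt (deriv (c.transition c' z)) t := by
  have h1 : ContDiffAt ℝ 2 (fderiv ℝ (c.transition c' z)) t :=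
    (contDiffAt_transition hp).fderiv_right (by norm_num)
  exact (h1.clm_apply (contDiffAt_const (c := (1 : ℝ)))).continuousAt

theorem image_transition_inter (hS : IsSaturated M S) {z : ℂ} {B : Set ℝ}
    (hB : ∀ t ∈ B, (z, t) ∈ c.overlap c') :
    c.transition c' z '' B ∩ c'.transversal S = c.transition c' z '' (B ∩ c.transversal S) := by
  ext s
  constructor
  · rintro ⟨⟨t, ht, rfl⟩, h⟩
    exact ⟨t, ⟨ht, (transition_mem_transversal_iff hS (hB t ht)).1 h⟩, rfl⟩
  · rintro ⟨t, ⟨ht, h⟩, rfl⟩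
    exact ⟨⟨t, ht, rfl⟩, (transition_mem_transversal_iff hS (hB t ht)).2 h⟩

/-- The Hausdorff measures of the transversals form a conformal family. -/
theorem hausdorffMeasure_transition (hS : IsSaturated M S) (hSc : IsClosed S) {α : ℝ} (hα : 0 ≤ α)
    {z : ℂ} {B : Set ℝ} (hBm : MeasurableSet B) (hB : ∀ t ∈ B, (z, t) ∈ c.overlap c')
    (hinj : InjOn (c.transition c' z) B) :
    (Measure.hausdorffMeasure α).restrict (c'.transversal S) (c.transition c' z '' B) =
      ∫⁻ t in B, ENNReal.ofReal (|deriv (c.transition c' z) t| ^ α)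
        ∂((Measure.hausdorffMeasure α).restrict (c.transversal S)) := by
  rw [Measure.restrict_apply' (measurableSet_transversal hS hSc), image_transition_inter hS hB,
    Measure.restrict_restrict hBm]
  exact hausdorffMeasure_image_eq_lintegral hα (hBm.inter (measurableSet_transversal hS hSc))
    (fun t ht => hasStrictDerivAt_transition (hB t ht.1))
    (fun t ht => deriv_transition_ne_zero (hB t ht.1))
    (fun t ht => continuousAt_deriv_transition (hB t ht.1)) (hinj.mono inter_subset_left)

end FoliatedChart

section

variable [IsManifold 𝓘(ℂ, ℂ × ℂ) ω X] (g : LeafwiseMetric M) {c c' : FoliatedChart M}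
  {δ : X → ℝ} {α : ℝ}

/-- The squared factor is the Jacobian of the holomorphic coordinate change on plaques; the factor
with exponent `α` is the one by which `𝓗^α` changes. -/
theorem weight_trans (hδ : ∀ x ∈ M, C3At δ x) (h0 : ∀ x ∈ M, δ x = 0) {p : ℂ × ℝ}
    (hp : p ∈ c.overlap c') :
    g.weight c (fun p => c.normalMetric δ p ^ α) p =
      ENNReal.ofReal (|(fderiv ℝ (c.trans c') p (0, 1)).2| ^ α) *
        (ENNReal.ofReal (‖(fderiv ℝ (c.trans c') p (1, 0)).1‖ ^ 2) *
          g.weight c' (fun p => c'.normalMetric δ p ^ α) (c.trans c' p)) := by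
  unfold LeafwiseMetric.weight
  simp only
  rw [g.density_trans hp, FoliatedChart.normalMetric_trans hδ h0 hp,
    Real.mul_rpow (abs_nonneg _) (show 0 ≤ c'.normalMetric δ (c.trans c' p) from abs_nonneg _),
    ENNReal.ofReal_mul (by positivity),
    ENNReal.ofReal_mul (by positivity)]
  ring

/-- The measure `h_δ^α vol_g ⊗ 𝓗^α` in a foliated chart. -/
noncomputable def chartMeasure [MeasurableSpace X] (g : LeafwiseMetric M) (S : Set X) (δ : X → ℝ)
    (α : ℝ) (c : FoliatedChart M) : Measure X :=
  g.localMeasure c ((Measure.hausdorffMeasure α).restrict (c.transversal S))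
    (fun p => c.normalMetric δ p ^ α)

variable [MeasurableSpace X] [BorelSpace X]

theorem sigmaFinite_transversal (hS : IsSaturated M S) (hSc : IsClosed S)
    (hfin : HasPosFiniteTransversals M S α) (c : FoliatedChart M) :
    SigmaFinite ((Measure.hausdorffMeasure α).restrict (c.transversal S)) :=
  sigmaFinite_restrict_of_isOpen c.isOpen_T FoliatedChart.transversal_subset
    (FoliatedChart.measurableSet_transversal hS hSc) (hfin c).2

theorem restrict_transversal_compl (hS : IsSaturated M S) (hSc : IsClosed S) :
    (Measure.hausdorffMeasure α).restrict (c.transversal S) c.Tᶜ = 0 := by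
  rw [Measure.restrict_apply' (FoliatedChart.measurableSet_transversal hS hSc)]
  convert measure_empty (μ := (Measure.hausdorffMeasure α : Measure ℝ))
  exact (disjoint_compl_left_iff_subset.2 FoliatedChart.transversal_subset).inter_eq

theorem continuousOn_normalMetric_rpow (hδ : ∀ x ∈ M, C3At δ x) (hα : 0 ≤ α) :
    ContinuousOn (fun p => c.normalMetric δ p ^ α) (c.D ×ˢ c.T) :=
  (FoliatedChart.continuousOn_normalMetric hδ).rpow_const fun _ _ => Or.inr hα

theorem chartMeasure_apply (hS : IsSaturated M S) (hSc : IsClosed S)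
    (hfin : HasPosFiniteTransversals M S α) (hδ : ∀ x ∈ M, C3At δ x) (hα : 0 ≤ α)
    (c : FoliatedChart M) {A : Set X} (hA : MeasurableSet A) :
    chartMeasure g S δ α c A = ∫⁻ t in c.transversal S, ∫⁻ z : ℂ,
      ((c.D ×ˢ c.T) ∩ c.param ⁻¹' A).indicator (g.weight c fun p => c.normalMetric δ p ^ α) (z, t)
        ∂volume ∂(Measure.hausdorffMeasure α) := by
  have := sigmaFinite_transversal hS hSc hfin c
  exact localMeasure_apply g c (restrict_transversal_compl hS hSc)
    (continuousOn_normalMetric_rpow hδ hα) hA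

/-- On a small product piece of the overlap of two charts the measures `h_δ^α vol_g ⊗ 𝓗^α` of the
two charts agree. -/
theorem chartMeasure_eq_of_subset_box (hS : IsSaturated M S) (hSc : IsClosed S)
    (hfin : HasPosFiniteTransversals M S α) (hδ : ∀ x ∈ M, C3At δ x) (h0 : ∀ x ∈ M, δ x = 0)
    (hα : 0 ≤ α) {D₁ : Set ℂ} {T₁ : Set ℝ} {z₀ : ℂ} (hz₀ : z₀ ∈ D₁) (hD₁ : Convex ℝ D₁)
    (hT₁ : MeasurableSet T₁) (hQ : D₁ ×ˢ T₁ ⊆ c.overlap c')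
    (hinj : InjOn (c.transition c' z₀) T₁) {A : Set X} (hA : MeasurableSet A)
    (hAQ : A ⊆ c.param '' (D₁ ×ˢ T₁)) :
    chartMeasure g S δ α c A = chartMeasure g S δ α c' A := by
  rw [chartMeasure_apply g hS hSc hfin hδ hα c hA, chartMeasure_apply g hS hSc hfin hδ hα c' hA]
  set ψ := c.transition c' z₀ with hψ
  set F := g.weight c fun p => c.normalMetric δ p ^ α with hF
  set F' := g.weight c' fun p => c'.normalMetric δ p ^ α with hF'
  set W := (c.D ×ˢ c.T) ∩ c.param ⁻¹' A with hW
  set W' := (c'.D ×ˢ c'.T) ∩ c'.param ⁻¹' A with hW'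
  have hWm : MeasurableSet W :=
    measurableSet_inter_preimage c.continuousOn_param c.isOpen_prod.measurableSet hA
  have hWm' : MeasurableSet W' :=
    measurableSet_inter_preimage c'.continuousOn_param c'.isOpen_prod.measurableSet hA
  have hWQ : W ⊆ D₁ ×ˢ T₁ := by
    rintro p ⟨hp, hpA⟩
    obtain ⟨q, hq, hqp⟩ := hAQ hpA
    rwa [← c.injOn_param (hQ hq).1 hp hqp]
  have hov : ∀ t ∈ T₁, (z₀, t) ∈ c.overlap c' := fun t ht => hQ ⟨hz₀, ht⟩
  -- Convexity of `D₁` makes the second transverse coordinate constant on each piece of plaque, so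
  -- on the box the transition has the form `(z, t) ↦ (ζ(z, t), ψ t)`.
  have hsnd : ∀ z ∈ D₁, ∀ t ∈ T₁, (c.trans c' (z, t)).2 = ψ t := fun z hz t ht =>
    FoliatedChart.trans_snd_eq hD₁ (fun w hw => hQ ⟨hw, ht⟩) hz hz₀
  have hWW' : ∀ p ∈ D₁ ×ˢ T₁, (c.trans c' p ∈ W' ↔ p ∈ W) := by
    intro p hp
    simp only [hW, hW', mem_inter_iff, mem_preimage, FoliatedChart.param_trans (hQ hp)]
    exact and_congr_left fun _ => iff_of_true (FoliatedChart.trans_mem (hQ hp)) (hQ hp).1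
  have hW'im : ∀ q ∈ W', ∃ p ∈ W, c.trans c' p = q := by
    rintro q ⟨hq, hqA⟩
    obtain ⟨p, hp, hpq⟩ := hAQ hqA
    have e : c.trans c' p = q := c'.injOn_param (FoliatedChart.trans_mem (hQ hp)) hq
      ((FoliatedChart.param_trans (hQ hp)).trans hpq)
    exact ⟨p, (hWW' p hp).1 (e ▸ ⟨hq, hqA⟩), e⟩
  have hFm' : Measurable (W'.indicator F') := measurable_indicator_of_continuousOn
    ((continuousOn_weight g c' (continuousOn_normalMetric_rpow hδ hα)).mono inter_subset_left) hWm'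
  set I : ℝ → ℝ≥0∞ := fun t => ∫⁻ z : ℂ, W.indicator F (z, t) with hI
  set G : ℝ → ℝ≥0∞ := fun t => ∫⁻ z : ℂ, W'.indicator F' (z, t) with hG
  have hGm : Measurable G := hFm'.lintegral_prod_left'
  -- Plaque by plaque this is the planar change of variables for a holomorphic injection; its
  -- Jacobian cancels the leafwise factor of `weight_trans` and leaves the transverse factor.
  have hIG : ∀ t ∈ T₁, I t = ENNReal.ofReal (|deriv ψ t| ^ α) * G (ψ t) := by
    intro t ht
    have hWt : MeasurableSet {z : ℂ | (z, t) ∈ W} := hWm.preimage (by fun_prop)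
    have hWt' : MeasurableSet {z : ℂ | (z, ψ t) ∈ W'} := hWm'.preimage (by fun_prop)
    have hsub : ∀ z ∈ {z : ℂ | (z, t) ∈ W}, (z, t) ∈ c.overlap c' := fun z hz => hQ (hWQ hz)
    have him : (fun z => (c.trans c' (z, t)).1) '' {z : ℂ | (z, t) ∈ W} =
        {z : ℂ | (z, ψ t) ∈ W'} := by
      ext w
      constructor
      · rintro ⟨z, hz, rfl⟩
        have h1 := (hWW' _ (hWQ hz)).2 hz
        have h2 := hsnd z (hWQ hz).1 t ht
        rwa [← Prod.mk.eta (p := c.trans c' (z, t)), h2] at h1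
      · intro hw
        obtain ⟨⟨z, s⟩, hzs, h⟩ := hW'im _ hw
        have h2 := hsnd z (hWQ hzs).1 s (hWQ hzs).2
        rw [h] at h2
        have h3 : t = s := hinj ht (hWQ hzs).2 h2
        subst h3
        exact ⟨z, hzs, by simp [h]⟩
    have hinj' : InjOn (fun z => (c.trans c' (z, t)).1) {z : ℂ | (z, t) ∈ W} := by
      intro z hz w hw h
      have h1 : c.trans c' (z, t) = c.trans c' (w, t) :=
        Prod.ext h ((hsnd z (hWQ hz).1 t ht).trans (hsnd w (hWQ hw).1 t ht).symm)
      have h2 := congrArg (c'.trans c) h1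
      rw [FoliatedChart.trans_trans (hsub z hz), FoliatedChart.trans_trans (hsub w hw)] at h2
      exact congrArg Prod.fst h2
    have hjac := lintegral_image_eq_lintegral_abs_det_fderiv_mul volume hWt
      (fun z hz => (FoliatedChart.hasDerivAt_trans_leaf (hsub z hz)).complexToReal_fderiv.hasFDerivWithinAt)
      hinj' (fun w => F' (w, ψ t))
    rw [him] at hjac
    have hGt : G (ψ t) = ∫⁻ z in {z : ℂ | (z, ψ t) ∈ W'}, F' (z, ψ t) := by
      rw [← lintegral_indicator hWt']
      rfl
    have hIt : I t = ∫⁻ z in {z : ℂ | (z, t) ∈ W}, F (z, t) := by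
      rw [← lintegral_indicator hWt]
      rfl
    rw [hGt, hjac, hIt, ← lintegral_const_mul' _ _ ENNReal.ofReal_ne_top]
    refine setLIntegral_congr_fun hWt fun z hz => ?_
    rw [hF, weight_trans g hδ h0 (hsub z hz), det_smul_one, abs_of_nonneg (sq_nonneg ‖(fderiv ℝ (c.trans c') (z, t) (1, 0)).1‖),
      ← hsnd z (hWQ hz).1 t ht]
    congr 3
    rw [← (FoliatedChart.hasDerivAt_transition (hsub z hz)).deriv]
    -- The transitions along the transversals through `z` and `z₀` must agree on a full
    -- neighbourhood of `t` to have equal derivatives, but `T₁` is only measurable. Compactness of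
    -- the segment from `z` to `z₀` and openness of the overlap provide the neighbourhood.
    have e : c.transition c' z =ᶠ[𝓝 t] ψ := by
      have h1 : ∀ᶠ s in 𝓝 t, ∀ w ∈ segment ℝ z z₀, (w, s) ∈ c.overlap c' := by
        have hcomp : IsCompact (segment ℝ z z₀) := by
          rw [segment_eq_image]
          exact isCompact_Icc.image (by fun_prop)
        have hsegment : ∀ w ∈ segment ℝ z z₀, ∀ᶠ q : ℝ × ℂ in 𝓝 t ×ˢ 𝓝 w,
            (q.2, q.1) ∈ c.overlap c' := by
          intro w hw
          rw [← nhds_prod_eq]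
          have : ContinuousAt (fun q : ℝ × ℂ => (q.2, q.1)) (t, w) := by fun_prop
          exact this.eventually ((c.isOpen_overlap c').mem_nhds
            (hQ ⟨hD₁.segment_subset (hWQ hz).1 hz₀ hw, ht⟩))
        exact hcomp.eventually_forall_of_forall_eventually (fun w hw => by
          rw [nhds_prod_eq]; exact hsegment w hw)
      filter_upwards [h1] with s hs
      exact FoliatedChart.trans_snd_eq (convex_segment z z₀) hs (left_mem_segment ℝ z z₀)
        (right_mem_segment ℝ z z₀)
    rw [e.deriv_eq]
  have hI0 : I = T₁.indicator I := by
    symm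
    refine indicator_eq_self.2 fun t ht => ?_
    by_contra htT
    refine ht ?_
    rw [hI]
    show ∫⁻ z : ℂ, _ = _
    rw [← lintegral_zero (μ := (volume : Measure ℂ))]
    refine lintegral_congr fun z => indicator_of_notMem (fun h => htT (hWQ h).2) _
  have hG0 : G = (ψ '' T₁).indicator G := by
    symm
    refine indicator_eq_self.2 fun s hs => ?_
    by_contra hsT
    refine hs ?_
    rw [hG]
    show ∫⁻ z : ℂ, _ = _
    rw [← lintegral_zero (μ := (volume : Measure ℂ))]
    refine lintegral_congr fun z => indicator_of_notMem (fun h => hsT ?_) _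
    obtain ⟨⟨w, t⟩, hp, e⟩ := hW'im _ h
    refine ⟨t, (hWQ hp).2, ?_⟩
    rw [← hsnd w (hWQ hp).1 t (hWQ hp).2, e]
  have hψc : ContinuousOn ψ T₁ := fun t ht =>
    (FoliatedChart.contDiffAt_transition (hov t ht)).continuousAt.continuousWithinAt
  have hTr := FoliatedChart.measurableSet_transversal (c := c) hS hSc
  rw [hI0, hG0, setLIntegral_indicator hT₁,
    setLIntegral_indicator (hT₁.image_of_continuousOn_injOn hψc hinj),
    FoliatedChart.image_transition_inter hS hov,
    setLIntegral_hausdorffMeasure_image hα (hT₁.inter hTr)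
      (fun t ht => FoliatedChart.hasStrictDerivAt_transition (hov t ht.1))
      (fun t ht => FoliatedChart.deriv_transition_ne_zero (hov t ht.1))
      (fun t ht => FoliatedChart.continuousAt_deriv_transition (hov t ht.1))
      (hinj.mono inter_subset_left) hGm]
  exact setLIntegral_congr_fun (hT₁.inter hTr) fun t ht => hIG t ht.1

end

end LeviFlat

/-! ### Gluing the local measures. -/

namespace LeviFlat

variable {X : Type*} [TopologicalSpace X] [ChartedSpace (ℂ × ℂ) X] {M S : Set X}
  [IsManifold 𝓘(ℂ, ℂ × ℂ) ω X] (g : LeafwiseMetric M) {c c' : FoliatedChart M}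
  {δ : X → ℝ} {α : ℝ}

theorem exists_injOn_nhds_of_hasStrictDerivAt {f : ℝ → ℝ} {f' a : ℝ} (hf : HasStrictDerivAt f f' a)
    (hf' : f' ≠ 0) : ∃ U ∈ 𝓝 a, InjOn f U := by
  have h := hf.hasStrictFDerivAt_equiv hf'
  exact ⟨(h.toOpenPartialHomeomorph f).source,
    (h.toOpenPartialHomeomorph f).open_source.mem_nhds h.mem_toOpenPartialHomeomorph_source,
    (h.toOpenPartialHomeomorph f).injOn⟩

/-- Convexity in `z` controls the plaques and injectivity in `t` comes from the inverse function
theorem. Overlaps need not have these properties globally, but countably many such boxes cover them.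
-/
theorem FoliatedChart.exists_box {p : ℂ × ℝ} (hp : p ∈ c.overlap c') :
    ∃ (D₁ : Set ℂ) (T₁ : Set ℝ), IsOpen D₁ ∧ p.1 ∈ D₁ ∧ Convex ℝ D₁ ∧ IsOpen T₁ ∧ p.2 ∈ T₁ ∧
      D₁ ×ˢ T₁ ⊆ c.overlap c' ∧ InjOn (c.transition c' p.1) T₁ := by
  obtain ⟨U, hU, hinj⟩ := exists_injOn_nhds_of_hasStrictDerivAt
    (FoliatedChart.hasStrictDerivAt_transition hp) (FoliatedChart.deriv_transition_ne_zero hp)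
  have hO := (c.isOpen_overlap c').mem_nhds hp
  rw [← Prod.mk.eta (p := p), nhds_prod_eq, mem_prod_iff] at hO
  obtain ⟨A, hA, B, hB, hAB⟩ := hO
  obtain ⟨ε, hε, hεA⟩ := Metric.mem_nhds_iff.1 hA
  obtain ⟨V, hV, hVo, hpV⟩ := mem_nhds_iff.1 (inter_mem hU hB)
  exact ⟨Metric.ball p.1 ε, V, Metric.isOpen_ball, Metric.mem_ball_self hε, convex_ball _ _, hVo,
    hpV, fun q hq => hAB ⟨hεA hq.1, (hV hq.2).2⟩, hinj.mono fun t ht => (hV ht).1⟩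

variable [MeasurableSpace X] [BorelSpace X] [T2Space X] [SecondCountableTopology X]

/-- Lusin–Souslin: an injective continuous image of a Borel set is Borel. -/
theorem FoliatedChart.measurableSet_param_image {A : Set (ℂ × ℝ)} (hA : MeasurableSet A)
    (hAc : A ⊆ c.D ×ˢ c.T) : MeasurableSet (c.param '' A) :=
  hA.image_of_continuousOn_injOn (c.continuousOn_param.mono hAc) (c.injOn_param.mono hAc)

theorem FoliatedChart.measurableSet_dom : MeasurableSet c.dom :=
  FoliatedChart.measurableSet_param_image c.isOpen_prod.measurableSet subset_rfl

theorem FoliatedChart.param_overlap : c.param '' c.overlap c' = c.dom ∩ c'.dom := by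
  ext x
  constructor
  · rintro ⟨p, hp, rfl⟩
    exact ⟨c.param_mem_dom hp.1, hp.2⟩
  · rintro ⟨⟨p, hp, rfl⟩, h⟩
    exact ⟨p, ⟨hp, h⟩, rfl⟩

/-- The measures `h_δ^α vol_g ⊗ 𝓗^α` of two foliated charts agree on the overlap. -/
theorem chartMeasure_restrict_overlap (hS : IsSaturated M S) (hSc : IsClosed S)
    (hfin : HasPosFiniteTransversals M S α) (hδ : ∀ x ∈ M, C3At δ x) (h0 : ∀ x ∈ M, δ x = 0)
    (hα : 0 ≤ α) (c c' : FoliatedChart M) :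
    (chartMeasure g S δ α c).restrict (c.dom ∩ c'.dom) =
      (chartMeasure g S δ α c').restrict (c.dom ∩ c'.dom) := by
  choose! D T hDo hpD hD hTo hpT hQ hinj using fun p (hp : p ∈ c.overlap c') =>
    FoliatedChart.exists_box hp
  obtain ⟨s, hs, hsc, hcov⟩ := TopologicalSpace.countable_cover_nhdsWithin (s := c.overlap c')
    (f := fun p => D p ×ˢ T p) fun p hp => mem_nhdsWithin_of_mem_nhds
      (((hDo p hp).prod (hTo p hp)).mem_nhds ⟨hpD p hp, hpT p hp⟩)
  have e : c.dom ∩ c'.dom = ⋃ p ∈ s, c.param '' (D p ×ˢ T p) := by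
    rw [← FoliatedChart.param_overlap, ← image_iUnion₂]
    congr 1
    exact subset_antisymm hcov (iUnion₂_subset fun p hp => hQ p (hs hp))
  rw [e, Measure.restrict_biUnion_congr hsc]
  intro p hp
  have hp' := hs hp
  have hm : MeasurableSet (c.param '' (D p ×ˢ T p)) := FoliatedChart.measurableSet_param_image
    ((hDo p hp').prod (hTo p hp')).measurableSet fun q hq => (hQ p hp' hq).1
  ext A hA
  rw [Measure.restrict_apply hA, Measure.restrict_apply hA]
  exact chartMeasure_eq_of_subset_box g hS hSc hfin hδ h0 hα (hpD p hp') (hD p hp')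
    (hTo p hp').measurableSet (hQ p hp') (hinj p hp') (hA.inter hm) inter_subset_right

theorem chartMeasure_restrict_dom (hS : IsSaturated M S) (hSc : IsClosed S)
    (hfin : HasPosFiniteTransversals M S α) (hδ : ∀ x ∈ M, C3At δ x) (hα : 0 ≤ α)
    (c : FoliatedChart M) :
    (chartMeasure g S δ α c).restrict c.dom = chartMeasure g S δ α c := by
  refine Measure.restrict_eq_self_of_ae_mem ?_
  rw [ae_iff]
  change chartMeasure g S δ α c c.domᶜ = 0
  rw [chartMeasure_apply g hS hSc hfin hδ hα c FoliatedChart.measurableSet_dom.compl]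
  have : (c.D ×ˢ c.T) ∩ c.param ⁻¹' c.domᶜ = ∅ := by
    ext p
    simp only [mem_inter_iff, mem_preimage, mem_compl_iff, mem_empty_iff_false, iff_false, not_and,
      not_not]
    exact fun hp => c.param_mem_dom hp
  rw [this]
  simp

/-- By saturation a plaque over a point of the transversal lies entirely in `S`. -/
theorem chartMeasure_compl (hS : IsSaturated M S) (hSc : IsClosed S)
    (hfin : HasPosFiniteTransversals M S α) (hδ : ∀ x ∈ M, C3At δ x) (hα : 0 ≤ α)
    (c : FoliatedChart M) : chartMeasure g S δ α c Sᶜ = 0 := by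
  rw [chartMeasure_apply g hS hSc hfin hδ hα c hSc.measurableSet.compl, lintegral_eq_zero_iff' ]
  · rw [EventuallyEq, ae_restrict_iff' (FoliatedChart.measurableSet_transversal hS hSc)]
    refine Eventually.of_forall fun t ht => ?_
    rw [Pi.zero_apply, ← lintegral_zero (μ := (volume : Measure ℂ))]
    refine lintegral_congr fun z => indicator_of_notMem (fun h => h.2 ?_) _
    exact (FoliatedChart.mem_transversal_iff hS h.1).1 ht
  · refine Measurable.aemeasurable (Measurable.lintegral_prod_left' (f := fun p => _) ?_)
    exact measurable_indicator_of_continuousOn ((continuousOn_weight g c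
      (continuousOn_normalMetric_rpow hδ hα)).mono inter_subset_left)
      (measurableSet_inter_preimage c.continuousOn_param c.isOpen_prod.measurableSet
        hSc.measurableSet.compl)

/-- The density is positive and `D` has positive area, so every plaque over the transversal has
positive mass; the transversal itself has positive Hausdorff measure. -/
theorem chartMeasure_ne_zero (hS : IsSaturated M S) (hSc : IsClosed S)
    (hfin : HasPosFiniteTransversals M S α) (hδ : ∀ x ∈ M, C3At δ x) (h0 : ∀ x ∈ M, δ x = 0)
    (hd : ∀ x ∈ M, diff δ x ≠ 0) (hα : 0 ≤ α) (c : FoliatedChart M)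
    (hne : (c.transversal S).Nonempty) : chartMeasure g S δ α c ≠ 0 := by
  intro h
  have h1 : chartMeasure g S δ α c univ = 0 := by rw [h]; rfl
  rw [chartMeasure_apply g hS hSc hfin hδ hα c MeasurableSet.univ, preimage_univ, inter_univ] at h1
  have hm : Measurable ((c.D ×ˢ c.T).indicator (g.weight c fun p => c.normalMetric δ p ^ α)) :=
    measurable_indicator_of_continuousOn (continuousOn_weight g c
      (continuousOn_normalMetric_rpow hδ hα)) c.isOpen_prod.measurableSet
  rw [lintegral_eq_zero_iff hm.lintegral_prod_left', EventuallyEq,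
    ae_restrict_iff' (FoliatedChart.measurableSet_transversal hS hSc)] at h1
  have h2 : ∀ t ∈ c.transversal S, ∫⁻ z : ℂ, (c.D ×ˢ c.T).indicator
      (g.weight c fun p => c.normalMetric δ p ^ α) (z, t) ≠ 0 := by
    intro t ht h3
    have hmt : Measurable fun z : ℂ => (c.D ×ˢ c.T).indicator
        (g.weight c fun p => c.normalMetric δ p ^ α) (z, t) := hm.comp measurable_prodMk_right
    rw [lintegral_eq_zero_iff hmt, EventuallyEq, ae_iff] at h3
    have h4 : volume c.D ≤ 0 := by
      rw [← h3]
      refine measure_mono fun z hz => ?_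
      have hp : (z, t) ∈ c.D ×ˢ c.T := ⟨hz, ht.1⟩
      simp only [mem_ofPred_eq, Pi.zero_apply]
      rw [indicator_of_mem hp]
      refine mul_ne_zero ?_ ?_
      · exact (ENNReal.ofReal_pos.2 (g.density_pos hp)).ne'
      · exact (ENNReal.ofReal_pos.2
          (Real.rpow_pos_of_pos (FoliatedChart.normalMetric_pos hδ h0 hd hp) _)).ne'
    exact (c.isOpen_D.measure_pos volume c.isConnected_D.nonempty).not_ge h4
  have h5 : Measure.hausdorffMeasure α (c.transversal S) ≤ 0 := by
    rw [ae_iff] at h1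
    rw [← h1]
    exact measure_mono fun t ht => by simpa [ht] using h2 t ht
  exact ((hfin c).1 hne).not_ge h5

/-- The measures `h_δ^α vol_g ⊗ 𝓗^α` of the foliated charts glue. -/
theorem exists_measure_restrict_dom_eq_chartMeasure (hS : IsSaturated M S) (hSc : IsClosed S)
    (hfin : HasPosFiniteTransversals M S α) (hδ : ∀ x ∈ M, C3At δ x) (h0 : ∀ x ∈ M, δ x = 0)
    (hα : 0 ≤ α) {n : ℕ} (c : Fin n → FoliatedChart M) (hcov : M = ⋃ i, (c i).dom) :
    ∃ μ : Measure X, μ Mᶜ = 0 ∧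
      ∀ c' : FoliatedChart M, μ.restrict c'.dom = chartMeasure g S δ α c' := by
  -- Disjoint pieces of the finite cover prevent double counting; on each piece the local measure
  -- may be replaced by that of any other chart.
  set E : Fin n → Set X := disjointed fun i => (c i).dom with hE
  have hEm : ∀ i, MeasurableSet (E i) :=
    fun i => disjointedRec (fun {s j} hs => hs.diff FoliatedChart.measurableSet_dom)
      FoliatedChart.measurableSet_dom
  have hEsub : ∀ i, E i ⊆ (c i).dom := fun i => disjointed_subset _ i
  have hEU : ⋃ i, E i = M := by rw [hE, iUnion_disjointed, ← hcov]
  have hMm : MeasurableSet M := hEU ▸ MeasurableSet.iUnion hEm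
  refine ⟨Measure.sum fun i => (chartMeasure g S δ α (c i)).restrict (E i), ?_, fun c' => ?_⟩
  · rw [Measure.sum_apply _ hMm.compl]
    refine ENNReal.tsum_eq_zero.2 fun i => ?_
    rw [Measure.restrict_apply hMm.compl]
    convert measure_empty (μ := chartMeasure g S δ α (c i))
    exact (disjoint_compl_left_iff_subset.2 (hEU ▸ subset_iUnion E i)).inter_eq
  · rw [Measure.restrict_sum _ FoliatedChart.measurableSet_dom]
    have h1 : ∀ i, ((chartMeasure g S δ α (c i)).restrict (E i)).restrict c'.dom =
        (chartMeasure g S δ α c').restrict (E i ∩ c'.dom) := by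
      intro i
      rw [Measure.restrict_restrict FoliatedChart.measurableSet_dom, inter_comm]
      have := chartMeasure_restrict_overlap g hS hSc hfin hδ h0 hα (c i) c'
      exact Measure.restrict_congr_mono (inter_subset_inter_left _ (hEsub i)) this
    simp_rw [h1]
    rw [← Measure.restrict_iUnion, ← iUnion_inter, hEU, inter_eq_right.2 c'.dom_subset,
      chartMeasure_restrict_dom g hS hSc hfin hδ hα]
    · intro i j hij
      exact (disjoint_disjointed _ hij).mono inter_subset_left inter_subset_left
    · exact fun i => (hEm i).inter FoliatedChart.measurableSet_dom

end LeviFlat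

/-! ### The Hermitian form of `-d^η` and its discriminant. -/

namespace LeviFlat

section

variable {E : Type*} [NormedAddCommGroup E] [NormedSpace ℂ E]

theorem fderiv_fderiv_rpow {E : Type*} [NormedAddCommGroup E] [NormedSpace ℝ E] {f : E → ℝ} {x : E}
    (hf : ContDiffAt ℝ 2 f x) (h0 : 0 < f x) (r : ℝ) (v : E) :
    fderiv ℝ (fderiv ℝ (fun y => f y ^ r)) x v v =
      r * f x ^ (r - 2) * (f x * fderiv ℝ (fderiv ℝ f) x v v + (r - 1) * fderiv ℝ f x v ^ 2) := by
  have e1 : fderiv ℝ (fun y => f y ^ r) =ᶠ[𝓝 x] fun y => (r * f y ^ (r - 1)) • fderiv ℝ f y := by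
    filter_upwards [hf.fderiv_eventually_hasFDerivAt (by norm_num),
      hf.continuousAt.eventually (lt_mem_nhds h0)] with y hy hy0
    exact (hy.hasFDerivAt.rpow_const (Or.inl (ne_of_gt hy0))).fderiv
  have hfd := (hf.differentiableAt (by simp)).hasFDerivAt
  have h1 := (hfd.rpow_const (p := r - 1) (Or.inl h0.ne')).const_mul r
  have h2 := h1.smul hf.differentiableAt_fderiv.hasFDerivAt
  rw [e1.fderiv_eq]
  erw [h2.fderiv]
  have e2 : f x ^ (r - 1) = f x ^ (r - 2) * f x := by
    rw [show r - 1 = r - 2 + 1 by ring, Real.rpow_add_one h0.ne']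
  have e3 : r - 1 - 1 = r - 2 := by ring
  simp [e3, e2]
  ring

theorem leviBilin_rpow {f : E → ℝ} {x : E} (hf : ContDiffAt ℝ 2 f x) (h0 : 0 < f x) (r : ℝ) (v : E) :
    leviBilin (fun y => f y ^ r) x v v = r * f x ^ (r - 2) * (f x * leviBilin f x v v +
      (r - 1) * (fderiv ℝ f x v ^ 2 + fderiv ℝ f x (Complex.I • v) ^ 2)) := by
  unfold leviBilin
  rw [fderiv_fderiv_rpow hf h0, fderiv_fderiv_rpow hf h0]
  ring

theorem leviBilin_neg (f : E → ℝ) (x v w : E) :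
    leviBilin (fun y => -f y) x v w = -leviBilin f x v w := by
  have h : fderiv ℝ (fun y => -f y) = fun y => -fderiv ℝ f y := by ext1 y; exact fderiv_fun_neg
  unfold leviBilin
  rw [h, fderiv_fun_neg]
  simp
  ring

/-- The form `-d B + (1 - η) (∂d ⊗ ∂̄d)`, whose positivity is the strict plurisubharmonicity
of `-d ^ η`. -/
noncomputable def dfForm (d : E → ℝ) (η : ℝ) (x v w : E) : ℝ :=
  -(d x) * leviBilin d x v w + (1 - η) * (fderiv ℝ d x v * fderiv ℝ d x w +
    fderiv ℝ d x (Complex.I • v) * fderiv ℝ d x (Complex.I • w))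

theorem leviBilin_neg_rpow {d : E → ℝ} {x : E} (hd : ContDiffAt ℝ 2 d x) (h0 : 0 < d x) (η : ℝ)
    (v : E) : leviBilin (fun y => -(d y ^ η)) x v v = η * d x ^ (η - 2) * dfForm d η x v v := by
  rw [leviBilin_neg, leviBilin_rpow hd h0, dfForm]
  ring

theorem leviBilin_complex_smul (f : E → ℝ) (x v w : E) (ξ : ℂ) :
    leviBilin f x (ξ • v) w = ξ.re * leviBilin f x v w + ξ.im * leviBilin f x (Complex.I • v) w := by
  conv_lhs => rw [← Complex.re_add_im ξ, add_smul, mul_comm, ← smul_smul, leviBilin_add_left,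
    Complex.coe_smul, leviBilin_real_smul_left, smul_comm, Complex.coe_smul,
    leviBilin_real_smul_left]

theorem fderiv_complex_smul (f : E → ℝ) (x v : E) (ξ : ℂ) :
    fderiv ℝ f x (ξ • v) = ξ.re * fderiv ℝ f x v + ξ.im * fderiv ℝ f x (Complex.I • v) := by
  conv_lhs => rw [← Complex.re_add_im ξ, add_smul, mul_comm, ← smul_smul, map_add,
    Complex.coe_smul, map_smul, smul_comm, Complex.coe_smul, map_smul]
  simp

theorem dfForm_complex_smul (d : E → ℝ) (η : ℝ) (x v w : E) (ξ : ℂ) :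
    dfForm d η x (ξ • v) w = ξ.re * dfForm d η x v w + ξ.im * dfForm d η x (Complex.I • v) w := by
  unfold dfForm
  rw [leviBilin_complex_smul, smul_comm, fderiv_complex_smul d x v, fderiv_complex_smul d x _ ξ]
  ring

theorem dfForm_add_left (d : E → ℝ) (η : ℝ) (x v v' w : E) :
    dfForm d η x (v + v') w = dfForm d η x v w + dfForm d η x v' w := by
  unfold dfForm
  rw [leviBilin_add_left, smul_add, map_add, map_add]
  ring

theorem dfForm_symm {d : E → ℝ} {x : E} (hd : ContDiffAt ℝ 2 d x) (η : ℝ) (v w : E) :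
    dfForm d η x v w = dfForm d η x w v := by
  unfold dfForm
  rw [leviBilin_symm hd]
  ring

theorem dfForm_I_smul (d : E → ℝ) (η : ℝ) (x v w : E) :
    dfForm d η x (Complex.I • v) (Complex.I • w) = dfForm d η x v w := by
  unfold dfForm
  rw [leviBilin_I_smul]
  simp only [smul_smul, Complex.I_mul_I, neg_smul, one_smul, map_neg]
  ring

/-- Multiplication by `i` is skew for this form; hence `dfForm` at `(v, w)` and at `(iv, w)` are, up
to sign convention, the real and imaginary parts of one Hermitian form. -/
theorem dfForm_I_smul_left (d : E → ℝ) (η : ℝ) (x v w : E) :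
    dfForm d η x (Complex.I • v) w = -dfForm d η x v (Complex.I • w) := by
  rw [← dfForm_I_smul d η x v, smul_smul, Complex.I_mul_I]
  have := dfForm_complex_smul d η x (Complex.I • v) (w) 1
  have h2 : ∀ u u' : E, dfForm d η x u (-u') = -dfForm d η x u u' := by
    intro u u'
    unfold dfForm leviBilin
    simp
    ring
  rw [neg_one_smul, h2, neg_neg]

/-- The discriminant of `dfForm` with respect to two vectors. -/
noncomputable def dfDisc (d : E → ℝ) (η : ℝ) (x a b : E) : ℝ :=
  dfForm d η x a a * dfForm d η x b b - dfForm d η x a b ^ 2 - dfForm d η x (Complex.I • a) b ^ 2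

theorem dfForm_combination {d : E → ℝ} {x : E} (hd : ContDiffAt ℝ 2 d x) (η : ℝ) (a b : E)
    (ξ ζ : ℂ) :
    dfForm d η x (ξ • a + ζ • b) (ξ • a + ζ • b) =
      (ξ.re ^ 2 + ξ.im ^ 2) * dfForm d η x a a + (ζ.re ^ 2 + ζ.im ^ 2) * dfForm d η x b b +
      2 * ((ξ.re * ζ.re + ξ.im * ζ.im) * dfForm d η x a b +
        (ξ.im * ζ.re - ξ.re * ζ.im) * dfForm d η x (Complex.I • a) b) := by
  have hs := dfForm_symm hd η
  have h0 : ∀ v, dfForm d η x (Complex.I • v) v = 0 := by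
    intro v
    have := dfForm_I_smul_left d η x v v
    rw [hs v] at this
    linarith
  have hab : dfForm d η x b (Complex.I • a) = dfForm d η x (Complex.I • a) b := hs _ _
  have hba : dfForm d η x (Complex.I • b) a = -dfForm d η x (Complex.I • a) b := by
    rw [dfForm_I_smul_left, hab]
  have hII := dfForm_I_smul d η x
  rw [dfForm_add_left, dfForm_complex_smul, dfForm_complex_smul d η x b, hs a, hs b,
    hs (Complex.I • a), hs (Complex.I • b)]
  simp only [dfForm_add_left, dfForm_complex_smul d η x _ _ ξ, dfForm_complex_smul d η x _ _ ζ, hII,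
    h0, hs b a, hs a (Complex.I • a), hs b (Complex.I • b), hs a (Complex.I • b), hba, hab]
  ring

theorem dfForm_pos_of_dfDisc_pos {d : E → ℝ} {x : E} (hd : ContDiffAt ℝ 2 d x) {η : ℝ} {a b : E}
    (hb : 0 < dfForm d η x b b) (hdisc : 0 < dfDisc d η x a b) {ξ ζ : ℂ} (h : ξ ≠ 0 ∨ ζ ≠ 0) :
    0 < dfForm d η x (ξ • a + ζ • b) (ξ • a + ζ • b) := by
  rw [dfForm_combination hd]
  unfold dfDisc at hdisc
  set Q := dfForm d η x b b
  set P := dfForm d η x a a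
  set A := dfForm d η x a b
  set C := dfForm d η x (Complex.I • a) b
  refine pos_of_mul_pos_right (a := Q) ?_ hb.le
  -- Multiply by the transverse coefficient `Q > 0` and complete the square.
  have e : Q * ((ξ.re ^ 2 + ξ.im ^ 2) * P + (ζ.re ^ 2 + ζ.im ^ 2) * Q +
      2 * ((ξ.re * ζ.re + ξ.im * ζ.im) * A + (ξ.im * ζ.re - ξ.re * ζ.im) * C)) =
      (ξ.re ^ 2 + ξ.im ^ 2) * (P * Q - A ^ 2 - C ^ 2) + ((Q * ζ.re + ξ.re * A + ξ.im * C) ^ 2 +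
        (Q * ζ.im + ξ.im * A - ξ.re * C) ^ 2) := by ring
  rw [e]
  by_cases hξ : ξ = 0
  · subst hξ
    have hζ : ζ ≠ 0 := by simpa using h
    have h1 : 0 < ζ.re ^ 2 + ζ.im ^ 2 := by
      have := Complex.normSq_pos.2 hζ
      rw [Complex.normSq_apply] at this
      nlinarith
    simp only [Complex.zero_re, Complex.zero_im]
    nlinarith [mul_pos (mul_pos hb hb) h1]
  · have h1 : 0 < ξ.re ^ 2 + ξ.im ^ 2 := by
      have := Complex.normSq_pos.2 hξ
      rw [Complex.normSq_apply] at this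
      nlinarith
    have := mul_pos h1 hdisc
    positivity

theorem dfDisc_pos_of_dfForm_pos {d : E → ℝ} {x : E} (hd : ContDiffAt ℝ 2 d x) {η : ℝ} {a b : E}
    (hab : ∀ ξ ζ : ℂ, ξ • a + ζ • b = 0 → ξ = 0 ∧ ζ = 0)
    (h : ∀ v, v ≠ 0 → 0 < dfForm d η x v v) : 0 < dfDisc d η x a b := by
  have hb : 0 < dfForm d η x b b := h b fun hb => by
    have := hab 0 1 (by simp [hb])
    simp at this
  set A := dfForm d η x a b with hA
  set C := dfForm d η x (Complex.I • a) b with hC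
  -- For `ξ = Q` the choice `ζ = -A + iC` makes the completed square vanish, so the form takes the
  -- value `Q` times the discriminant at this vector.
  have h1 := h ((dfForm d η x b b : ℂ) • a + (⟨-A, C⟩ : ℂ) • b) fun h0 => by
    have := (hab _ _ h0).1
    exact hb.ne' (by exact_mod_cast this)
  rw [dfForm_combination hd, ← hA, ← hC] at h1
  simp only [Complex.ofReal_re, Complex.ofReal_im] at h1
  unfold dfDisc
  rw [← hA, ← hC]
  nlinarith

end

end LeviFlat

/-! ### Leaf parametrizations, the collar and its holomorphic thickening. -/

namespace LeviFlat

/-- A `C³` parametrization `φ(z, t)`, holomorphic in `z`, of a piece of the hypersurface `{d = 0}`. -/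
structure IsLeafParam (φ : ℂ × ℝ → ℂ × ℂ) (d : ℂ × ℂ → ℝ) (p₀ : ℂ × ℝ) : Prop where
  smooth : ContDiffAt ℝ 3 φ p₀
  hol : ∀ᶠ p in 𝓝 p₀, ∀ ζ : ℂ, fderiv ℝ φ p (ζ, 0) = ζ • fderiv ℝ φ p (1, 0)
  indep : (fderiv ℝ φ p₀ (1, 0)).1 * (fderiv ℝ φ p₀ (0, 1)).2 -
    (fderiv ℝ φ p₀ (1, 0)).2 * (fderiv ℝ φ p₀ (0, 1)).1 ≠ 0
  smooth_d : ContDiffAt ℝ 3 d (φ p₀)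
  zero : ∀ᶠ p in 𝓝 p₀, d (φ p) = 0

variable {φ : ℂ × ℝ → ℂ × ℂ} {d : ℂ × ℂ → ℝ} {p₀ : ℂ × ℝ}

/-- The derivative of `d` in the direction normal to the hypersurface. -/
noncomputable def signedMetric (φ : ℂ × ℝ → ℂ × ℂ) (d : ℂ × ℂ → ℝ) (p : ℂ × ℝ) : ℝ :=
  fderiv ℝ d (φ p) (Complex.I • fderiv ℝ φ p (0, 1))

/-- The point at signed height `s` over `φ p`. -/
noncomputable def collar (φ : ℂ × ℝ → ℂ × ℂ) (x : (ℂ × ℝ) × ℝ) : ℂ × ℂ :=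
  φ x.1 + x.2 • Complex.I • fderiv ℝ φ x.1 (0, 1)

/-- The holomorphic tangent vector of the translated leaf at height `s`. -/
noncomputable def collarLeafVec (φ : ℂ × ℝ → ℂ × ℂ) (x : (ℂ × ℝ) × ℝ) : ℂ × ℂ :=
  fderiv ℝ (collar φ) x ((1, 0), 0)

namespace IsLeafParam

theorem eventually_contDiffAt (h : IsLeafParam φ d p₀) : ∀ᶠ p in 𝓝 p₀, ContDiffAt ℝ 3 φ p :=
  h.smooth.eventually (by simp)

theorem eventually_contDiffAt_d (h : IsLeafParam φ d p₀) : ∀ᶠ p in 𝓝 p₀, ContDiffAt ℝ 3 d (φ p) :=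
  h.smooth.continuousAt.eventually (h.smooth_d.eventually (by simp))

theorem contDiffAt_signedMetric (h : IsLeafParam φ d p₀) : ContDiffAt ℝ 2 (signedMetric φ d) p₀ :=
  FoliatedChart.contDiffAt_signedMetric h.smooth_d h.smooth

theorem contDiffAt_transverse (h : IsLeafParam φ d p₀) :
    ContDiffAt ℝ 2 (fun p => fderiv ℝ φ p (0, 1)) p₀ :=
  (h.smooth.fderiv_right (m := 2) (by norm_num)).clm_apply contDiffAt_const

/-- The transverse vector field is holomorphic along the leaves. -/
theorem transverse_hol (h : IsLeafParam φ d p₀) : ∀ᶠ p in 𝓝 p₀, ∀ ζ : ℂ,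
    fderiv ℝ (fun p => fderiv ℝ φ p (0, 1)) p (ζ, 0) =
      ζ • fderiv ℝ (fun p => fderiv ℝ φ p (0, 1)) p (1, 0) := by
  filter_upwards [h.hol.eventually_nhds, h.eventually_contDiffAt] with p hp hs ζ
  have hs2 : ContDiffAt ℝ 2 φ p := hs.of_le (by norm_num)
  have hdf := hs2.differentiableAt_fderiv
  rw [← fderiv_fderiv_apply hdf, ← fderiv_fderiv_apply hdf, hs2.fderiv_fderiv_symm,
    hs2.fderiv_fderiv_symm (1, 0), fderiv_fderiv_apply hdf, fderiv_fderiv_apply hdf]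
  have e : (fun x => fderiv ℝ φ x (ζ, 0)) =ᶠ[𝓝 p] fun x => ζ • fderiv ℝ φ x (1, 0) :=
    hp.mono fun q hq => hq ζ
  have h3 : DifferentiableAt ℝ (fun x => fderiv ℝ φ x (1, 0)) p :=
    hdf.clm_apply (differentiableAt_const _)
  rw [e.fderiv_eq]
  erw [(h3.hasFDerivAt.const_smul ζ).fderiv]
  simp

/-- The holomorphic extension `(z, w) ↦ φ(z, t) + w φ_t(z, t)` of the leaf parametrization. -/
noncomputable def thicken (φ : ℂ × ℝ → ℂ × ℂ) (t : ℝ) (q : ℂ × ℂ) : ℂ × ℂ :=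
  φ (q.1, t) + q.2 • fderiv ℝ φ (q.1, t) (0, 1)

theorem _root_.Filter.Eventually.slice {P : ℂ × ℝ → Prop} (h : ∀ᶠ p in 𝓝 p₀, P p) :
    ∀ᶠ z in 𝓝 p₀.1, P (z, p₀.2) := by
  have : ContinuousAt (fun z : ℂ => (z, p₀.2)) p₀.1 := by fun_prop
  exact this.eventually h

theorem differentiableAt_slice {f : ℂ × ℝ → ℂ × ℂ} {z : ℂ} {t : ℝ}
    (hf : DifferentiableAt ℝ f (z, t))
    (hol : ∀ ζ : ℂ, fderiv ℝ f (z, t) (ζ, 0) = ζ • fderiv ℝ f (z, t) (1, 0)) :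
    DifferentiableAt ℂ (fun z => f (z, t)) z := by
  have h1 : HasFDerivAt (fun z => f (z, t)) _ z :=
    hf.hasFDerivAt.comp z (hasFDerivAt_prodMk_left (𝕜 := ℝ) z t)
  rw [differentiableAt_complex_iff_differentiableAt_real]
  refine ⟨h1.differentiableAt, ?_⟩
  rw [h1.fderiv]
  simpa using hol Complex.I

/-- For fixed `t` both `φ` and `φ_t` are holomorphic in `z`. The collar over a single leaf is
therefore the restriction to `w = is` of a holomorphic map, although `φ` is only `C³` in `t`. -/
theorem thicken_analyticAt (h : IsLeafParam φ d p₀) (w : ℂ) :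
    AnalyticAt ℂ (thicken φ p₀.2) (p₀.1, w) := by
  have h1 : AnalyticAt ℂ (fun z => φ (z, p₀.2)) p₀.1 := by
    refine Complex.analyticAt_iff_eventually_differentiableAt.2 ?_
    filter_upwards [h.hol.slice, h.eventually_contDiffAt.slice] with z hz hs
    exact differentiableAt_slice (hs.differentiableAt (by simp)) hz
  have h2 : AnalyticAt ℂ (fun z => fderiv ℝ φ (z, p₀.2) (0, 1)) p₀.1 := by
    refine Complex.analyticAt_iff_eventually_differentiableAt.2 ?_
    filter_upwards [h.transverse_hol.slice, h.eventually_contDiffAt.slice] with z hz hs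
    refine differentiableAt_slice (f := fun p => fderiv ℝ φ p (0, 1)) ?_ hz
    exact ((hs.of_le (by norm_num : (2 : ℕ∞ω) ≤ 3)).differentiableAt_fderiv).clm_apply
      (differentiableAt_const _)
  have hfst : AnalyticAt ℂ (Prod.fst : ℂ × ℂ → ℂ) (p₀.1, w) := analyticAt_fst
  have hsnd : AnalyticAt ℂ (Prod.snd : ℂ × ℂ → ℂ) (p₀.1, w) := analyticAt_snd
  exact (AnalyticAt.fun_comp (g := fun z => φ (z, p₀.2)) (f := (Prod.fst : ℂ × ℂ → ℂ)) h1 hfst).add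
    (hsnd.smul (AnalyticAt.fun_comp (g := fun z => fderiv ℝ φ (z, p₀.2) (0, 1))
      (f := (Prod.fst : ℂ × ℂ → ℂ)) h2 hfst))

end IsLeafParam

end LeviFlat

/-! ### First-order behaviour of `d` in the collar. -/

namespace LeviFlat

/-- Strict differentiability at `(p₀, 0)` compares `G (p, s)` with `G (p, 0) = 0` uniformly in `p`,
so the quotient converges even when the base point moves together with the height. -/
theorem tendsto_div_height {P : Type*} [NormedAddCommGroup P] [NormedSpace ℝ P] {p₀ : P}
    {G : P × ℝ → ℝ} (hG : ContDiffAt ℝ 1 G (p₀, 0))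
    (h0 : ∀ᶠ p in 𝓝 p₀, G (p, 0) = 0) {c : ℝ} (hc : HasDerivAt (fun s => G (p₀, s)) c 0) :
    Tendsto (fun x => G x / x.2) (𝓝[{x | x.2 ≠ 0}] (p₀, 0)) (𝓝 c) := by
  have hs := hG.hasStrictFDerivAt (by simp)
  have hc' : ∀ s : ℝ, fderiv ℝ G (p₀, 0) (0, s) = s * c := by
    intro s
    have h1 : HasFDerivAt (fun s : ℝ => G (p₀, s)) _ (0 : ℝ) :=
      hs.hasFDerivAt.comp (0 : ℝ) (hasFDerivAt_prodMk_right (𝕜 := ℝ) p₀ (0 : ℝ))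
    have h2 := h1.hasDerivAt.unique hc
    have : ((0 : P), s) = s • ((0 : P), (1 : ℝ)) := by simp
    rw [this, map_smul, ← h2]
    simp
  have hm : Tendsto (fun x : P × ℝ => (x, (x.1, (0 : ℝ)))) (𝓝 (p₀, 0)) (𝓝 ((p₀, 0), (p₀, 0))) := by
    have : Continuous (fun x : P × ℝ => (x, (x.1, (0 : ℝ)))) := by fun_prop
    exact this.tendsto' _ _ rfl
  have ho := (hs.isLittleO.comp_tendsto hm).mono
    (nhdsWithin_le_nhds (s := {x : P × ℝ | x.2 ≠ 0}))
  have h0' : ∀ᶠ x in 𝓝[{x : P × ℝ | x.2 ≠ 0}] (p₀, 0), G (x.1, 0) = 0 :=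
    nhdsWithin_le_nhds ((continuous_fst.tendsto (p₀, (0 : ℝ))).eventually h0)
  have ho2 : (fun x : P × ℝ => G x - x.2 * c) =o[𝓝[{x : P × ℝ | x.2 ≠ 0}] (p₀, 0)]
      fun x => x.2 := by
    refine (ho.congr' ?_ (Eventually.of_forall fun x => rfl)).trans_isBigO ?_
    · filter_upwards [h0'] with x hx
      have e : x - (x.1, 0) = (0, x.2) := by ext <;> simp
      simp only [Function.comp, hx, e, hc', sub_zero]
    · refine Asymptotics.isBigO_of_le _ fun x => ?_
      have e : x - (x.1, 0) = (0, x.2) := by ext <;> simp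
      simp [Function.comp, e]
  have h3 := (ho2.tendsto_div_nhds_zero).add_const c
  rw [zero_add] at h3
  refine h3.congr' ?_
  filter_upwards [self_mem_nhdsWithin] with x hx
  field_simp [show x.2 ≠ 0 from hx]
  ring

namespace IsLeafParam

variable {φ : ℂ × ℝ → ℂ × ℂ} {d : ℂ × ℂ → ℝ} {p₀ : ℂ × ℝ}

theorem collar_zero (p : ℂ × ℝ) : collar φ (p, 0) = φ p := by simp [collar]

theorem contDiffAt_collar (h : IsLeafParam φ d p₀) : ContDiffAt ℝ 2 (collar φ) (p₀, 0) := by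
  have h1 : ContDiffAt ℝ 2 (fun x : (ℂ × ℝ) × ℝ => φ x.1) (p₀, 0) :=
    ContDiffAt.comp (g := φ) (p₀, (0 : ℝ)) (h.smooth.of_le (by norm_num)) contDiffAt_fst
  have h2 : ContDiffAt ℝ 2 (fun x : (ℂ × ℝ) × ℝ => fderiv ℝ φ x.1 (0, 1)) (p₀, 0) :=
    ContDiffAt.comp (g := fun p => fderiv ℝ φ p (0, 1)) (p₀, (0 : ℝ)) h.contDiffAt_transverse
      contDiffAt_fst
  exact h1.add (contDiffAt_snd.smul (h2.const_smul Complex.I))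

theorem fderiv_collar_fst {x : (ℂ × ℝ) × ℝ} (h : ContDiffAt ℝ 2 φ x.1) (v : ℂ × ℝ) :
    fderiv ℝ (collar φ) x (v, 0) = fderiv ℝ φ x.1 v +
      x.2 • Complex.I • fderiv ℝ (fun p => fderiv ℝ φ p (0, 1)) x.1 v := by
  have h2 : DifferentiableAt ℝ (fun p => fderiv ℝ φ p (0, 1)) x.1 :=
    h.differentiableAt_fderiv.clm_apply (differentiableAt_const _)
  have h1 : DifferentiableAt ℝ φ x.1 := h.differentiableAt (by simp)
  have h3 : HasFDerivAt (fun y : (ℂ × ℝ) × ℝ => φ y.1) _ x := h1.hasFDerivAt.comp x hasFDerivAt_fst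
  have h4 : HasFDerivAt (fun y : (ℂ × ℝ) × ℝ => fderiv ℝ φ y.1 (0, 1)) _ x :=
    HasFDerivAt.comp (g := fun p => fderiv ℝ φ p (0, 1)) x h2.hasFDerivAt hasFDerivAt_fst
  have h5 := h3.add ((hasFDerivAt_snd (𝕜 := ℝ) (p := x)).smul (h4.const_smul Complex.I))
  erw [h5.fderiv]
  simp

theorem fderiv_collar_snd {x : (ℂ × ℝ) × ℝ} (h : ContDiffAt ℝ 2 φ x.1) :
    fderiv ℝ (collar φ) x (0, 1) = Complex.I • fderiv ℝ φ x.1 (0, 1) := by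
  have h2 : DifferentiableAt ℝ (fun p => fderiv ℝ φ p (0, 1)) x.1 :=
    h.differentiableAt_fderiv.clm_apply (differentiableAt_const _)
  have h1 : DifferentiableAt ℝ φ x.1 := h.differentiableAt (by simp)
  have h3 : HasFDerivAt (fun y : (ℂ × ℝ) × ℝ => φ y.1) _ x := h1.hasFDerivAt.comp x hasFDerivAt_fst
  have h4 : HasFDerivAt (fun y : (ℂ × ℝ) × ℝ => fderiv ℝ φ y.1 (0, 1)) _ x :=
    HasFDerivAt.comp (g := fun p => fderiv ℝ φ p (0, 1)) x h2.hasFDerivAt hasFDerivAt_fst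
  have h5 := h3.add ((hasFDerivAt_snd (𝕜 := ℝ) (p := x)).smul (h4.const_smul Complex.I))
  erw [h5.fderiv]
  simp

/-- The translated leaves are holomorphic curves too, because `φ_t` is holomorphic along the leaves.
-/
theorem smul_collarLeafVec (h : IsLeafParam φ d p₀) : ∀ᶠ p in 𝓝 p₀, ∀ (s : ℝ) (ζ : ℂ),
    fderiv ℝ (collar φ) (p, s) ((ζ, 0), 0) = ζ • collarLeafVec φ (p, s) := by
  filter_upwards [h.hol, h.transverse_hol, h.eventually_contDiffAt] with p h1 h2 h3 s ζ
  have h3' : ContDiffAt ℝ 2 φ p := h3.of_le (by norm_num)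
  rw [collarLeafVec, fderiv_collar_fst (x := (p, s)) h3', fderiv_collar_fst (x := (p, s)) h3']
  simp only [h1 ζ, h2 ζ, smul_add]
  congr 1
  rw [smul_comm ζ s, smul_comm ζ Complex.I]

theorem collarLeafVec_zero (h : IsLeafParam φ d p₀) :
    collarLeafVec φ (p₀, 0) = fderiv ℝ φ p₀ (1, 0) := by
  rw [collarLeafVec, fderiv_collar_fst (x := (p₀, (0 : ℝ))) (h.smooth.of_le (by norm_num))]
  simp

theorem contDiffAt_collarLeafVec (h : IsLeafParam φ d p₀) :
    ContDiffAt ℝ 1 (collarLeafVec φ) (p₀, 0) :=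
  (h.contDiffAt_collar.fderiv_right (m := 1) (by norm_num)).clm_apply contDiffAt_const

theorem contDiffAt_comp_collar (h : IsLeafParam φ d p₀) :
    ContDiffAt ℝ 2 (d ∘ collar φ) (p₀, 0) := by
  refine ContDiffAt.comp _ ?_ h.contDiffAt_collar
  rw [collar_zero]
  exact h.smooth_d.of_le (by norm_num)

theorem hasDerivAt_comp_collar (h : IsLeafParam φ d p₀) :
    HasDerivAt (fun s => d (collar φ (p₀, s))) (signedMetric φ d p₀) 0 := by
  have h1 : DifferentiableAt ℝ d (collar φ (p₀, 0)) := by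
    rw [collar_zero]; exact h.smooth_d.differentiableAt (by simp)
  have h2 : HasFDerivAt (fun s : ℝ => collar φ (p₀, s)) _ 0 :=
    (h.contDiffAt_collar.differentiableAt (by simp)).hasFDerivAt.comp (0 : ℝ)
      (hasFDerivAt_prodMk_right (𝕜 := ℝ) p₀ (0 : ℝ))
  have h3 := (h1.hasFDerivAt.comp (0 : ℝ) h2).hasDerivAt
  refine h3.congr_deriv ?_
  change fderiv ℝ d _ (fderiv ℝ (collar φ) (p₀, 0) (0, 1)) = fderiv ℝ d (φ p₀) _
  rw [fderiv_collar_snd (x := (p₀, (0 : ℝ))) (h.smooth.of_le (by norm_num)), collar_zero]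

theorem tendsto_height (h : IsLeafParam φ d p₀) :
    Tendsto (fun x => d (collar φ x) / x.2) (𝓝[{x | x.2 ≠ 0}] (p₀, 0))
      (𝓝 (signedMetric φ d p₀)) :=
  tendsto_div_height (h.contDiffAt_comp_collar.of_le (by norm_num))
    (h.zero.mono fun p hp => by simpa [collar_zero] using hp) h.hasDerivAt_comp_collar

/-- All the conditions are open, so identities proved at the base point may be differentiated. -/
theorem eventually_isLeafParam (h : IsLeafParam φ d p₀) : ∀ᶠ p in 𝓝 p₀, IsLeafParam φ d p := by
  have hdf : ContDiffAt ℝ 2 (fderiv ℝ φ) p₀ := h.smooth.fderiv_right (by norm_num)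
  have hdc := hdf.continuousAt
  have hdet : ContinuousAt (fun p => (fderiv ℝ φ p (1, 0)).1 * (fderiv ℝ φ p (0, 1)).2 -
    (fderiv ℝ φ p (1, 0)).2 * (fderiv ℝ φ p (0, 1)).1) p₀ := by fun_prop
  filter_upwards [h.eventually_contDiffAt, h.hol.eventually_nhds, hdet.eventually_ne h.indep,
    h.eventually_contDiffAt_d, h.zero.eventually_nhds] with p h1 h2 h3 h4 h5
  exact ⟨h1, h2, h3, h4, h5⟩

/-- The derivative of `d` along the translated leaves, divided by the height. -/
theorem tendsto_leaf (h : IsLeafParam φ d p₀) (ζ : ℂ) :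
    Tendsto (fun x => fderiv ℝ d (collar φ x) (ζ • collarLeafVec φ x) / x.2)
      (𝓝[{x | x.2 ≠ 0}] (p₀, 0)) (𝓝 (fderiv ℝ (signedMetric φ d) p₀ (ζ, 0))) := by
  have hC := h.contDiffAt_comp_collar
  have key : Tendsto (fun x => fderiv ℝ (d ∘ collar φ) x ((ζ, 0), 0) / x.2)
      (𝓝[{x | x.2 ≠ 0}] (p₀, 0)) (𝓝 (fderiv ℝ (signedMetric φ d) p₀ (ζ, 0))) := by
    refine tendsto_div_height (G := fun x => fderiv ℝ (d ∘ collar φ) x ((ζ, 0), 0)) ?_ ?_ ?_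
    · exact (hC.fderiv_right (m := 1) (by norm_num)).clm_apply contDiffAt_const
    · have hev : ∀ᶠ p in 𝓝 p₀, DifferentiableAt ℝ (d ∘ collar φ) (p, 0) := by
        have : ContinuousAt (fun p : ℂ × ℝ => (p, (0 : ℝ))) p₀ := by fun_prop
        exact this.eventually (hC.fderiv_eventually_hasFDerivAt (by norm_num))
      filter_upwards [hev, h.zero.eventually_nhds] with p hp hz
      have h1 : HasFDerivAt (fun q : ℂ × ℝ => (d ∘ collar φ) (q, 0)) _ p :=
        HasFDerivAt.comp (g := d ∘ collar φ) p hp.hasFDerivAt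
          (hasFDerivAt_prodMk_left (𝕜 := ℝ) p (0 : ℝ))
      have h2 : (fun q : ℂ × ℝ => (d ∘ collar φ) (q, 0)) =ᶠ[𝓝 p] fun _ => 0 :=
        hz.mono fun q hq => by simpa [collar_zero] using hq
      have h3 := h1.fderiv
      rw [h2.fderiv_eq] at h3
      have := congrArg (fun L => L (ζ, 0)) h3
      simpa using this.symm
    · have h1 : HasFDerivAt (fun s : ℝ => fderiv ℝ (d ∘ collar φ) (p₀, s) ((ζ, 0), 0)) _ 0 :=
        HasFDerivAt.comp (g := fun x => fderiv ℝ (d ∘ collar φ) x ((ζ, 0), 0)) (0 : ℝ)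
        ((hC.differentiableAt_fderiv.clm_apply (differentiableAt_const _)).hasFDerivAt)
        (hasFDerivAt_prodMk_right (𝕜 := ℝ) p₀ (0 : ℝ))
      have h2 := h1.hasDerivAt
      refine h2.congr_deriv ?_
      change fderiv ℝ (fun y => (fderiv ℝ (d ∘ collar φ) y) ((ζ, 0), 0)) (p₀, 0) (0, 1) = _
      -- Exchange the height derivative with the leaf derivative: at height zero the former is `σ`,
      -- which is then differentiated along the leaf.
      rw [← fderiv_fderiv_apply hC.differentiableAt_fderiv, hC.fderiv_fderiv_symm,
        fderiv_fderiv_apply hC.differentiableAt_fderiv]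
      have h3 : HasFDerivAt (fun p : ℂ × ℝ => fderiv ℝ (d ∘ collar φ) (p, 0) (0, 1)) _ p₀ :=
        HasFDerivAt.comp (g := fun x => fderiv ℝ (d ∘ collar φ) x (0, 1)) p₀
        ((hC.differentiableAt_fderiv.clm_apply (differentiableAt_const _)).hasFDerivAt)
        (hasFDerivAt_prodMk_left (𝕜 := ℝ) p₀ (0 : ℝ))
      have h4 : signedMetric φ d =ᶠ[𝓝 p₀] fun p => fderiv ℝ (d ∘ collar φ) (p, 0) (0, 1) := by
        filter_upwards [h.eventually_isLeafParam] with p hp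
        have h5 := hp.hasDerivAt_comp_collar
        have h6 : HasFDerivAt (fun s : ℝ => (d ∘ collar φ) (p, s)) _ 0 :=
          (hp.contDiffAt_comp_collar.differentiableAt (by simp)).hasFDerivAt.comp (0 : ℝ)
          (hasFDerivAt_prodMk_right (𝕜 := ℝ) p (0 : ℝ))
        simpa using h5.unique h6.hasDerivAt
      rw [h4.fderiv_eq, h3.fderiv]
      simp
  refine key.congr' ?_
  have e1 : ∀ᶠ x in 𝓝 (p₀, (0 : ℝ)), DifferentiableAt ℝ (collar φ) x :=
    h.contDiffAt_collar.fderiv_eventually_hasFDerivAt (by norm_num)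
  have e2 : ∀ᶠ x in 𝓝 (p₀, (0 : ℝ)), DifferentiableAt ℝ d (collar φ x) := by
    refine h.contDiffAt_collar.continuousAt.eventually ?_
    rw [collar_zero]
    exact h.smooth_d.fderiv_eventually_hasFDerivAt (by norm_num)
  have e3 : ∀ᶠ x in 𝓝 (p₀, (0 : ℝ)), fderiv ℝ (collar φ) x ((ζ, 0), 0) = ζ • collarLeafVec φ x :=
    (continuous_fst.tendsto (p₀, (0 : ℝ))).eventually h.smul_collarLeafVec |>.mono
      fun x hx => hx x.2 ζ
  filter_upwards [nhdsWithin_le_nhds e1, nhdsWithin_le_nhds e2, nhdsWithin_le_nhds e3] with x h1 h2 h3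
  rw [fderiv_comp x h2 h1, ContinuousLinearMap.comp_apply, h3]

end IsLeafParam

end LeviFlat

/-! ### The Levi form of `d` along and across the translated leaves. -/

namespace LeviFlat

/-- Commuting a derivative past two others. -/
theorem fderiv_fderiv_fderiv_comm {E : Type*} [NormedAddCommGroup E] [NormedSpace ℝ E] {K : E → ℝ}
    {x : E} (hK : ContDiffAt ℝ 3 K x) (e f : E) :
    fderiv ℝ (fun y => fderiv ℝ (fun y => fderiv ℝ K y e) y e) x f =
      fderiv ℝ (fun y => fderiv ℝ (fun y => fderiv ℝ K y f) y e) x e := by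
  have hsw : ∀ {g : E → ℝ} {y : E}, ContDiffAt ℝ 2 g y → ∀ u v : E,
      fderiv ℝ (fun y => fderiv ℝ g y u) y v = fderiv ℝ (fun y => fderiv ℝ g y v) y u := by
    intro g y hg u v
    rw [← fderiv_fderiv_apply hg.differentiableAt_fderiv, hg.fderiv_fderiv_symm,
      fderiv_fderiv_apply hg.differentiableAt_fderiv]
  have h2 : ContDiffAt ℝ 2 (fun y => fderiv ℝ K y e) x :=
    (hK.fderiv_right (m := 2) (by norm_num)).clm_apply contDiffAt_const
  rw [hsw h2 e f]
  have h3 : (fun y => fderiv ℝ (fun y => fderiv ℝ K y e) y f) =ᶠ[𝓝 x]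
      fun y => fderiv ℝ (fun y => fderiv ℝ K y f) y e := by
    filter_upwards [hK.eventually (by simp)] with y hy
    exact hsw (hy.of_le (by norm_num)) e f
  rw [h3.fderiv_eq]

namespace IsLeafParam

variable {φ : ℂ × ℝ → ℂ × ℂ} {d : ℂ × ℂ → ℝ} {p₀ : ℂ × ℝ}

theorem thicken_mul_I (t : ℝ) (z : ℂ) (s : ℝ) :
    thicken φ t (z, s * Complex.I) = collar φ ((z, t), s) := by
  simp only [thicken, collar, mul_smul, Complex.coe_smul]

theorem thicken_zero (t : ℝ) (z : ℂ) : thicken φ t (z, 0) = φ (z, t) := by simp [thicken]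

theorem thicken_contDiffAt (h : IsLeafParam φ d p₀) (w : ℂ) (n : ℕ∞ω) :
    ContDiffAt ℝ n (thicken φ p₀.2) (p₀.1, w) :=
  (h.thicken_analyticAt w).contDiffAt.restrict_scalars ℝ

theorem comp_thicken_contDiffAt (h : IsLeafParam φ d p₀) :
    ContDiffAt ℝ 3 (d ∘ thicken φ p₀.2) (p₀.1, 0) := by
  refine ContDiffAt.comp _ ?_ (h.thicken_contDiffAt 0 3)
  rw [thicken_zero]
  exact h.smooth_d

theorem fderiv_thicken_snd (h : IsLeafParam φ d p₀) (w ζ : ℂ) :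
    fderiv ℝ (thicken φ p₀.2) (p₀.1, w) (0, ζ) = ζ • fderiv ℝ φ p₀ (0, 1) := by
  have h1 : HasFDerivAt (fun w : ℂ => thicken φ p₀.2 (p₀.1, w)) _ w :=
    ((h.thicken_contDiffAt w 1).differentiableAt (by simp)).hasFDerivAt.comp w
      (hasFDerivAt_prodMk_right (𝕜 := ℝ) p₀.1 w)
  have h2 : HasFDerivAt (fun w : ℂ => φ p₀ + w • fderiv ℝ φ p₀ (0, 1)) _ w :=
    ((ContinuousLinearMap.id ℝ ℂ).smulRight (fderiv ℝ φ p₀ (0, 1))).hasFDerivAt.const_add (φ p₀)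
  have h3 := congrArg (fun L => L ζ) (h1.unique h2)
  simpa using h3

theorem fderiv_thicken_fst (h : IsLeafParam φ d p₀) : ∀ᶠ s : ℝ in 𝓝 (0 : ℝ), ∀ v : ℂ,
    fderiv ℝ (thicken φ p₀.2) (p₀.1, (s : ℂ) * Complex.I) (v, 0) = v • collarLeafVec φ (p₀, s) := by
  have hcont : ContinuousAt (fun s : ℝ => (p₀, s)) 0 := by fun_prop
  have he := hcont.eventually (h.contDiffAt_collar.fderiv_eventually_hasFDerivAt (by norm_num))
  filter_upwards [he] with s hs v
  have h1 : HasFDerivAt (fun z : ℂ => thicken φ p₀.2 (z, s * Complex.I)) _ p₀.1 :=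
    HasFDerivAt.comp (g := thicken φ p₀.2) p₀.1
      ((h.thicken_contDiffAt (s * Complex.I) 1).differentiableAt (by simp)).hasFDerivAt
      (hasFDerivAt_prodMk_left (𝕜 := ℝ) p₀.1 (s * Complex.I))
  have h2 : HasFDerivAt (fun z : ℂ => collar φ ((z, p₀.2), s)) _ p₀.1 :=
    HasFDerivAt.comp (g := collar φ) p₀.1 hs.hasFDerivAt
      ((hasFDerivAt_prodMk_left (𝕜 := ℝ) (p₀.1, p₀.2) s).comp p₀.1
      (hasFDerivAt_prodMk_left (𝕜 := ℝ) p₀.1 p₀.2))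
  simp only [thicken_mul_I] at h1
  have h3 := congrArg (fun L => L v) (h1.unique h2)
  rw [← h.smul_collarLeafVec.self_of_nhds]
  simpa using h3

theorem fderiv_comp_thicken (h : IsLeafParam φ d p₀) (ζ : ℂ) :
    fderiv ℝ (d ∘ thicken φ p₀.2) (p₀.1, 0) (0, ζ) = ζ.im * signedMetric φ d p₀ := by
  have h1 : DifferentiableAt ℝ d (thicken φ p₀.2 (p₀.1, 0)) := by
    rw [thicken_zero]; exact h.smooth_d.differentiableAt (by simp)
  rw [fderiv_comp _ h1 ((h.thicken_contDiffAt 0 1).differentiableAt (by simp)),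
    ContinuousLinearMap.comp_apply, h.fderiv_thicken_snd, thicken_zero]
  have h2 : HasFDerivAt (d ∘ φ) _ p₀ :=
    (h.smooth_d.differentiableAt (by simp)).hasFDerivAt.comp p₀
      (h.smooth.differentiableAt (by simp)).hasFDerivAt
  have h3 : d ∘ φ =ᶠ[𝓝 p₀] fun _ => (0 : ℝ) := h.zero
  have h4 := congrArg (fun L => L (0, 1)) h2.fderiv
  rw [h3.fderiv_eq] at h4
  have h5 : fderiv ℝ d (φ p₀) (fderiv ℝ φ p₀ (0, 1)) = 0 := by simpa using h4.symm
  have h6 : ζ • fderiv ℝ φ p₀ (0, 1) = ζ.re • fderiv ℝ φ p₀ (0, 1) +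
      ζ.im • Complex.I • fderiv ℝ φ p₀ (0, 1) := by
    conv_lhs => rw [← Complex.re_add_im ζ]
    rw [add_smul, mul_smul, Complex.coe_smul, Complex.coe_smul]
  change fderiv ℝ d (φ p₀) _ = _
  rw [h6, map_add, map_smul, map_smul, h5]
  simp [signedMetric]

theorem eventually_fderiv_comp_thicken (h : IsLeafParam φ d p₀) (ζ : ℂ) : ∀ᶠ z in 𝓝 p₀.1,
    fderiv ℝ (d ∘ thicken φ p₀.2) (z, 0) (0, ζ) = ζ.im * signedMetric φ d (z, p₀.2) := by
  filter_upwards [h.eventually_isLeafParam.slice] with z hz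
  exact hz.fderiv_comp_thicken ζ

/-- Pull back by the holomorphic thickening. On `w = 0` the derivative of the pulled-back function
in `Re w` vanishes and that in `Im w` is `σ`, so only the term with both vectors multiplied by `i`
survives. -/
theorem leviBilin_leaf_transverse (h : IsLeafParam φ d p₀) (v : ℂ) :
    leviBilin d (φ p₀) (v • fderiv ℝ φ p₀ (1, 0)) (fderiv ℝ φ p₀ (0, 1)) =
      fderiv ℝ (signedMetric φ d) p₀ (Complex.I * v, 0) := by
  have hd2 : ContDiffAt ℝ 2 d (thicken φ p₀.2 (p₀.1, 0)) := by
    rw [thicken_zero]; exact h.smooth_d.of_le (by norm_num)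
  have hhol : ∀ᶠ x in 𝓝 (p₀.1, (0 : ℂ)), DifferentiableAt ℂ (thicken φ p₀.2) x :=
    (h.thicken_analyticAt 0).eventually_analyticAt.mono fun x hx => hx.differentiableAt
  have h1 := leviBilin_comp hd2 hhol (h.thicken_contDiffAt 0 2) (v, 0) (0, 1)
  have h2 := h.fderiv_thicken_fst.self_of_nhds v
  rw [Complex.ofReal_zero, zero_mul, collarLeafVec_zero h] at h2
  rw [h2, h.fderiv_thicken_snd, one_smul, thicken_zero] at h1
  refine h1.symm.trans ?_
  have hK := h.comp_thicken_contDiffAt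
  have hKd := (hK.of_le (by norm_num : (2 : ℕ∞ω) ≤ 3)).differentiableAt_fderiv
  rw [leviBilin, fderiv_fderiv_apply hKd, fderiv_fderiv_apply hKd]
  have key : ∀ ζ u : ℂ, fderiv ℝ (fun x => fderiv ℝ (d ∘ thicken φ p₀.2) x (0, ζ)) (p₀.1, 0) (u, 0) =
      ζ.im * fderiv ℝ (signedMetric φ d) p₀ (u, 0) := by
    intro ζ u
    have h3 : HasFDerivAt (fun z : ℂ => fderiv ℝ (d ∘ thicken φ p₀.2) (z, 0) (0, ζ)) _ p₀.1 :=
      HasFDerivAt.comp (g := fun x => fderiv ℝ (d ∘ thicken φ p₀.2) x (0, ζ)) p₀.1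
        (hKd.clm_apply (differentiableAt_const _)).hasFDerivAt
        (hasFDerivAt_prodMk_left (𝕜 := ℝ) p₀.1 (0 : ℂ))
    have h4 : HasFDerivAt (fun z : ℂ => ζ.im * signedMetric φ d (z, p₀.2)) _ p₀.1 :=
      (HasFDerivAt.comp (g := signedMetric φ d) p₀.1
        (h.contDiffAt_signedMetric.differentiableAt (by simp)).hasFDerivAt
        (hasFDerivAt_prodMk_left (𝕜 := ℝ) p₀.1 p₀.2)).const_mul ζ.im
    have h5 := h4.congr_of_eventuallyEq (h.eventually_fderiv_comp_thicken ζ)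
    have h6 := congrArg (fun L => L u) (h3.unique h5)
    simpa using h6
  have k1 := key 1 v
  have k2 := key Complex.I (Complex.I * v)
  simp only [Complex.one_im, Complex.I_im, zero_mul, one_mul] at k1 k2
  have e1 : Complex.I • (v, (0 : ℂ)) = (Complex.I * v, 0) := by simp
  have e2 : Complex.I • ((0 : ℂ), (1 : ℂ)) = (0, Complex.I) := by simp
  rw [e1, e2, k1, k2, zero_add]

theorem contDiffAt_signedMetric_slice (h : IsLeafParam φ d p₀) :
    ContDiffAt ℝ 2 (fun z => signedMetric φ d (z, p₀.2)) p₀.1 :=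
  ContDiffAt.comp (g := signedMetric φ d) p₀.1 h.contDiffAt_signedMetric
    (contDiffAt_id.prodMk contDiffAt_const)

/-- By holomorphic invariance the Levi form along the leaf at height `s` is the Laplacian in `z` of
the pulled-back function on `w = is`. The height derivative passes through the two `z`-derivatives,
which is where three derivatives of `d` are used, and leaves the Laplacian of `σ`. -/
theorem hasDerivAt_leviBilin_leaf (h : IsLeafParam φ d p₀) :
    HasDerivAt (fun s => leviBilin d (collar φ (p₀, s)) (collarLeafVec φ (p₀, s))
      (collarLeafVec φ (p₀, s)))
      (leviBilin (fun z => signedMetric φ d (z, p₀.2)) p₀.1 1 1) 0 := by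
  set K := d ∘ thicken φ p₀.2 with hKdef
  have hK : ContDiffAt ℝ 3 K (p₀.1, 0) := h.comp_thicken_contDiffAt
  have hK2 : ContDiffAt ℝ 2 (fun y => fderiv ℝ K y (0, Complex.I)) (p₀.1, 0) :=
    (hK.fderiv_right (m := 2) (by norm_num)).clm_apply contDiffAt_const
  -- second derivatives of the slices of `K`
  have hlap : ∀ e : ℂ, HasDerivAt (fun s : ℝ => fderiv ℝ (fun y => fderiv ℝ K y (e, 0))
      (p₀.1, s * Complex.I) (e, 0))
      (fderiv ℝ (fderiv ℝ (fun z => signedMetric φ d (z, p₀.2))) p₀.1 e e) 0 := by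
    intro e
    have hD : DifferentiableAt ℝ (fun y => fderiv ℝ (fun y => fderiv ℝ K y (e, 0)) y (e, 0))
        (p₀.1, 0) := by
      have h2 : ContDiffAt ℝ 2 (fun y => fderiv ℝ K y (e, 0)) (p₀.1, 0) :=
        (hK.fderiv_right (m := 2) (by norm_num)).clm_apply contDiffAt_const
      exact h2.differentiableAt_fderiv.clm_apply (differentiableAt_const _)
    have hline : HasDerivAt (fun s : ℝ => (p₀.1, (s : ℂ) * Complex.I)) (0, Complex.I) 0 := by
      have h1 : HasDerivAt (fun s : ℝ => (s : ℂ) * Complex.I) (1 * Complex.I) 0 :=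
        (HasDerivAt.ofReal_comp (hasDerivAt_id 0)).mul_const Complex.I |>.congr_deriv (by simp)
      rw [one_mul] at h1
      exact (hasDerivAt_const _ _).prodMk h1
    have h1 : HasDerivAt (fun s : ℝ => fderiv ℝ (fun y => fderiv ℝ K y (e, 0))
      (p₀.1, s * Complex.I) (e, 0)) _ 0 :=
      HasFDerivAt.comp_hasDerivAt_of_eq
        (l := fun y => fderiv ℝ (fun y => fderiv ℝ K y (e, 0)) y (e, 0)) (0 : ℝ)
        hD.hasFDerivAt hline (by simp)
    refine h1.congr_deriv ?_
    rw [fderiv_fderiv_fderiv_comm hK]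
    -- pass to the slice
    have hS : (fun z => fderiv ℝ (fun z => signedMetric φ d (z, p₀.2)) z e) =ᶠ[𝓝 p₀.1]
        fun z => fderiv ℝ (fun y => fderiv ℝ K y (0, Complex.I)) (z, 0) (e, 0) := by
      have hc : ContinuousAt (fun z : ℂ => (z, (0 : ℂ))) p₀.1 := by fun_prop
      filter_upwards [(h.eventually_fderiv_comp_thicken Complex.I).eventually_nhds,
        hc.eventually (hK2.fderiv_eventually_hasFDerivAt (by norm_num))] with z h3 h4
      have h5 : HasFDerivAt (fun z : ℂ => fderiv ℝ K (z, 0) (0, Complex.I)) _ z :=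
        HasFDerivAt.comp (g := fun y => fderiv ℝ K y (0, Complex.I)) z h4.hasFDerivAt
          (hasFDerivAt_prodMk_left (𝕜 := ℝ) z (0 : ℂ))
      have h6 : (fun z => signedMetric φ d (z, p₀.2)) =ᶠ[𝓝 z]
          fun z : ℂ => fderiv ℝ K (z, 0) (0, Complex.I) := by
        filter_upwards [h3] with w hw
        rw [hKdef, hw]
        simp
      rw [h6.fderiv_eq, h5.fderiv]
      simp
    rw [fderiv_fderiv_apply h.contDiffAt_signedMetric_slice.differentiableAt_fderiv, hS.fderiv_eq]
    have h7 : HasFDerivAt (fun z : ℂ => fderiv ℝ (fun y => fderiv ℝ K y (0, Complex.I)) (z, 0) (e, 0))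
        _ p₀.1 :=
      HasFDerivAt.comp (g := fun y => fderiv ℝ (fun y => fderiv ℝ K y (0, Complex.I)) y (e, 0)) p₀.1
        (hK2.differentiableAt_fderiv.clm_apply (differentiableAt_const _)).hasFDerivAt
        (hasFDerivAt_prodMk_left (𝕜 := ℝ) p₀.1 (0 : ℂ))
    rw [h7.fderiv]
    simp
  have hsum := (hlap 1).add (hlap Complex.I)
  have hval : leviBilin (fun z => signedMetric φ d (z, p₀.2)) p₀.1 1 1 =
      fderiv ℝ (fderiv ℝ (fun z => signedMetric φ d (z, p₀.2))) p₀.1 1 1 +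
      fderiv ℝ (fderiv ℝ (fun z => signedMetric φ d (z, p₀.2))) p₀.1 Complex.I Complex.I := by
    simp [leviBilin]
  rw [hval]
  refine hsum.congr_of_eventuallyEq ?_
  have hline : ContinuousAt (fun s : ℝ => (p₀.1, (s : ℂ) * Complex.I)) 0 := by fun_prop
  have hline0 : (p₀.1, ((0 : ℝ) : ℂ) * Complex.I) = (p₀.1, 0) := by simp
  have hhol : ∀ᶠ x in 𝓝 (p₀.1, (0 : ℂ)), DifferentiableAt ℂ (thicken φ p₀.2) x :=
    (h.thicken_analyticAt 0).eventually_analyticAt.mono fun x hx => hx.differentiableAt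
  have hd3 : ∀ᶠ x in 𝓝 (p₀.1, (0 : ℂ)), ContDiffAt ℝ 3 d (thicken φ p₀.2 x) := by
    refine (h.thicken_contDiffAt 0 1).continuousAt.eventually ?_
    rw [thicken_zero]
    exact h.smooth_d.eventually (by simp)
  have hK3 : ∀ᶠ x in 𝓝 (p₀.1, (0 : ℂ)), ContDiffAt ℝ 3 K x := hK.eventually (by simp)
  rw [← hline0] at hhol hd3 hK3
  filter_upwards [hline.eventually hhol.eventually_nhds, hline.eventually hd3,
    hline.eventually hK3, h.fderiv_thicken_fst] with s h1 h2 h3 h4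
  have h5 := leviBilin_comp (h2.of_le (by norm_num)) h1 (h.thicken_contDiffAt _ 2) (1, 0) (1, 0)
  rw [h4, one_smul, thicken_mul_I] at h5
  have hKd := (h3.of_le (by norm_num : (2 : ℕ∞ω) ≤ 3)).differentiableAt_fderiv
  rw [← h5, leviBilin, fderiv_fderiv_apply hKd, fderiv_fderiv_apply hKd]
  simp [hKdef]

/-- At height zero the leaves lie in `{d = 0}`, so there the leafwise Levi form is the Laplacian of
a constant; its quotient by `s` tends to the height derivative. -/
theorem tendsto_leviBilin_leaf (h : IsLeafParam φ d p₀) :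
    Tendsto (fun x => leviBilin d (collar φ x) (collarLeafVec φ x) (collarLeafVec φ x) / x.2)
      (𝓝[{x | x.2 ≠ 0}] (p₀, 0))
      (𝓝 (leviBilin (fun z => signedMetric φ d (z, p₀.2)) p₀.1 1 1)) := by
  refine tendsto_div_height (G := fun x => leviBilin d (collar φ x) (collarLeafVec φ x)
    (collarLeafVec φ x)) ?_ ?_ h.hasDerivAt_leviBilin_leaf
  · have h2 : ContDiffAt ℝ 1 (fderiv ℝ (fderiv ℝ d)) (φ p₀) :=
      (h.smooth_d.fderiv_right (m := 2) (by norm_num)).fderiv_right (by norm_num)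
    have h3 : ContDiffAt ℝ 1 (fun x => fderiv ℝ (fderiv ℝ d) (collar φ x)) (p₀, 0) := by
      refine ContDiffAt.comp (g := fderiv ℝ (fderiv ℝ d)) _ ?_ (h.contDiffAt_collar.of_le (by norm_num))
      rwa [collar_zero]
    have h4 := h.contDiffAt_collarLeafVec
    have h5 := h4.const_smul Complex.I
    exact ((h3.clm_apply h4).clm_apply h4).add ((h3.clm_apply h5).clm_apply h5)
  · filter_upwards [h.eventually_isLeafParam] with p hp
    have hsl : ContinuousAt (fun z : ℂ => (z, p.2)) p.1 := by fun_prop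
    have hd2 : ContDiffAt ℝ 2 d (φ (p.1, p.2)) := hp.smooth_d.of_le (by norm_num)
    have ha := hp.thicken_analyticAt 0
    have hf : AnalyticAt ℂ (fun z => φ (z, p.2)) p.1 := by
      have h1 : AnalyticAt ℂ (fun z : ℂ => (z, (0 : ℂ))) p.1 := analyticAt_id.prod analyticAt_const
      have h2 := AnalyticAt.fun_comp (g := thicken φ p.2) (f := fun z : ℂ => (z, (0 : ℂ))) ha h1
      simpa only [thicken_zero] using h2
    have h1 := leviBilin_comp (h := fun z => φ (z, p.2)) hd2 (hf.eventually_analyticAt.mono fun x hx => hx.differentiableAt)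
      (hf.contDiffAt.restrict_scalars ℝ) 1 1
    have h0 : d ∘ (fun z => φ (z, p.2)) =ᶠ[𝓝 p.1] fun _ => 0 := hsl.eventually hp.zero
    rw [leviBilin_congr h0] at h1
    have h2 : fderiv ℝ (fun z => φ (z, p.2)) p.1 1 = fderiv ℝ φ p (1, 0) := by
      have h3 : HasFDerivAt (fun z => φ (z, p.2)) _ p.1 :=
        HasFDerivAt.comp (g := φ) p.1 (hp.smooth.differentiableAt (by simp)).hasFDerivAt
          (hasFDerivAt_prodMk_left (𝕜 := ℝ) p.1 p.2)
      rw [h3.fderiv]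
      simp
    rw [h2] at h1
    simp only [hp.collarLeafVec_zero, collar_zero]
    rw [← h1]
    simp [leviBilin]

end IsLeafParam

end LeviFlat

/-! ### Asymptotics of the form and of its discriminant at the boundary. -/

namespace LeviFlat

theorem tendsto_of_limit_eq {α β : Type*} [TopologicalSpace β] {f : α → β} {l : Filter α} {a b : β}
    (h : Tendsto f l (𝓝 a)) (e : a = b) : Tendsto f l (𝓝 b) := e ▸ h

/-- The leafwise Laplacian of the signed metric. -/
noncomputable def metricLaplacian (φ : ℂ × ℝ → ℂ × ℂ) (d : ℂ × ℂ → ℝ) (p : ℂ × ℝ) : ℝ :=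
  leviBilin (fun z => signedMetric φ d (z, p.2)) p.1 1 1

/-- The squared norm of the leafwise gradient of the signed metric. -/
noncomputable def metricGradSq (φ : ℂ × ℝ → ℂ × ℂ) (d : ℂ × ℂ → ℝ) (p : ℂ × ℝ) : ℝ :=
  fderiv ℝ (signedMetric φ d) p (1, 0) ^ 2 + fderiv ℝ (signedMetric φ d) p (Complex.I, 0) ^ 2

/-- The quantity that decides whether `-d^η` is plurisubharmonic near a boundary point. -/
noncomputable def dfExcess (φ : ℂ × ℝ → ℂ × ℂ) (d : ℂ × ℂ → ℝ) (η : ℝ) (p : ℂ × ℝ) : ℝ :=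
  (1 - η) * (-(signedMetric φ d p * metricLaplacian φ d p)) + (1 - 2 * η) * metricGradSq φ d p

namespace IsLeafParam

variable {φ : ℂ × ℝ → ℂ × ℂ} {d : ℂ × ℂ → ℝ} {p₀ : ℂ × ℝ}

theorem fderiv_transverse (h : IsLeafParam φ d p₀) : fderiv ℝ d (φ p₀) (fderiv ℝ φ p₀ (0, 1)) = 0 := by
  have h2 : HasFDerivAt (d ∘ φ) _ p₀ :=
    (h.smooth_d.differentiableAt (by simp)).hasFDerivAt.comp p₀
      (h.smooth.differentiableAt (by simp)).hasFDerivAt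
  have h3 : d ∘ φ =ᶠ[𝓝 p₀] fun _ => (0 : ℝ) := h.zero
  have h4 := congrArg (fun L => L (0, 1)) h2.fderiv
  rw [h3.fderiv_eq] at h4
  simpa using h4.symm

theorem tendsto_fderiv_d (h : IsLeafParam φ d p₀) :
    ContinuousAt (fun x => fderiv ℝ d (collar φ x)) (p₀, 0) := by
  refine ContinuousAt.comp (g := fderiv ℝ d) ?_ h.contDiffAt_collar.continuousAt
  rw [collar_zero]
  exact (h.smooth_d.fderiv_right (m := 2) (by norm_num)).continuousAt

theorem continuousAt_transverse (h : IsLeafParam φ d p₀) :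
    ContinuousAt (fun x : (ℂ × ℝ) × ℝ => fderiv ℝ φ x.1 (0, 1)) (p₀, 0) :=
  ContinuousAt.comp (g := fun p => fderiv ℝ φ p (0, 1)) h.contDiffAt_transverse.continuousAt
    continuousAt_fst

theorem continuousAt_leviBilin (h : IsLeafParam φ d p₀) {v w : (ℂ × ℝ) × ℝ → ℂ × ℂ}
    (hv : ContinuousAt v (p₀, 0)) (hw : ContinuousAt w (p₀, 0)) :
    ContinuousAt (fun x => leviBilin d (collar φ x) (v x) (w x)) (p₀, 0) := by
  have h2 : ContinuousAt (fderiv ℝ (fderiv ℝ d)) (φ p₀) :=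
    ((h.smooth_d.fderiv_right (m := 2) (by norm_num)).fderiv_right (m := 1)
      (by norm_num)).continuousAt
  have h3 : ContinuousAt (fun x => fderiv ℝ (fderiv ℝ d) (collar φ x)) (p₀, 0) := by
    refine ContinuousAt.comp (g := fderiv ℝ (fderiv ℝ d)) ?_ h.contDiffAt_collar.continuousAt
    rwa [collar_zero]
  exact ((h3.clm_apply hv).clm_apply hw).add
    ((h3.clm_apply (hv.const_smul Complex.I)).clm_apply (hw.const_smul Complex.I))

theorem tendsto_dfForm_transverse (h : IsLeafParam φ d p₀) (η : ℝ) :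
    Tendsto (fun x => dfForm d η (collar φ x) (fderiv ℝ φ x.1 (0, 1)) (fderiv ℝ φ x.1 (0, 1)))
      (𝓝 (p₀, 0)) (𝓝 ((1 - η) * signedMetric φ d p₀ ^ 2)) := by
  have hb := h.continuousAt_transverse
  have hc := h.contDiffAt_comp_collar.continuousAt
  have hc0 : d (φ p₀) = 0 := h.zero.self_of_nhds
  have h1 := h.tendsto_fderiv_d.clm_apply hb
  have h2 := h.tendsto_fderiv_d.clm_apply (hb.const_smul Complex.I)
  have h3 := ((hc.neg).mul (h.continuousAt_leviBilin hb hb)).add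
    (continuousAt_const (y := 1 - η) |>.mul ((h1.mul h1).add (h2.mul h2)))
  refine tendsto_of_limit_eq h3.tendsto ?_
  simp [signedMetric, sq, collar_zero, h.fderiv_transverse, hc0]

/-- Along the leaf `d`, its Levi form and its differential are each of order `s`, so both terms of
the form are of order `s²`. -/
theorem tendsto_dfForm_leaf (h : IsLeafParam φ d p₀) (η : ℝ) :
    Tendsto (fun x => dfForm d η (collar φ x) (collarLeafVec φ x) (collarLeafVec φ x) / x.2 ^ 2)
      (𝓝[{x | x.2 ≠ 0}] (p₀, 0)) (𝓝 (-(signedMetric φ d p₀ * metricLaplacian φ d p₀) +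
        (1 - η) * metricGradSq φ d p₀)) := by
  have h1 := h.tendsto_leaf 1
  have h2 := h.tendsto_leaf Complex.I
  simp only [one_smul] at h1
  have h3 := ((h.tendsto_height.mul h.tendsto_leviBilin_leaf).neg).add
    (((h1.mul h1).add (h2.mul h2)).const_mul (1 - η))
  refine tendsto_of_limit_eq (h3.congr fun x => ?_) ?_
  · unfold dfForm
    ring
  · simp only [metricLaplacian, metricGradSq]
    ring

/-- The Levi term contributes `-1` and the gradient term `1 - η` times the same quantity, whence the
coefficient `-η`. -/
theorem tendsto_dfForm_mixed (h : IsLeafParam φ d p₀) (η : ℝ) (ζ : ℂ) :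
    Tendsto (fun x => dfForm d η (collar φ x) (ζ • collarLeafVec φ x) (fderiv ℝ φ x.1 (0, 1)) / x.2)
      (𝓝[{x | x.2 ≠ 0}] (p₀, 0)) (𝓝 (-(η * signedMetric φ d p₀ *
        fderiv ℝ (signedMetric φ d) p₀ (Complex.I * ζ, 0)))) := by
  have hb := h.continuousAt_transverse
  have h1 := h.tendsto_leaf ζ
  have h2 := h.tendsto_leaf (Complex.I * ζ)
  have h4 := (h.tendsto_fderiv_d.clm_apply hb).tendsto.mono_left
    (nhdsWithin_le_nhds (s := {x : (ℂ × ℝ) × ℝ | x.2 ≠ 0}))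
  have h5 := (h.tendsto_fderiv_d.clm_apply (hb.const_smul Complex.I)).tendsto.mono_left
    (nhdsWithin_le_nhds (s := {x : (ℂ × ℝ) × ℝ | x.2 ≠ 0}))
  have h6 := (h.continuousAt_leviBilin (h.contDiffAt_collarLeafVec.continuousAt.const_smul ζ)
    hb).tendsto.mono_left (nhdsWithin_le_nhds (s := {x : (ℂ × ℝ) × ℝ | x.2 ≠ 0}))
  have h3 := ((h.tendsto_height.mul h6).neg).add (((h1.mul h4).add (h2.mul h5)).const_mul (1 - η))
  refine tendsto_of_limit_eq (h3.congr fun x => ?_) ?_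
  · unfold dfForm
    simp only [Pi.smul_apply, mul_smul]
    ring
  · simp only [Pi.smul_apply, collar_zero, h.fderiv_transverse, h.collarLeafVec_zero,
      h.leviBilin_leaf_transverse]
    simp only [signedMetric]
    ring

/-- Combining the three limits, the coefficient of `σ² |∇σ|²` is `(1 - η)² - η² = 1 - 2η`. -/
theorem tendsto_dfDisc (h : IsLeafParam φ d p₀) (η : ℝ) :
    Tendsto (fun x => dfDisc d η (collar φ x) (collarLeafVec φ x) (fderiv ℝ φ x.1 (0, 1)) / x.2 ^ 2)
      (𝓝[{x | x.2 ≠ 0}] (p₀, 0)) (𝓝 (signedMetric φ d p₀ ^ 2 * dfExcess φ d η p₀)) := by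
  have h1 := h.tendsto_dfForm_leaf η
  have h2 := (h.tendsto_dfForm_transverse η).mono_left
    (nhdsWithin_le_nhds (s := {x : (ℂ × ℝ) × ℝ | x.2 ≠ 0}))
  have h3 := h.tendsto_dfForm_mixed η 1
  have h4 := h.tendsto_dfForm_mixed η Complex.I
  simp only [one_smul] at h3
  have h5 := ((h1.mul h2).sub (h3.pow 2)).sub (h4.pow 2)
  refine tendsto_of_limit_eq (h5.congr fun x => ?_) ?_
  · unfold dfDisc
    ring
  · have e : fderiv ℝ (signedMetric φ d) p₀ (Complex.I * Complex.I, 0) =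
        -fderiv ℝ (signedMetric φ d) p₀ (1, 0) := by
      rw [Complex.I_mul_I, ← map_neg]
      simp
    rw [e, mul_one]
    simp only [dfExcess, metricGradSq]
    ring

end IsLeafParam

end LeviFlat

/-! ### From the critical exponent to the leafwise equation. -/

namespace LeviFlat

/-- Two vectors of `ℂ²` with nonzero determinant form a basis. -/
theorem exists_combination_of_det_ne_zero {a b : ℂ × ℂ} (h : a.1 * b.2 - a.2 * b.1 ≠ 0) (v : ℂ × ℂ) :
    ∃ ξ ζ : ℂ, v = ξ • a + ζ • b := by
  refine ⟨(v.1 * b.2 - v.2 * b.1) / (a.1 * b.2 - a.2 * b.1),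
    (a.1 * v.2 - a.2 * v.1) / (a.1 * b.2 - a.2 * b.1), Prod.ext ?_ ?_⟩
  · simp only [Prod.fst_add, Prod.smul_fst, smul_eq_mul]
    rw [div_mul_eq_mul_div, div_mul_eq_mul_div, ← add_div, eq_div_iff h]
    ring
  · simp only [Prod.snd_add, Prod.smul_snd, smul_eq_mul]
    rw [div_mul_eq_mul_div, div_mul_eq_mul_div, ← add_div, eq_div_iff h]
    ring

theorem eq_zero_of_det_ne_zero {a b : ℂ × ℂ} (h : a.1 * b.2 - a.2 * b.1 ≠ 0) (ξ ζ : ℂ)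
    (h0 : ξ • a + ζ • b = 0) : ξ = 0 ∧ ζ = 0 := by
  have h1 : ξ * a.1 + ζ * b.1 = 0 := by simpa using congrArg Prod.fst h0
  have h2 : ξ * a.2 + ζ * b.2 = 0 := by simpa using congrArg Prod.snd h0
  constructor
  · refine (mul_eq_zero.1 (?_ : ξ * (a.1 * b.2 - a.2 * b.1) = 0)).resolve_right h
    linear_combination b.2 * h1 - b.1 * h2
  · refine (mul_eq_zero.1 (?_ : ζ * (a.1 * b.2 - a.2 * b.1) = 0)).resolve_right h
    linear_combination a.1 * h2 - a.2 * h1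

namespace IsLeafParam

variable {φ : ℂ × ℝ → ℂ × ℂ} {d : ℂ × ℂ → ℝ} {p₀ : ℂ × ℝ}

/-- The collar has surjective differential, so it is open at the base point: statements near `φ p₀`
are the same as statements near `(p₀, 0)` in collar coordinates. -/
theorem map_collar_nhds (h : IsLeafParam φ d p₀) :
    map (collar φ) (𝓝 (p₀, 0)) = 𝓝 (φ p₀) := by
  have hs := h.contDiffAt_collar.hasStrictFDerivAt (by simp)
  have h2 : ContDiffAt ℝ 2 φ p₀ := h.smooth.of_le (by norm_num)
  rw [hs.map_nhds_eq_of_surj, collar_zero]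
  refine LinearMap.range_eq_top.2 fun v => ?_
  obtain ⟨ξ, ζ, rfl⟩ := exists_combination_of_det_ne_zero h.indep v
  refine ⟨((ξ, ζ.re), ζ.im), ?_⟩
  have e : (((ξ, ζ.re), ζ.im) : (ℂ × ℝ) × ℝ) =
      ((ξ, 0), 0) + (ζ.re • ((0, 1), 0) + ζ.im • (0, 1)) := by ext <;> simp
  change fderiv ℝ (collar φ) (p₀, 0) _ = _
  rw [e, map_add, map_add, map_smul, map_smul, fderiv_collar_fst (x := (p₀, (0 : ℝ))) h2,
    fderiv_collar_fst (x := (p₀, (0 : ℝ))) h2, fderiv_collar_snd (x := (p₀, (0 : ℝ))) h2,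
    h.hol.self_of_nhds]
  conv_rhs => rw [← Complex.re_add_im ζ]
  simp only [zero_smul, add_zero, add_smul, mul_smul, Complex.coe_smul]

theorem eventually_det_ne_zero (h : IsLeafParam φ d p₀) : ∀ᶠ x in 𝓝 (p₀, (0 : ℝ)),
    (collarLeafVec φ x).1 * (fderiv ℝ φ x.1 (0, 1)).2 -
      (collarLeafVec φ x).2 * (fderiv ℝ φ x.1 (0, 1)).1 ≠ 0 := by
  have h1 := h.contDiffAt_collarLeafVec.continuousAt
  have h2 := h.continuousAt_transverse
  have h3 : ContinuousAt (fun x => (collarLeafVec φ x).1 * (fderiv ℝ φ x.1 (0, 1)).2 -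
      (collarLeafVec φ x).2 * (fderiv ℝ φ x.1 (0, 1)).1) (p₀, (0 : ℝ)) :=
    (h1.fst.mul h2.snd).sub (h1.snd.mul h2.fst)
  refine h3.eventually_ne ?_
  rw [h.collarLeafVec_zero]
  exact h.indep

theorem eventually_contDiffAt_collar_d (h : IsLeafParam φ d p₀) :
    ∀ᶠ x in 𝓝 (p₀, (0 : ℝ)), ContDiffAt ℝ 2 d (collar φ x) := by
  refine h.contDiffAt_collar.continuousAt.eventually ?_
  rw [collar_zero]
  exact (h.smooth_d.of_le (by norm_num : (2 : ℕ∞ω) ≤ 3)).eventually (by simp)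

theorem eventually_ne_zero_height (h : IsLeafParam φ d p₀) :
    ∀ᶠ x in 𝓝 (p₀, (0 : ℝ)), d (collar φ x) ≠ 0 → x.2 ≠ 0 := by
  filter_upwards [(continuous_fst.tendsto (p₀, (0 : ℝ))).eventually h.zero] with x hx h1 h2
  apply h1
  have : x = (x.1, 0) := Prod.ext rfl h2
  rw [this, collar_zero, hx]

/-- Off the hypersurface the discriminant is `s²` times a quantity with positive limit and the
transverse coefficient is positive; a Hermitian form in two variables with these signs is positive
definite. -/
theorem eventually_dfForm_pos (h : IsLeafParam φ d p₀) (hσ : signedMetric φ d p₀ ≠ 0) {η : ℝ}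
    (hη : η < 1) (hE : 0 < dfExcess φ d η p₀) :
    ∀ᶠ y in 𝓝 (φ p₀), d y ≠ 0 → ∀ v, v ≠ 0 → 0 < dfForm d η y v v := by
  rw [← h.map_collar_nhds]
  have hσ2 : 0 < signedMetric φ d p₀ ^ 2 := by positivity
  have h1 := (h.tendsto_dfDisc η).eventually_const_lt (mul_pos hσ2 hE)
  rw [eventually_nhdsWithin_iff] at h1
  have h2 := (h.tendsto_dfForm_transverse η).eventually_const_lt (mul_pos (sub_pos.2 hη) hσ2)
  refine eventually_map.2 ?_
  filter_upwards [h1, h2, h.eventually_det_ne_zero, h.eventually_contDiffAt_collar_d,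
    h.eventually_ne_zero_height] with x hx1 hx2 hdet hd hne hd0 v hv
  have hs := hne hd0
  have hdisc : 0 < dfDisc d η (collar φ x) (collarLeafVec φ x) (fderiv ℝ φ x.1 (0, 1)) := by
    have h3 := hx1 hs
    have h4 : 0 < x.2 ^ 2 := by positivity
    exact (div_pos_iff_of_pos_right h4).1 h3
  obtain ⟨ξ, ζ, rfl⟩ := exists_combination_of_det_ne_zero hdet v
  refine dfForm_pos_of_dfDisc_pos hd hx2 hdisc ?_
  by_contra! h0
  simp [h0] at hv

/-- Positivity is assumed only at points accumulating at the boundary point, which is what approach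
from inside `Ω` provides: a negative limit would make the discriminant negative at all nearby points
off the hypersurface. -/
theorem dfExcess_nonneg (h : IsLeafParam φ d p₀) (hσ : signedMetric φ d p₀ ≠ 0) {η : ℝ}
    (hf : ∃ᶠ y in 𝓝 (φ p₀), d y ≠ 0 ∧ ∀ v, v ≠ 0 → 0 < dfForm d η y v v) :
    0 ≤ dfExcess φ d η p₀ := by
  by_contra! hE
  have hσ2 : 0 < signedMetric φ d p₀ ^ 2 := by positivity
  have h1 := (h.tendsto_dfDisc η).eventually_lt_const (mul_neg_of_pos_of_neg hσ2 hE)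
  rw [eventually_nhdsWithin_iff] at h1
  rw [← h.map_collar_nhds] at hf
  refine hf (eventually_map.2 ?_)
  filter_upwards [h1, h.eventually_det_ne_zero, h.eventually_contDiffAt_collar_d,
    h.eventually_ne_zero_height] with x hx1 hdet hd hne hx
  have h3 := hx1 (hne hx.1)
  have h4 := dfDisc_pos_of_dfForm_pos hd (eq_zero_of_det_ne_zero hdet) hx.2
  have h5 : 0 < x.2 ^ 2 := by have := hne hx.1; positivity
  exact absurd h3 (not_lt.2 (div_pos h4 h5).le)

theorem continuous_dfExcess (p : ℂ × ℝ) : Continuous fun η => dfExcess φ d η p := by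
  unfold dfExcess
  fun_prop

/-- The exponent at which plurisubharmonicity is lost solves the leafwise equation. -/
theorem dfExcess_sSup_eq_zero (h : IsLeafParam φ d p₀) (hσ : signedMetric φ d p₀ ≠ 0) {A : Set ℝ}
    (hA : A ⊆ Ioo 0 1) {η : ℝ} (hη : sSup A = η) (hη0 : 0 < η) (hη1 : η < 1)
    (hnonneg : ∀ ε ∈ A, ∃ᶠ y in 𝓝 (φ p₀), d y ≠ 0 ∧ ∀ v, v ≠ 0 → 0 < dfForm d ε y v v)
    (hpos : ∀ ε ∈ Ioo (0 : ℝ) 1,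
      (∀ᶠ y in 𝓝 (φ p₀), d y ≠ 0 → ∀ v, v ≠ 0 → 0 < dfForm d ε y v v) → ε ∈ A) :
    dfExcess φ d η p₀ = 0 := by
  have hne : A.Nonempty := by
    by_contra! hA
    rw [hA, Real.sSup_empty] at hη
    exact hη0.ne hη
  have hbdd : BddAbove A := ⟨1, fun x hx => (hA hx).2.le⟩
  have hc := (continuous_dfExcess (φ := φ) (d := d) p₀).continuousAt (x := η)
  rcases lt_trichotomy (dfExcess φ d η p₀) 0 with hE | hE | hE
  · have h1 := hc.eventually_lt_const hE
    obtain ⟨ε, hε, hb⟩ := Metric.eventually_nhds_iff.1 h1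
    -- Negativity at the supremum persists at admissible exponents just below it. These exist
    -- although `A` is not known to be an interval.
    obtain ⟨ξ, hξA, hξ⟩ := exists_lt_of_lt_csSup hne (show η - ε < sSup A by linarith)
    have hξ2 := le_csSup hbdd hξA
    have h2 := h.dfExcess_nonneg hσ (hnonneg ξ hξA)
    have h3 := hb (y := ξ) (by rw [Real.dist_eq, abs_lt]; constructor <;> linarith)
    linarith
  · exact hE
  · have h1 := hc.eventually_const_lt hE
    obtain ⟨ε, hε, hb⟩ := Metric.eventually_nhds_iff.1 h1
    -- An exponent strictly between `η` and `1` and within `ε` of `η`; it would be admissible and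
    -- exceed the supremum.
    set ξ := min (η + ε / 2) ((η + 1) / 2)
    have hξ1 : η < ξ := lt_min (by linarith) (by linarith)
    have hξ2 : ξ ≤ η + ε / 2 := min_le_left _ _
    have hξ3 : ξ ≤ (η + 1) / 2 := min_le_right _ _
    have h2 := hb (y := ξ) (by rw [Real.dist_eq, abs_lt]; constructor <;> linarith)
    have h3 := hpos ξ ⟨by linarith, by linarith⟩ (h.eventually_dfForm_pos hσ (by linarith) h2)
    have h4 := le_csSup hbdd h3
    linarith

/-- If the excess vanishes then the power `|σ|^α` of the signed metric has zero leafwise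
Laplacian. -/
theorem leviBilin_abs_rpow_eq_zero (h : IsLeafParam φ d p₀) (hσ : signedMetric φ d p₀ ≠ 0) {η α : ℝ}
    (hη0 : 0 < η) (hη1 : η < 1) (hα : α = (η⁻¹ - 1)⁻¹) (hE : dfExcess φ d η p₀ = 0) :
    leviBilin (fun z => |signedMetric φ d (z, p₀.2)| ^ α) p₀.1 1 1 = 0 := by
  set τ : ℂ → ℝ := fun z => signedMetric φ d (z, p₀.2) with hτ
  have hτ2 : ContDiffAt ℝ 2 τ p₀.1 := h.contDiffAt_signedMetric_slice
  have hgrad : ∀ v : ℂ, fderiv ℝ τ p₀.1 v = fderiv ℝ (signedMetric φ d) p₀ (v, 0) := by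
    intro v
    have h1 : HasFDerivAt τ _ p₀.1 := HasFDerivAt.comp (g := signedMetric φ d) p₀.1
      (h.contDiffAt_signedMetric.differentiableAt (by simp)).hasFDerivAt
      (hasFDerivAt_prodMk_left (𝕜 := ℝ) p₀.1 p₀.2)
    rw [h1.fderiv]
    simp
  have hα1 : α - 1 = (2 * η - 1) / (1 - η) := by
    have : 1 - η ≠ 0 := by linarith
    rw [hα, show η⁻¹ - 1 = (1 - η) / η by field_simp, inv_div]
    field_simp
    ring
  -- The vanishing excess divided by `-(1 - η)`: the equation `σ Δσ + (α - 1) |∇σ|² = 0`, which is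
  -- the vanishing of the Laplacian of a power with exponent `α`.
  have hrel : τ p₀.1 * leviBilin τ p₀.1 1 1 +
      (α - 1) * (fderiv ℝ τ p₀.1 1 ^ 2 + fderiv ℝ τ p₀.1 Complex.I ^ 2) = 0 := by
    rw [hgrad, hgrad, hα1]
    have h1 : 1 - η ≠ 0 := by linarith
    field_simp
    have h2 : (1 - η) * (-(τ p₀.1 * leviBilin τ p₀.1 1 1)) + (1 - 2 * η) *
      (fderiv ℝ (signedMetric φ d) p₀ (1, 0) ^ 2 +
        fderiv ℝ (signedMetric φ d) p₀ (Complex.I, 0) ^ 2) = 0 := hE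
    linear_combination -h2
  have main : ∀ f : ℂ → ℝ, ContDiffAt ℝ 2 f p₀.1 → 0 < f p₀.1 →
      f p₀.1 * leviBilin f p₀.1 1 1 +
      (α - 1) * (fderiv ℝ f p₀.1 1 ^ 2 + fderiv ℝ f p₀.1 Complex.I ^ 2) = 0 →
      leviBilin (fun z => f z ^ α) p₀.1 1 1 = 0 := by
    intro f hf hpos hr
    rw [leviBilin, fderiv_fderiv_rpow hf hpos, fderiv_fderiv_rpow hf hpos]
    simp only [leviBilin, smul_eq_mul, mul_one] at hr ⊢
    linear_combination α * f p₀.1 ^ (α - 2) * hr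
  -- The sign of `σ` depends on the orientation of `t`; the equation is invariant under `σ ↦ -σ`.
  rcases lt_or_gt_of_ne hσ with hs | hs
  · have e : (fun z => |τ z| ^ α) =ᶠ[𝓝 p₀.1] fun z => (-τ z) ^ α := by
      filter_upwards [hτ2.continuousAt.eventually_lt_const hs] with z hz
      rw [abs_of_neg hz]
    rw [leviBilin_congr e]
    refine main (fun z => -τ z) hτ2.neg (neg_pos.2 hs) ?_
    rw [leviBilin_neg]
    simp only [fderiv_fun_neg, neg_apply]
    linear_combination hrel
  · have e : (fun z => |τ z| ^ α) =ᶠ[𝓝 p₀.1] fun z => τ z ^ α := by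
      filter_upwards [hτ2.continuousAt.eventually_const_lt hs] with z hz
      rw [abs_of_pos hz]
    rw [leviBilin_congr e]
    exact main τ hτ2 hs hrel

theorem contDiffAt_abs_rpow (h : IsLeafParam φ d p₀) (hσ : signedMetric φ d p₀ ≠ 0) (α : ℝ) :
    ContDiffAt ℝ 2 (fun z => |signedMetric φ d (z, p₀.2)| ^ α) p₀.1 :=
  (h.contDiffAt_signedMetric_slice.abs hσ).rpow_const_of_ne (abs_ne_zero.2 hσ)

end IsLeafParam

end LeviFlat

/-! ### Harmonicity of `h_δ^α` on the manifold. -/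

namespace LeviFlat

variable {X : Type*} [TopologicalSpace X] [ChartedSpace (ℂ × ℂ) X] [IsManifold 𝓘(ℂ, ℂ × ℂ) ω X]
  {Ω S : Set X} {δ : X → ℝ}

theorem det_ne_zero_of_independent {a b : ℂ × ℂ}
    (h : ∀ μ ν : ℂ, μ • a + ν • b = 0 → μ = 0 ∧ ν = 0) : a.1 * b.2 - a.2 * b.1 ≠ 0 := by
  intro h0
  have h1 := h b.1 (-a.1) (by
    ext
    · simp; ring
    · simp; linear_combination -h0)
  have h2 := h b.2 (-a.2) (by
    ext
    · simp; linear_combination h0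
    · simp; ring)
  have ha : a = 0 := Prod.ext (neg_eq_zero.1 h1.2) (neg_eq_zero.1 h2.2)
  exact one_ne_zero (h 1 0 (by simp [ha])).1

theorem FoliatedChart.isLeafParam {M : Set X} {c : FoliatedChart M} (hδ : ∀ x ∈ M, C3At δ x)
    (h0 : ∀ x ∈ M, δ x = 0) {x₀ : X} {p : ℂ × ℝ} (hp : p ∈ c.D ×ˢ c.T)
    (hx : c.param p ∈ (chartAt (ℂ × ℂ) x₀).source) :
    IsLeafParam (chartAt (ℂ × ℂ) x₀ ∘ c.param) (δ ∘ (chartAt (ℂ × ℂ) x₀).symm) p where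
  smooth := contDiffAt_chart_param hp hx
  hol := by
    filter_upwards [chart_param_eventually hp hx] with q hq ζ
    have := fderiv_chart_param_smul hq.1 hq.2 ζ 1
    rwa [smul_eq_mul, mul_one] at this
  indep := by
    refine det_ne_zero_of_independent fun μ ν h => ?_
    rw [fderiv_chart_param hp hx, fderiv_chart_param hp hx] at h
    have h1 : chartDeriv x₀ (c.param p) (μ • c.leafVec p + ν • c.transVec p) = 0 := by
      rw [map_add, map_smul, map_smul]
      exact h
    exact leafVec_transVec_independent hp (chartDeriv_injective hx (h1.trans (map_zero _).symm))
  smooth_d := (hδ _ (c.param_mem p)).contDiffAt hx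
  zero := by
    filter_upwards [chart_param_eventually hp hx] with q hq
    simp only [Function.comp]
    rw [(chartAt (ℂ × ℂ) x₀).left_inv hq.2]
    exact h0 _ (c.param_mem q)

/-- Openness of `Ω` puts the point outside `Ω`, so `δ ≤ 0` there; approach from inside, where `δ >
0`, gives the other inequality. -/
theorem IsBoundaryDistance.eq_zero (hΩ : IsOpen Ω) (hδ : IsBoundaryDistance Ω δ) {x : X}
    (hx : x ∈ frontier Ω) : δ x = 0 := by
  have hc : x ∈ closure Ω := frontier_subset_closure hx
  have hn : x ∉ Ω := fun h => (hΩ.frontier_eq ▸ hx).2 h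
  have h1 : δ x ≤ 0 := not_lt.1 fun h => hn ((hδ.pos_iff x hc).2 h)
  refine le_antisymm h1 ?_
  have h2 : ContinuousAt δ x := (hδ.smooth x hc).continuousAt
  have := mem_closure_iff_frequently.1 hc
  by_contra! h3
  refine this ?_
  filter_upwards [h2.eventually_lt_const h3] with y hy hyΩ
  exact absurd ((hδ.pos_iff y (subset_closure hyΩ)).1 hyΩ) (not_lt.2 hy.le)

/-- Strict plurisubharmonicity of `-δ^η` at a point of `Ω`, read in a chart. -/
theorem leviForm_neg_rpow_pos_iff {x₀ y : X} (hy : y ∈ (chartAt (ℂ × ℂ) x₀).source) (hδ : C3At δ y)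
    (hpos : 0 < δ y) {η : ℝ} (hη : 0 < η) :
    (∀ v, v ≠ 0 → 0 < leviForm (fun x => -(δ x ^ η)) y v) ↔
      ∀ v, v ≠ 0 → 0 < dfForm (δ ∘ (chartAt (ℂ × ℂ) x₀).symm) η (chartAt (ℂ × ℂ) x₀ y) v v := by
  set e := chartAt (ℂ × ℂ) x₀
  have hd : ContDiffAt ℝ 2 (δ ∘ e.symm) (e y) := (hδ.contDiffAt hy).of_le (by norm_num)
  have hy' : (δ ∘ e.symm) (e y) = δ y := by simp [e.left_inv hy]
  have hd0 : 0 < (δ ∘ e.symm) (e y) := by rwa [hy']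
  have hf : ContDiffAt ℝ 2 ((fun x => -(δ x ^ η)) ∘ e.symm) (e y) :=
    (hd.rpow_const_of_ne hd0.ne').neg
  have key : ∀ v, leviForm (fun x => -(δ x ^ η)) y v = η * δ y ^ (η - 2) / 4 *
      dfForm (δ ∘ e.symm) η (e y) (chartDeriv x₀ y v) (chartDeriv x₀ y v) := by
    intro v
    rw [leviForm_eq hy hf]
    have := leviBilin_neg_rpow hd hd0 η (chartDeriv x₀ y v)
    rw [hy'] at this
    change leviBilin (fun y => -((δ ∘ e.symm) y ^ η)) _ _ _ / 4 = _
    rw [this]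
    ring
  have hc : 0 < η * δ y ^ (η - 2) / 4 := by positivity
  have hinj := chartDeriv_injective hy
  constructor
  · intro h v hv
    obtain ⟨w, rfl⟩ := chartDeriv_surjective hy v
    have hw : w ≠ 0 := by rintro rfl; simp at hv
    have := h w hw
    rw [key] at this
    exact pos_of_mul_pos_right this hc.le
  · intro h v hv
    rw [key]
    refine mul_pos hc (h _ fun h0 => hv (hinj (h0.trans (map_zero _).symm)))

namespace FoliatedChart

variable {c : FoliatedChart (frontier Ω)}

/-- The set of exponents whose supremum defines `localDFExponent` satisfies both criteria: the
points of `Ω` accumulate at the boundary point, and positivity near that point yields the required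
neighbourhood. -/
theorem dfExcess_eq_zero (hΩ : IsOpen Ω) (hδ : IsBoundaryDistance Ω δ) {p : ℂ × ℝ}
    (hp : p ∈ c.D ×ˢ c.T) {x₀ : X} (hx : c.param p ∈ (chartAt (ℂ × ℂ) x₀).source)
    (hσ : signedMetric (chartAt (ℂ × ℂ) x₀ ∘ c.param) (δ ∘ (chartAt (ℂ × ℂ) x₀).symm) p ≠ 0)
    {η : ℝ} (hη : localDFExponent Ω δ (c.param p) = η) (hη0 : 0 < η) (hη1 : η < 1) :
    dfExcess (chartAt (ℂ × ℂ) x₀ ∘ c.param) (δ ∘ (chartAt (ℂ × ℂ) x₀).symm) η p = 0 := by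
  set e := chartAt (ℂ × ℂ) x₀
  have hcl : ∀ x ∈ frontier Ω, C3At δ x := fun x hx => hδ.smooth x (frontier_subset_closure hx)
  have hL : IsLeafParam (e ∘ c.param) (δ ∘ e.symm) p :=
    c.isLeafParam hcl (fun x hx => hδ.eq_zero hΩ hx) hp hx
  have hpF : c.param p ∈ frontier Ω := c.param_mem p
  refine hL.dfExcess_sSup_eq_zero hσ (fun ξ hξ => hξ.1) hη hη0 hη1 ?_ ?_
  · rintro ξ ⟨hξ, U, hU, hpU, hpsh⟩
    have h1 : ∃ᶠ y in 𝓝 (c.param p), y ∈ Ω :=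
      mem_closure_iff_frequently.1 (frontier_subset_closure hpF)
    have h2 : ∀ᶠ y in 𝓝 (c.param p), y ∈ U ∩ e.source :=
      (hU.inter e.open_source).mem_nhds ⟨hpU, hx⟩
    have h3 := h1.and_eventually h2
    have h4 : Tendsto e (𝓝 (c.param p)) (𝓝 ((e ∘ c.param) p)) := e.continuousAt hx
    refine h4.frequently (h3.mono ?_)
    rintro y ⟨hyΩ, hyU, hye⟩
    have hyc := subset_closure hyΩ
    have hpos := (hδ.pos_iff y hyc).1 hyΩ
    refine ⟨by simpa [e.left_inv hye] using hpos.ne', ?_⟩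
    exact (leviForm_neg_rpow_pos_iff hye (hδ.smooth y hyc) hpos hξ.1).1 (hpsh y ⟨hyU, hyΩ⟩)
  · intro ξ hξ hev
    refine ⟨hξ, ?_⟩
    have h4 : Tendsto e (𝓝 (c.param p)) (𝓝 ((e ∘ c.param) p)) := e.continuousAt hx
    have h5 := (h4.eventually hev).and (e.open_source.mem_nhds hx)
    obtain ⟨U, hUs, hU, hpU⟩ := mem_nhds_iff.1 h5
    refine ⟨U, hU, hpU, ?_⟩
    rintro y ⟨hyU, hyΩ⟩
    have hyc := subset_closure hyΩ
    have hpos := (hδ.pos_iff y hyc).1 hyΩ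
    obtain ⟨h6, hye⟩ := hUs hyU
    refine (leviForm_neg_rpow_pos_iff hye (hδ.smooth y hyc) hpos hξ.1).2 (h6 ?_)
    simpa [e.left_inv hye] using hpos.ne'

/-- The power `h_δ^α` is harmonic along the leaves on which the local Diederich--Fornaess exponent is
constant. -/
theorem harmonicOnNhd_normalMetric (hΩ : IsOpen Ω) (hδ : IsBoundaryDistance Ω δ)
    (hS : IsSaturated (frontier Ω) S) {η α : ℝ} (hη : ∀ p ∈ S, localDFExponent Ω δ p = η)
    (hη0 : 0 < η) (hη1 : η < 1) (hα : α = (η⁻¹ - 1)⁻¹) {t : ℝ} (ht : t ∈ c.transversal S) :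
    InnerProductSpace.HarmonicOnNhd (fun z => c.normalMetric δ (z, t) ^ α) c.D := by
  have hcl : ∀ x ∈ frontier Ω, C3At δ x := fun x hx => hδ.smooth x (frontier_subset_closure hx)
  have hz0 : ∀ x ∈ frontier Ω, δ x = 0 := fun x hx => hδ.eq_zero hΩ hx
  have key : ∀ z ∈ c.D, ContDiffAt ℝ 2 (fun z => c.normalMetric δ (z, t) ^ α) z ∧
      leviBilin (fun z => c.normalMetric δ (z, t) ^ α) z 1 1 = 0 := by
    intro z hz
    have hp : (z, t) ∈ c.D ×ˢ c.T := ⟨hz, ht.1⟩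
    have hpS : c.param (z, t) ∈ S := (mem_transversal_iff hS hp).1 ht
    set x₀ := c.param (z, t)
    have hx : c.param (z, t) ∈ (chartAt (ℂ × ℂ) x₀).source := mem_chart_source _ _
    have hL := c.isLeafParam hcl hz0 hp hx
    have hσ : signedMetric (chartAt (ℂ × ℂ) x₀ ∘ c.param) (δ ∘ (chartAt (ℂ × ℂ) x₀).symm) (z, t)
        ≠ 0 := by
      have h1 := normalMetric_pos hcl hz0 hδ.diff_ne_zero hp
      rw [normalMetric_eq (hcl _ (c.param_mem _)) hp hx] at h1
      exact abs_pos.1 h1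
    have hE := dfExcess_eq_zero hΩ hδ hp hx hσ (hη _ hpS) hη0 hη1
    have hev : (fun z => c.normalMetric δ (z, t) ^ α) =ᶠ[𝓝 z] fun z =>
        |signedMetric (chartAt (ℂ × ℂ) x₀ ∘ c.param) (δ ∘ (chartAt (ℂ × ℂ) x₀).symm) (z, t)| ^ α := by
      filter_upwards [(chart_param_eventually hp hx).slice] with w hw
      rw [normalMetric_eq (hcl _ (c.param_mem _)) hw.1 hw.2]
      rfl
    refine ⟨(hL.contDiffAt_abs_rpow hσ α).congr_of_eventuallyEq hev, ?_⟩
    rw [leviBilin_congr hev]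
    exact hL.leviBilin_abs_rpow_eq_zero hσ hη0 hη1 hα hE
  intro z hz
  refine ⟨(key z hz).1, ?_⟩
  filter_upwards [c.isOpen_D.mem_nhds hz] with w hw
  have h1 := key w hw
  rw [InnerProductSpace.laplacian_eq_iteratedFDeriv_complexPlane]
  simp only [iteratedFDeriv_two_apply]
  simpa [leviBilin] using h1.2

end FoliatedChart

end LeviFlat

/-! ### Parameter integrals and a Schwarz-type formula. -/

namespace LeviFlat

/-- Integrals of `C^n` functions over a compact interval depend `C^n` on parameters. -/
theorem contDiffOn_intervalIntegral {P F : Type*} [NormedAddCommGroup P] [NormedSpace ℝ P]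
    [NormedAddCommGroup F] [NormedSpace ℝ F] {n : ℕ∞} {G : P × ℝ → F} {s : Set P} {J : Set ℝ}
    {a b : ℝ} (hs : IsOpen s) (hJ : IsOpen J) (hab : a ≤ b) (hJab : Icc a b ⊆ J)
    (hG : ContDiffOn ℝ n G (s ×ˢ J)) : ContDiffOn ℝ n (fun p => ∫ x in a..b, G (p, x)) s := by
  obtain ⟨ε, hε, hεJ⟩ := isCompact_Icc.exists_cthickening_subset_open hJ hJab
  let χ : ContDiffBump ((a + b) / 2) := ⟨(b - a) / 2 + ε / 2, (b - a) / 2 + ε, by linarith, by linarith⟩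
  have hball : Metric.closedBall ((a + b) / 2) ((b - a) / 2 + ε) ⊆ J := by
    intro x hx
    apply hεJ
    rw [Real.closedBall_eq_Icc] at hx
    refine Metric.mem_cthickening_of_dist_le x (max a (min x b)) ε _
      ⟨le_max_left _ _, max_le hab (min_le_right _ _)⟩ ?_
    rw [Real.dist_eq, abs_le]
    constructor
    · rcases max_cases a (min x b) with h | h <;> rcases min_cases x b with h' | h' <;>
        linarith [hx.1, hx.2]
    · rcases max_cases a (min x b) with h | h <;> rcases min_cases x b with h' | h' <;>
        linarith [hx.1, hx.2]
  have hone : ∀ x ∈ Icc a b, χ x = 1 := by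
    intro x hx
    refine χ.one_of_mem_closedBall ?_
    rw [Real.closedBall_eq_Icc]
    change x ∈ Icc ((a + b) / 2 - ((b - a) / 2 + ε / 2)) ((a + b) / 2 + ((b - a) / 2 + ε / 2))
    constructor <;> linarith [hx.1, hx.2]
  -- Cut off and reflected, so that the integral becomes the convolution of the indicator of the
  -- interval with `g p`, evaluated at `0`.
  let g : P → ℝ → F := fun p x => χ (-x) • G (p, -x)
  let k : Set ℝ := -Metric.closedBall ((a + b) / 2) ((b - a) / 2 + ε)
  have hzero : ∀ x, x ∉ k → χ (-x) = 0 := by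
    intro x hx
    refine χ.zero_of_le_dist ?_
    by_contra! h
    exact hx (Set.mem_neg.2 (Metric.mem_closedBall.2 h.le))
  have hk : IsCompact k := (isCompact_closedBall _ _).neg
  have hg : ContDiffOn ℝ n (Function.uncurry g) (s ×ˢ univ) := by
    rintro ⟨p, x⟩ ⟨hp, -⟩
    refine ContDiffAt.contDiffWithinAt ?_
    by_cases hx : -x ∈ J
    · have h1 : ContDiffAt ℝ n G (p, -x) := hG.contDiffAt ((hs.prod hJ).mem_nhds ⟨hp, hx⟩)
      have h2 : ContDiffAt ℝ n (fun q : P × ℝ => G (q.1, -q.2)) (p, x) :=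
        ContDiffAt.comp (g := G) (p, x) h1 (contDiffAt_fst.prodMk contDiffAt_snd.neg)
      have h3 : ContDiffAt ℝ n (fun q : P × ℝ => χ (-q.2)) (p, x) :=
        (χ.contDiff (n := n)).contDiffAt.comp (p, x) contDiffAt_snd.neg
      exact h3.smul h2
    · have hxk : x ∉ k := fun h => hx (hball h)
      have h1 : ∀ᶠ q : P × ℝ in 𝓝 (p, x), q.2 ∉ k :=
        (continuous_snd.tendsto (p, x)).eventually (hk.isClosed.isOpen_compl.mem_nhds hxk)
      refine (contDiffAt_const (c := (0 : F))).congr_of_eventuallyEq ?_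
      filter_upwards [h1] with q hq
      simp [Function.uncurry, g, hzero _ hq]
  have hf : LocallyIntegrable (indicator (Ioc a b) fun _ => (1 : ℝ)) volume :=
    ((integrableOn_const (C := (1 : ℝ)) (by simp)).integrable_indicator
      measurableSet_Ioc).locallyIntegrable
  have key := contDiffOn_convolution_right_with_param_comp (μ := volume)
    (ContinuousLinearMap.lsmul ℝ ℝ) (v := fun _ => (0 : ℝ)) contDiffOn_const hs hk
    (g := g) (fun p x _ hx => by simp [g, hzero x hx]) hf hg
  refine key.congr fun p hp => ?_
  rw [intervalIntegral.integral_of_le hab, convolution_def, ← integral_indicator measurableSet_Ioc]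
  refine integral_congr_ae (Eventually.of_forall fun x => ?_)
  by_cases hx : x ∈ Ioc a b
  · simp [hx, g, hone x ⟨hx.1.le, hx.2⟩]
  · simp [hx]

/-- The derivative of a holomorphic function at the centre of a disc, in terms of its imaginary part
on the boundary circle. -/
theorem deriv_eq_integral_im {H : ℂ → ℂ} {c : ℂ} {r : ℝ} {U : Set ℂ} (hU : IsOpen U) (hr : 0 < r)
    (hcU : Metric.closedBall c r ⊆ U) (hH : DifferentiableOn ℂ H U) :
    deriv H c = ∫ x in (0 : ℝ)..2 * Real.pi, ((H (circleMap c r x)).im : ℂ) *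
      (Complex.I / (Real.pi * r) * Complex.exp (-(x * Complex.I))) := by
  have hrc : (r : ℂ) ≠ 0 := by exact_mod_cast hr.ne'
  have hπ : (Real.pi : ℂ) ≠ 0 := by exact_mod_cast Real.pi_ne_zero
  have hd : DiffContOnCl ℂ H (Metric.ball c r) := by
    refine ⟨hH.mono (Metric.ball_subset_closedBall.trans hcU), ?_⟩
    rw [closure_ball c hr.ne']
    exact (hH.mono hcU).continuousOn
  have hcont : Continuous fun x : ℝ => H (circleMap c r x) :=
    continuous_iff_continuousAt.2 fun x =>
      ContinuousAt.comp (g := H) ((hH.continuousOn.continuousAt (hU.mem_nhds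
        (hcU (circleMap_mem_closedBall c hr.le x))))) (continuous_circleMap c r).continuousAt
  have h1 : (∮ z in C(c, r), H z) = 0 := hd.circleIntegral_eq_zero hr.le
  have h2 := Complex.two_pi_I_inv_smul_circleIntegral_sub_sq_inv_smul_of_differentiable hU hcU hH
    (Metric.mem_ball_self hr)
  rw [circleIntegral] at h1 h2
  simp only [deriv_circleMap, smul_eq_mul, circleMap_sub_center] at h1 h2
  simp only [circleMap_zero] at h1 h2
  have hE : Continuous fun x : ℝ => Complex.exp (x * Complex.I) := by fun_prop
  have hE' : Continuous fun x : ℝ => Complex.exp (-(x * Complex.I)) := by fun_prop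
  -- Conjugating Cauchy's theorem shows that the conjugate of `H` contributes nothing at this
  -- frequency. Replacing `H` by `H` minus its conjugate, which is `2i Im H`, in Cauchy's formula
  -- for the derivative is therefore harmless.
  have h3 : ∫ x in (0 : ℝ)..2 * Real.pi, Complex.exp (-(x * Complex.I)) *
      (starRingEnd ℂ) (H (circleMap c r x)) = 0 := by
    have e1 : ∫ x in (0 : ℝ)..2 * Real.pi, Complex.exp (x * Complex.I) * H (circleMap c r x) = 0 := by
      have : ∀ x : ℝ, (r : ℂ) * Complex.exp (x * Complex.I) * Complex.I * H (circleMap c r x) =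
        (r * Complex.I) * (Complex.exp (x * Complex.I) * H (circleMap c r x)) := fun x => by ring
      simp only [this, intervalIntegral.integral_const_mul] at h1
      exact (mul_eq_zero.1 h1).resolve_left (mul_ne_zero hrc Complex.I_ne_zero)
    have e2 := Complex.conjCLE.toContinuousLinearMap.intervalIntegral_comp_comm
      (μ := volume) (a := 0) (b := 2 * Real.pi)
      (f := fun x : ℝ => Complex.exp (x * Complex.I) * H (circleMap c r x))
      ((hE.mul hcont).intervalIntegrable _ _)
    rw [e1, map_zero] at e2
    rw [← e2]
    refine intervalIntegral.integral_congr fun x _ => ?_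
    change _ = (starRingEnd ℂ) _
    simp [← Complex.exp_conj]
  have h4 : ∫ x in (0 : ℝ)..2 * Real.pi, Complex.exp (-(x * Complex.I)) * H (circleMap c r x) =
      2 * Real.pi * r * deriv H c := by
    have : ∀ x : ℝ, (r : ℂ) * Complex.exp (x * Complex.I) * Complex.I *
        (((r * Complex.exp (x * Complex.I)) ^ 2)⁻¹ * H (circleMap c r x)) =
        (Complex.I / r) * (Complex.exp (-(x * Complex.I)) * H (circleMap c r x)) := fun x => by
      rw [Complex.exp_neg]
      have := Complex.exp_ne_zero (x * Complex.I)
      field_simp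
    simp only [this, intervalIntegral.integral_const_mul] at h2
    rw [← h2]
    generalize (∫ x in (0 : ℝ)..2 * Real.pi, Complex.exp (-(x * Complex.I)) *
      H (circleMap c r x)) = A
    field_simp [Complex.I_ne_zero]
  have h5 : ∀ x : ℝ, ((H (circleMap c r x)).im : ℂ) *
      (Complex.I / (Real.pi * r) * Complex.exp (-(x * Complex.I))) =
      (2 * Real.pi * r : ℂ)⁻¹ * (Complex.exp (-(x * Complex.I)) * H (circleMap c r x) -
        Complex.exp (-(x * Complex.I)) * (starRingEnd ℂ) (H (circleMap c r x))) := by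
    intro x
    have : H (circleMap c r x) - (starRingEnd ℂ) (H (circleMap c r x)) =
        2 * (H (circleMap c r x)).im * Complex.I := by
      rw [Complex.sub_conj]; push_cast; ring
    rw [← mul_sub, this]
    field_simp
  have hconj : Continuous fun x : ℝ => (starRingEnd ℂ) (H (circleMap c r x)) :=
    Complex.continuous_conj.comp hcont
  simp only [h5, intervalIntegral.integral_const_mul]
  have h6 := intervalIntegral.integral_sub ((hE'.mul hcont).intervalIntegrable (μ := volume) 0
    (2 * Real.pi)) ((hE'.mul hconj).intervalIntegrable _ _)
  simp only [Pi.mul_apply] at h6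
  rw [h6, h3, h4]
  field_simp
  ring

end LeviFlat

/-! ### Solving `dU = Re (A dz)` along rays. -/

namespace LeviFlat

open scoped NNReal

/-- `U` solves the equation `dU = Re (A(z, U) dz)` along the rays from the origin. -/
structure IsRadialSolution (A : ℂ × ℝ → ℂ) (U : ℂ × ℝ → ℝ → ℝ) : Prop where
  init : ∀ p, U p 0 = p.2
  ode : ∀ p, ∀ σ ∈ Ioo (-1 : ℝ) 2, HasDerivAt (U p) (A (σ * p.1, U p σ) * p.1).re σ

section

variable {A : ℂ × ℝ → ℂ}

theorem exists_lipschitz_of_compactSupport (hA : ContDiff ℝ 1 A) (hc : HasCompactSupport A) :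
    ∃ K : ℝ≥0, LipschitzWith K A :=
  hA.lipschitzWith_of_hasCompactSupport hc (by simp)

theorem radialField_lipschitz {K : ℝ≥0} (hK : LipschitzWith K A) (z : ℂ) (σ : ℝ) :
    LipschitzWith (K * ‖z‖₊) (fun x : ℝ => (A (σ * z, x) * z).re) := by
  refine LipschitzWith.of_dist_le_mul fun x y => ?_
  rw [Real.dist_eq, ← Complex.sub_re, ← sub_mul]
  refine (Complex.abs_re_le_norm _).trans ?_
  rw [norm_mul, ← dist_eq_norm]
  have h1 := hK.dist_le_mul (σ * z, x) (σ * z, y)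
  have h2 : dist ((σ * z : ℂ), x) ((σ * z : ℂ), y) = dist x y := by simp [Prod.dist_eq]
  rw [h2] at h1
  calc _ ≤ K * dist x y * ‖z‖ := by gcongr
    _ = _ := by push_cast; ring

/-- Compact support makes the field bounded and globally Lipschitz, so the Picard–Lindelöf theorem
covers the whole interval. That interval contains `[0, 1]` in its interior, which gives two-sided
derivatives at the endpoints. -/
theorem exists_isRadialSolution (hA : ContDiff ℝ 1 A) (hc : HasCompactSupport A) :
    ∃ U, IsRadialSolution A U := by
  obtain ⟨K, hK⟩ := exists_lipschitz_of_compactSupport hA hc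
  obtain ⟨C, hC⟩ := hA.continuous.bounded_above_of_compact_support hc
  have hC0 : 0 ≤ C := (norm_nonneg _).trans (hC 0)
  have key : ∀ p : ℂ × ℝ, ∃ U : ℝ → ℝ, U 0 = p.2 ∧ ∀ σ ∈ Ioo (-1 : ℝ) 2,
      HasDerivAt U (A (σ * p.1, U σ) * p.1).re σ := by
    intro p
    have hcont : Continuous A := hA.continuous
    -- The initial time is `0`, so time `2` is the longest excursion; the radius is twice the bound
    -- `C ‖p.1‖` on the speed.
    have hPL : IsPicardLindelof (fun (σ : ℝ) (x : ℝ) => (A (σ * p.1, x) * p.1).re) (tmin := -1)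
        (tmax := 2) ⟨0, by norm_num⟩ p.2 (2 * (⟨C, hC0⟩ * ‖p.1‖₊)) 0 (⟨C, hC0⟩ * ‖p.1‖₊)
        (K * ‖p.1‖₊) := by
      refine ⟨fun σ _ => (radialField_lipschitz hK p.1 σ).lipschitzOnWith, fun x _ => ?_,
        fun σ _ x _ => ?_, ?_⟩
      · exact Continuous.continuousOn (by fun_prop)
      · rw [Real.norm_eq_abs]
        refine (Complex.abs_re_le_norm _).trans ?_
        rw [norm_mul]
        exact mul_le_mul_of_nonneg_right (hC _) (norm_nonneg _)
      · rw [show max ((2 : ℝ) - 0) (0 - -1) = 2 by norm_num]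
        push_cast
        linarith
    obtain ⟨U, hU0, hU⟩ := hPL.exists_eq_forall_mem_Icc_hasDerivWithinAt₀
    exact ⟨U, hU0, fun σ hσ => (hU σ (Ioo_subset_Icc_self hσ)).hasDerivAt
      (Icc_mem_nhds hσ.1 hσ.2)⟩
  choose U hU using key
  exact ⟨U, fun p => (hU p).1, fun p => (hU p).2⟩

end

theorem gronwallBound_zero_le {K ε : ℝ} (hK : 0 < K) :
    gronwallBound 0 K ε 1 = ε * ((Real.exp K - 1) / K) := by
  rw [gronwallBound_of_K_ne_0 hK.ne']
  simp only [zero_mul, zero_add, mul_one]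
  ring

namespace IsRadialSolution

variable {A : ℂ × ℝ → ℂ} {U : ℂ × ℝ → ℝ → ℝ}

theorem continuousOn (h : IsRadialSolution A U) (p : ℂ × ℝ) : ContinuousOn (U p) (Ioo (-1) 2) :=
  fun σ hσ => (h.ode p σ hσ).continuousAt.continuousWithinAt

theorem eq_of_hasDerivAt (h : IsRadialSolution A U) {K : ℝ≥0} (hK : LipschitzWith K A) {p : ℂ × ℝ}
    {V : ℝ → ℝ} (h0 : V 0 = p.2)
    (hV : ∀ σ ∈ Icc (0 : ℝ) 1, HasDerivAt V (A (σ * p.1, V σ) * p.1).re σ) {σ : ℝ}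
    (hσ : σ ∈ Icc (0 : ℝ) 1) : V σ = U p σ := by
  have h1 := dist_le_of_trajectories_ODE (v := fun (σ x : ℝ) => (A (σ * p.1, x) * p.1).re)
    (K := K * ‖p.1‖₊) (f := V) (g := U p) (a := 0) (b := 1) (δ := 0)
    (fun σ => radialField_lipschitz hK p.1 σ)
    (fun σ hσ => (hV σ hσ).continuousAt.continuousWithinAt)
    (fun σ hσ => (hV σ ⟨hσ.1, hσ.2.le⟩).hasDerivWithinAt)
    ((h.continuousOn p).mono fun x hx => ⟨by linarith [hx.1], by linarith [hx.2]⟩)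
    (fun σ hσ => (h.ode p σ ⟨by linarith [hσ.1], by linarith [hσ.2]⟩).hasDerivWithinAt)
    (by rw [h0, h.init, dist_self]) σ hσ
  rw [zero_mul] at h1
  exact dist_le_zero.1 h1

/-- The solution with parameter `τ z` is a rescaling of the solution with parameter `z`. -/
theorem radial (h : IsRadialSolution A U) {K : ℝ≥0} (hK : LipschitzWith K A) (z : ℂ) (t : ℝ) {τ : ℝ}
    (hτ : τ ∈ Icc (0 : ℝ) 1) : U (τ * z, t) 1 = U (z, t) τ := by
  have h1 := h.eq_of_hasDerivAt hK (p := (τ * z, t)) (V := fun σ => U (z, t) (σ * τ))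
    (by simp [h.init]) (fun σ hσ => by
      have hst : σ * τ ∈ Icc (0 : ℝ) 1 :=
        ⟨mul_nonneg hσ.1 hτ.1, mul_le_one₀ hσ.2 hτ.1 hτ.2⟩
      have h2 := (h.ode (z, t) (σ * τ) ⟨by linarith [hst.1], by linarith [hst.2]⟩).comp σ
        ((hasDerivAt_id σ).mul_const τ)
      refine h2.congr_deriv ?_
      have e : ((σ * τ : ℝ) : ℂ) * z = σ * (τ * z) := by push_cast; ring
      rw [one_mul, e, ← Complex.re_mul_ofReal, mul_assoc, mul_comm z (τ : ℂ)]) (right_mem_Icc.2 zero_le_one)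
  rw [← h1, one_mul]

theorem zero_left (h : IsRadialSolution A U) {K : ℝ≥0} (hK : LipschitzWith K A) (t : ℝ) {σ : ℝ}
    (hσ : σ ∈ Icc (0 : ℝ) 1) : U (0, t) σ = t :=
  (h.eq_of_hasDerivAt hK (p := (0, t)) (V := fun _ => t) rfl
    (fun σ _ => by simpa using hasDerivAt_const σ t) hσ).symm

theorem abs_sub_le (h : IsRadialSolution A U) {C : ℝ} (hC : ∀ p, ‖A p‖ ≤ C) (p : ℂ × ℝ) {σ : ℝ}
    (hσ : σ ∈ Icc (0 : ℝ) 1) : |U p σ - p.2| ≤ C * ‖p.1‖ := by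
  have hC0 : 0 ≤ C := (norm_nonneg _).trans (hC 0)
  have h1 := (convex_Icc (0 : ℝ) 1).norm_image_sub_le_of_norm_hasDerivWithin_le (f := U p)
    (C := C * ‖p.1‖) (x := 0) (y := σ)
    (fun s hs => (h.ode p s ⟨by linarith [hs.1], by linarith [hs.2]⟩).hasDerivWithinAt)
    (fun s _ => by
      rw [Real.norm_eq_abs]
      refine (Complex.abs_re_le_norm _).trans ?_
      rw [norm_mul]
      gcongr
      exact hC _) (left_mem_Icc.2 zero_le_one) hσ
  rw [h.init, Real.norm_eq_abs, sub_zero, Real.norm_eq_abs, abs_of_nonneg hσ.1] at h1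
  refine h1.trans (mul_le_of_le_one_right (by positivity) hσ.2)

end IsRadialSolution

end LeviFlat

/-! ### First-order dependence of the radial solutions on their data. -/

namespace LeviFlat

open scoped NNReal

/-- Complete integrability of `dU = Re (A(z, U) dz)` at a point: the derivative of `A` along the
solutions is complex linear. -/
def IsIntegrableAt (A : ℂ × ℝ → ℂ) (p : ℂ × ℝ) : Prop :=
  fderiv ℝ A p (Complex.I, (A p * Complex.I).re) = Complex.I * fderiv ℝ A p (1, (A p).re)

theorem IsIntegrableAt.fderiv_apply {A : ℂ × ℝ → ℂ} {p : ℂ × ℝ} (h : IsIntegrableAt A p) (ζ : ℂ) :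
    fderiv ℝ A p (ζ, (A p * ζ).re) = ζ * fderiv ℝ A p (1, (A p).re) := by
  have e : (ζ, (A p * ζ).re) = ζ.re • ((1 : ℂ), (A p).re) + ζ.im • (Complex.I, (A p * Complex.I).re) := by
    ext
    · simp
    · simp [Complex.mul_re]
      ring
  rw [e, map_add, map_smul, map_smul, h]
  conv_rhs => rw [← Complex.re_add_im ζ]
  simp only [Complex.real_smul]
  ring

/-- Mean value inequality for `A` minus its linearization; the derivative of a compactly supported
`C²` map is Lipschitz. -/
theorem exists_taylor_bound {E F : Type*} [NormedAddCommGroup E] [NormedSpace ℝ E]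
    [NormedAddCommGroup F] [NormedSpace ℝ F] {A : E → F} (hA : ContDiff ℝ 2 A)
    (hc : HasCompactSupport A) :
    ∃ K : ℝ≥0, ∀ p q, ‖A q - A p - fderiv ℝ A p (q - p)‖ ≤ K * ‖q - p‖ ^ 2 := by
  obtain ⟨K, hK⟩ := (hA.fderiv_right (m := 1) (by norm_num)).lipschitzWith_of_hasCompactSupport
    (hc.fderiv (𝕜 := ℝ)) (by simp)
  refine ⟨K, fun p q => ?_⟩
  have h1 := (convex_segment (𝕜 := ℝ) p q).norm_image_sub_le_of_norm_fderiv_le'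
    (f := A) (φ := fderiv ℝ A p) (C := K * ‖q - p‖)
    (fun x _ => hA.differentiable (by simp) x) (fun x hx => ?_) (left_mem_segment ℝ p q)
    (right_mem_segment ℝ p q)
  · rw [sq, ← mul_assoc]
    exact h1
  · rw [← dist_eq_norm]
    refine (hK.dist_le_mul x p).trans ?_
    gcongr
    rw [dist_eq_norm]
    rw [segment_eq_image'] at hx
    obtain ⟨θ, hθ, rfl⟩ := hx
    rw [add_sub_cancel_left, norm_smul, Real.norm_eq_abs, abs_of_nonneg hθ.1]
    exact mul_le_of_le_one_left (norm_nonneg _) hθ.2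

namespace IsRadialSolution

variable {A : ℂ × ℝ → ℂ} {U : ℂ × ℝ → ℝ → ℝ}

/-- The exponent of the transverse derivative of the solution. -/
noncomputable def transverseRate (A : ℂ × ℝ → ℂ) (U : ℂ × ℝ → ℝ → ℝ) (p : ℂ × ℝ) (σ : ℝ) : ℝ :=
  (fderiv ℝ A (σ * p.1, U p σ) (0, 1) * p.1).re

theorem continuousOn_transverseRate (h : IsRadialSolution A U) (hA : ContDiff ℝ 2 A) (p : ℂ × ℝ) :
    ContinuousOn (transverseRate A U p) (Ioo (-1) 2) := by
  have h1 : Continuous (fderiv ℝ A) := hA.continuous_fderiv (by simp)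
  have h2 : ContinuousOn (fun σ : ℝ => ((σ * p.1 : ℂ), U p σ)) (Ioo (-1) 2) :=
    ContinuousOn.prodMk (Continuous.continuousOn (by fun_prop)) (h.continuousOn p)
  have h3 := h1.comp_continuousOn h2
  exact Complex.continuous_re.comp_continuousOn
    ((h3.clm_apply continuousOn_const).mul continuousOn_const)

theorem hasDerivAt_integral_transverseRate (h : IsRadialSolution A U) (hA : ContDiff ℝ 2 A)
    (p : ℂ × ℝ) {σ : ℝ} (hσ : σ ∈ Icc (0 : ℝ) 1) :
    HasDerivAt (fun s => ∫ x in (0 : ℝ)..s, transverseRate A U p x) (transverseRate A U p σ) σ := by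
  have hc := h.continuousOn_transverseRate hA p
  have hm : Ioo (-1 : ℝ) 2 ∈ 𝓝 σ := Ioo_mem_nhds (by linarith [hσ.1]) (by linarith [hσ.2])
  refine intervalIntegral.integral_hasDerivAt_right ?_
    (hc.stronglyMeasurableAtFilter isOpen_Ioo _ (mem_of_mem_nhds hm)) (hc.continuousAt hm)
  refine (hc.mono ?_).intervalIntegrable
  rw [uIcc_of_le hσ.1]
  exact fun x hx => ⟨by linarith [hx.1], by linarith [hx.2, hσ.2]⟩

/-- First-order expansion of the solution in its parameter and its initial value. -/
theorem exists_abs_sub_le (h : IsRadialSolution A U) (hA : ContDiff ℝ 2 A) (hc : HasCompactSupport A)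
    {p : ℂ × ℝ} (hint : ∀ σ ∈ Icc (0 : ℝ) 1, IsIntegrableAt A (σ * p.1, U p σ)) :
    ∃ C : ℝ, ∀ q : ℂ × ℝ, ‖q‖ ≤ 1 → |U (p + q) 1 - U p 1 - ((A (p.1, U p 1) * q.1).re +
      q.2 * Real.exp (∫ x in (0 : ℝ)..1, transverseRate A U p x))| ≤ C * ‖q‖ ^ 2 := by
  obtain ⟨K, hK⟩ := exists_lipschitz_of_compactSupport (hA.of_le (by norm_num)) hc
  obtain ⟨K₂, hK₂⟩ := exists_taylor_bound hA hc
  obtain ⟨C₀, hC₀⟩ := hA.continuous.bounded_above_of_compact_support hc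
  have hC₀0 : 0 ≤ C₀ := (norm_nonneg _).trans (hC₀ 0)
  set E : ℝ → ℝ := fun σ => Real.exp (∫ x in (0 : ℝ)..σ, transverseRate A U p x) with hEdef
  have hE : ∀ σ ∈ Icc (0 : ℝ) 1, HasDerivAt E (E σ * transverseRate A U p σ) σ := fun σ hσ =>
    (h.hasDerivAt_integral_transverseRate hA p hσ).exp
  obtain ⟨Cₑ, hCₑ⟩ := isCompact_Icc.exists_bound_of_continuousOn (f := E) (s := Icc (0 : ℝ) 1)
    fun σ hσ => (hE σ hσ).continuousAt.continuousWithinAt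
  have hCₑ0 : 0 ≤ Cₑ := (norm_nonneg _).trans (hCₑ 0 (left_mem_Icc.2 zero_le_one))
  set c : ℝ := 1 + C₀ + Cₑ with hcdef
  set z := p.1 with hz
  -- A Lipschitz constant for all perturbed fields with `‖w‖ ≤ 1`; the extra `1` keeps it positive
  -- for the explicit form of Grönwall's bound.
  set κ : ℝ≥0 := K * (‖z‖₊ + 1) + 1 with hκ
  set ε₀ : ℝ := K * c + K₂ * c ^ 2 * (‖z‖ + 1) with hε₀
  refine ⟨ε₀ * ((Real.exp κ - 1) / κ), fun q hq => ?_⟩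
  obtain ⟨w, k⟩ := q
  have hw : ‖w‖ ≤ ‖(w, k)‖ := norm_fst_le (w, k)
  have hk : |k| ≤ ‖(w, k)‖ := norm_snd_le (w, k)
  set n := ‖(w, k)‖ with hn
  have hn0 : 0 ≤ n := norm_nonneg _
  -- The expected first-order variation: moving `z` by `w` moves the ray point by `σ w` and the
  -- height by `Re (A σ w)`, and moving the initial value by `k` contributes `k E σ`. It solves the
  -- perturbed equation up to an error of order `‖(w, k)‖²`.
  set W : ℝ → ℝ := fun σ => U p σ + σ * (A (σ * z, U p σ) * w).re + k * E σ with hW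
  set W' : ℝ → ℝ := fun σ => (A (σ * z, U p σ) * z).re + ((A (σ * z, U p σ) * w).re +
    σ * (fderiv ℝ A (σ * z, U p σ) (z, (A (σ * z, U p σ) * z).re) * w).re) +
    k * (E σ * transverseRate A U p σ) with hW'
  have hI : ∀ σ ∈ Icc (0 : ℝ) 1, σ ∈ Ioo (-1 : ℝ) 2 := fun σ hσ =>
    ⟨by linarith [hσ.1], by linarith [hσ.2]⟩
  have hWd : ∀ σ ∈ Icc (0 : ℝ) 1, HasDerivAt W (W' σ) σ := by
    intro σ hσ
    have h1 := h.ode p σ (hI σ hσ)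
    have h2 : HasDerivAt (fun s : ℝ => ((s * z : ℂ), U p s)) (z, (A (σ * z, U p σ) * z).re) σ := by
      refine HasDerivAt.prodMk ?_ h1
      simpa using (Complex.ofRealCLM.hasDerivAt (x := σ)).mul_const z
    have h3 : HasDerivAt (fun s : ℝ => A (s * z, U p s)) _ σ :=
      HasFDerivAt.comp_hasDerivAt (l := A) σ
        (hA.differentiable (by simp) (σ * z, U p σ)).hasFDerivAt h2
    have h4 : HasDerivAt (fun s : ℝ => (A (s * z, U p s) * w).re) _ σ :=
      Complex.reCLM.hasFDerivAt.comp_hasDerivAt σ (h3.mul_const w)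
    have h5 := (h1.add ((hasDerivAt_id σ).mul h4)).add ((hE σ hσ).const_mul k)
    refine h5.congr_deriv ?_
    simp [hW', hz]
  have hbound : ∀ σ ∈ Icc (0 : ℝ) 1,
      dist (W' σ) (A (σ * (z + w), W σ) * (z + w)).re ≤ ε₀ * n ^ 2 := by
    intro σ hσ
    set P : ℂ × ℝ := (σ * z, U p σ) with hP
    set Q : ℂ × ℝ := (σ * (z + w), W σ) with hQ
    set D := fderiv ℝ A P with hD
    have hEb : |E σ| ≤ Cₑ := hCₑ σ hσ
    have hAw : |(A P * w).re| ≤ C₀ * n := by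
      refine (Complex.abs_re_le_norm _).trans ?_
      rw [norm_mul]
      exact mul_le_mul (hC₀ P) hw (norm_nonneg _) hC₀0
    have hQP : Q - P = σ • (w, (A P * w).re) + (k * E σ) • ((0 : ℂ), (1 : ℝ)) := by
      ext
      · simp [hQ, hP]; ring
      · simp only [hQ, hP, hW, Prod.snd_sub, Prod.snd_add, Prod.smul_snd, smul_eq_mul, mul_one]
        ring
    have hσ1 : |σ| ≤ 1 := abs_le.2 ⟨by linarith [hσ.1], hσ.2⟩
    have hQPn : ‖Q - P‖ ≤ c * n := by
      rw [hQP]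
      refine (norm_add_le _ _).trans ?_
      have h1 : ‖σ • (w, (A P * w).re)‖ ≤ (1 + C₀) * n := by
        rw [norm_smul, Real.norm_eq_abs]
        refine (mul_le_of_le_one_left (norm_nonneg _) hσ1).trans ?_
        rw [Prod.norm_def]
        refine max_le ?_ ?_
        · nlinarith
        · rw [Real.norm_eq_abs]; nlinarith
      have h2 : ‖(k * E σ) • ((0 : ℂ), (1 : ℝ))‖ ≤ Cₑ * n := by
        rw [norm_smul, Real.norm_eq_abs, abs_mul, Prod.norm_def]
        simp only [norm_zero, norm_one, zero_le_one, sup_of_le_right, mul_one]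
        rw [mul_comm]
        exact mul_le_mul hEb hk (abs_nonneg _) hCₑ0
      rw [hcdef]
      linarith
    -- Complete integrability enters here: complex linearity along the solutions makes the
    -- derivatives in directions `z` and `w` commute, so the first-order terms of the error cancel.
    have hDQ : D (Q - P) = σ * (w * D (1, (A P).re)) + k * E σ * D (0, 1) := by
      rw [hQP, map_add, map_smul, map_smul, (hint σ hσ).fderiv_apply w]
      simp only [Complex.real_smul]
      push_cast
      ring
    have hDz : D (z, (A P * z).re) = z * D (1, (A P).re) := (hint σ hσ).fderiv_apply z
    set R := A Q - A P - D (Q - P) with hR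
    have hRn : ‖R‖ ≤ K₂ * (c * n) ^ 2 := (hK₂ P Q).trans (by gcongr)
    have hDn : ‖D (Q - P)‖ ≤ K * (c * n) := by
      refine (D.le_opNorm _).trans ?_
      exact mul_le_mul (norm_fderiv_le_of_lipschitz ℝ hK) hQPn (norm_nonneg _) K.2
    have hdiff : W' σ - (A Q * (z + w)).re = -(D (Q - P) * w + R * (z + w)).re := by
      have e1 : A Q = A P + D (Q - P) + R := by rw [hR]; ring
      have e2 : transverseRate A U p σ = (D (0, 1) * z).re := rfl
      have e3 : W' σ = (A P * z + A P * w + σ * (D (z, (A P * z).re) * w) +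
          k * E σ * (D (0, 1) * z)).re := by
        simp only [hW', e2, Complex.add_re, mul_assoc, Complex.re_ofReal_mul]
        ring
      rw [e3, e1, ← Complex.sub_re, ← Complex.neg_re]
      congr 1
      have e4 : (D (Q - P)) * z = σ * (w * D (1, (A P).re)) * z + k * E σ * (D (0, 1) * z) := by
        rw [hDQ]; ring
      rw [hDz]
      linear_combination -e4
    rw [Real.dist_eq, hdiff, abs_neg]
    refine (Complex.abs_re_le_norm _).trans ((norm_add_le _ _).trans ?_)
    rw [norm_mul, norm_mul]
    have hzw : ‖z + w‖ ≤ ‖z‖ + 1 := (norm_add_le _ _).trans (by linarith)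
    have hc0 : 0 ≤ c := by positivity
    calc ‖D (Q - P)‖ * ‖w‖ + ‖R‖ * ‖z + w‖ ≤ K * (c * n) * n + K₂ * (c * n) ^ 2 * (‖z‖ + 1) := by
          gcongr
      _ = ε₀ * n ^ 2 := by rw [hε₀]; ring
  have hG := dist_le_of_approx_trajectories_ODE
    (v := fun (σ x : ℝ) => (A (σ * (z + w), x) * (z + w)).re)
    (K := κ) (f := W) (f' := W') (g := U (p + (w, k)))
    (g' := fun σ => (A (σ * (z + w), U (p + (w, k)) σ) * (z + w)).re) (a := 0) (b := 1) (δ := 0)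
    (εf := ε₀ * n ^ 2) (εg := 0)
    (fun σ => (radialField_lipschitz hK (z + w) σ).weaken (by
      rw [hκ]
      have : ‖z + w‖₊ ≤ ‖z‖₊ + 1 := (nnnorm_add_le _ _).trans (by
        gcongr
        exact_mod_cast hw.trans hq)
      exact (mul_le_mul_right this K).trans le_self_add))
    (fun σ hσ => (hWd σ hσ).continuousAt.continuousWithinAt)
    (fun σ hσ => (hWd σ ⟨hσ.1, hσ.2.le⟩).hasDerivWithinAt)
    (fun σ hσ => hbound σ ⟨hσ.1, hσ.2.le⟩)
    ((h.continuousOn _).mono fun x hx => hI x hx)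
    (fun σ hσ => (h.ode _ σ (hI σ ⟨hσ.1, hσ.2.le⟩)).hasDerivWithinAt)
    (fun σ hσ => by simp [hz])
    (by simp [hW, h.init, hEdef]) 1 (right_mem_Icc.2 zero_le_one)
  rw [add_zero, sub_zero, gronwallBound_zero_le (by positivity), dist_comm, Real.dist_eq] at hG
  have e : U (p + (w, k)) 1 - W 1 = U (p + (w, k)) 1 - U p 1 - ((A (z, U p 1) * w).re +
      k * Real.exp (∫ x in (0 : ℝ)..1, transverseRate A U p x)) := by
    simp only [hW, hEdef]
    push_cast
    rw [one_mul, one_mul]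
    ring
  rw [e] at hG
  refine hG.trans (le_of_eq ?_)
  ring

end IsRadialSolution

end LeviFlat

/-! ### Regularity and existence of the leaf heights. -/

namespace LeviFlat

open scoped NNReal

/-- The differential `(h, k) ↦ Re (α h) + e k`. -/
noncomputable def leafDifferential (x : ℂ × ℝ) : (ℂ × ℝ) →L[ℝ] ℝ :=
  (Complex.reCLM.comp (ContinuousLinearMap.mul ℝ ℂ x.1)).comp (ContinuousLinearMap.fst ℝ ℂ ℝ) +
    x.2 • ContinuousLinearMap.snd ℝ ℂ ℝ

theorem leafDifferential_apply (x q : ℂ × ℝ) :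
    leafDifferential x q = (x.1 * q.1).re + x.2 * q.2 := by
  simp [leafDifferential]

theorem contDiff_leafDifferential {n : ℕ∞ω} : ContDiff ℝ n leafDifferential := by
  unfold leafDifferential
  have h1 : ContDiff ℝ n fun x : ℂ × ℝ => ContinuousLinearMap.mul ℝ ℂ x.1 :=
    (ContinuousLinearMap.mul ℝ ℂ).contDiff.comp contDiff_fst
  exact ((contDiff_const.clm_comp h1).clm_comp contDiff_const).add (contDiff_snd.smul contDiff_const)

theorem ball_zero_prod (r : ℝ) : Metric.ball (0 : ℂ × ℝ) r = Metric.ball 0 r ×ˢ Metric.ball 0 r := by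
  rw [ball_prod_same]; rfl

/-- Bootstrapping the regularity of a solution of `dU = Re (A(z, U) dz) + e dt`. -/
theorem contDiffOn_of_hasFDerivAt {A : ℂ × ℝ → ℂ} {u : ℂ × ℝ → ℝ} {r : ℝ} (hr : 0 < r)
    (hA : ContDiff ℝ 2 A)
    (hu : ∀ p ∈ Metric.ball (0 : ℂ × ℝ) r, HasFDerivAt u (leafDifferential (A (p.1, u p),
      Real.exp (∫ x in (0 : ℝ)..1, (fderiv ℝ A (x * p.1, u (x * p.1, p.2)) (0, 1) * p.1).re))) p)
    {n : ℕ} (hn : n ≤ 1) (h : ContDiffOn ℝ n u (Metric.ball 0 r)) :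
    ContDiffOn ℝ ((n + 1 : ℕ) : ℕ∞ω) u (Metric.ball 0 (r / 2)) := by
  have hsub : Metric.ball (0 : ℂ × ℝ) (r / 2) ⊆ Metric.ball 0 r :=
    Metric.ball_subset_ball (by linarith)
  have h2 : ContDiffOn ℝ n u (Metric.ball 0 (r / 2)) := h.mono hsub
  push_cast
  rw [contDiffOn_succ_iff_fderiv_of_isOpen Metric.isOpen_ball]
  refine ⟨fun p hp => (hu p (hsub hp)).differentiableAt.differentiableWithinAt, fun h => by simp at h, ?_⟩
  have hAn : ContDiff ℝ n A := hA.of_le (by exact_mod_cast (by omega : n ≤ 2))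
  have hA' : ContDiff ℝ n (fderiv ℝ A) := hA.fderiv_right (by exact_mod_cast (by omega : n + 1 ≤ 2))
  -- An open interval around `[0, 1]` is needed for the parameter integral; `|x| < 2` is paid for by
  -- halving the radius of the ball.
  have hG : ContDiffOn ℝ n (fun x : (ℂ × ℝ) × ℝ =>
      (fderiv ℝ A (x.2 * x.1.1, u (x.2 * x.1.1, x.1.2)) (0, 1) * x.1.1).re)
      (Metric.ball 0 (r / 2) ×ˢ Ioo (-2) 2) := by
    have h3 : ContDiff ℝ n fun x : (ℂ × ℝ) × ℝ => (x.2 : ℂ) * x.1.1 :=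
      (Complex.ofRealCLM.contDiff.comp contDiff_snd).mul (contDiff_fst.comp contDiff_fst)
    have h4 : ContDiffOn ℝ n (fun x : (ℂ × ℝ) × ℝ => u ((x.2 : ℂ) * x.1.1, x.1.2))
        (Metric.ball 0 (r / 2) ×ˢ Ioo (-2) 2) := by
      refine h.comp (h3.prodMk (contDiff_snd.comp contDiff_fst)).contDiffOn ?_
      rintro ⟨⟨z, t⟩, s⟩ ⟨hz, hs⟩
      rw [ball_zero_prod] at hz ⊢
      obtain ⟨hz, ht⟩ := hz
      simp only [Metric.mem_ball, dist_zero_right] at hz ht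
      refine ⟨?_, ?_⟩
      · simp only [Metric.mem_ball, dist_zero_right, norm_mul, Complex.norm_real, Real.norm_eq_abs]
        have : |s| ≤ 2 := abs_le.2 ⟨hs.1.le, hs.2.le⟩
        nlinarith [norm_nonneg z, abs_nonneg s]
      · simp only [Metric.mem_ball, dist_zero_right]
        exact ht.trans (by linarith)
    have h5 := (hA'.comp_contDiffOn (h3.contDiffOn.prodMk h4)).clm_apply
      (contDiffOn_const (c := ((0 : ℂ), (1 : ℝ))))
    exact Complex.reCLM.contDiff.comp_contDiffOn
      (h5.mul (contDiff_fst.comp contDiff_fst).contDiffOn)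
  have hI := contDiffOn_intervalIntegral (n := n) (a := 0) (b := 1) Metric.isOpen_ball isOpen_Ioo
    zero_le_one (fun x hx => ⟨by linarith [hx.1], by linarith [hx.2]⟩) hG
  have hAu : ContDiffOn ℝ n (fun p : ℂ × ℝ => A (p.1, u p)) (Metric.ball 0 (r / 2)) :=
    hAn.comp_contDiffOn (contDiff_fst.contDiffOn.prodMk h2)
  have key := contDiff_leafDifferential.comp_contDiffOn
    (hAu.prodMk (Real.contDiff_exp.comp_contDiffOn hI))
  exact key.congr fun p hp => (hu p (hsub hp)).fderiv

/-- Take the solutions at time `1`. Rescaling rays expresses the whole trajectory through `u`, so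
the differential of `u` becomes a formula in `A` and `u` alone, and two bootstraps give `C²`. -/
theorem exists_leaf_height_of_compactSupport {A : ℂ × ℝ → ℂ} (hA : ContDiff ℝ 2 A)
    (hc : HasCompactSupport A) (hint : ∀ᶠ p in 𝓝 0, IsIntegrableAt A p) :
    ∃ u : ℂ × ℝ → ℝ, ContDiffAt ℝ 2 u 0 ∧ (∀ t, u (0, t) = t) ∧
      ∀ᶠ p in 𝓝 0, (∀ ζ, fderiv ℝ u p (ζ, 0) = (A (p.1, u p) * ζ).re) ∧
        0 < fderiv ℝ u p (0, 1) := by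
  obtain ⟨R, hR, hint⟩ := Metric.eventually_nhds_iff_ball.1 hint
  obtain ⟨U, hU⟩ := exists_isRadialSolution (hA.of_le (by norm_num)) hc
  obtain ⟨K, hK⟩ := exists_lipschitz_of_compactSupport (hA.of_le (by norm_num)) hc
  obtain ⟨C, hC⟩ := hA.continuous.bounded_above_of_compact_support hc
  have hC0 : 0 ≤ C := (norm_nonneg _).trans (hC 0)
  set u : ℂ × ℝ → ℝ := fun p => U p 1 with hu
  -- A trajectory with data of size below `r` stays within `(1 + C) r = R`, where integrability is
  -- known.
  set r := R / (1 + C) with hr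
  have hr0 : 0 < r := by positivity
  have hrR : (1 + C) * r = R := by rw [hr]; field_simp
  have hray : ∀ p : ℂ × ℝ, ∀ s ∈ Icc (0 : ℝ) 1, u (s * p.1, p.2) = U p s := fun p s hs =>
    hU.radial hK p.1 p.2 hs
  have hmem : ∀ p ∈ Metric.ball (0 : ℂ × ℝ) r, ∀ σ ∈ Icc (0 : ℝ) 1,
      IsIntegrableAt A (σ * p.1, U p σ) := by
    rintro ⟨z, t⟩ hp σ hσ
    rw [ball_zero_prod] at hp
    obtain ⟨hz, ht⟩ := hp
    simp only [Metric.mem_ball, dist_zero_right] at hz ht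
    refine hint _ ?_
    rw [ball_zero_prod]
    refine ⟨?_, ?_⟩
    · simp only [Metric.mem_ball, dist_zero_right, norm_mul, Complex.norm_real, Real.norm_eq_abs,
        abs_of_nonneg hσ.1]
      nlinarith [norm_nonneg z, hσ.2, mul_nonneg hC0 hr0.le]
    · simp only [Metric.mem_ball, dist_zero_right, Real.norm_eq_abs] at ht ⊢
      have h1 := abs_sub_le_iff.1 (hU.abs_sub_le hC (z, t) hσ)
      have h2 := abs_lt.1 ht
      have h3 : C * ‖z‖ ≤ C * r := by gcongr
      rw [abs_lt]
      constructor <;> nlinarith [h1.1, h1.2, h2.1, h2.2]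
  have hder : ∀ p ∈ Metric.ball (0 : ℂ × ℝ) r, HasFDerivAt u (leafDifferential (A (p.1, u p),
      Real.exp (∫ x in (0 : ℝ)..1, (fderiv ℝ A (x * p.1, u (x * p.1, p.2)) (0, 1) * p.1).re))) p := by
    intro p hp
    obtain ⟨C', hC'⟩ := hU.exists_abs_sub_le hA hc (hmem p hp)
    have e : ∫ x in (0 : ℝ)..1, (fderiv ℝ A (x * p.1, u (x * p.1, p.2)) (0, 1) * p.1).re =
        ∫ x in (0 : ℝ)..1, IsRadialSolution.transverseRate A U p x := by
      refine intervalIntegral.integral_congr fun x hx => ?_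
      rw [uIcc_of_le zero_le_one] at hx
      simp only [IsRadialSolution.transverseRate]
      rw [hray p x hx]
    rw [e, hasFDerivAt_iff_isLittleO_nhds_zero]
    have hO : (fun q => u (p + q) - u p - leafDifferential (A (p.1, u p),
        Real.exp (∫ x in (0 : ℝ)..1, IsRadialSolution.transverseRate A U p x)) q)
        =O[𝓝 0] fun q => ‖q‖ ^ 2 := by
      refine Asymptotics.IsBigO.of_bound C' ?_
      filter_upwards [Metric.ball_mem_nhds (0 : ℂ × ℝ) one_pos] with q hq
      have h1 := hC' q (by simpa using (mem_ball_zero_iff.1 hq).le)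
      rw [leafDifferential_apply, Real.norm_eq_abs, norm_pow, norm_norm]
      simp only [hu]
      rwa [mul_comm (Real.exp _) q.2]
    refine hO.trans_isLittleO ?_
    exact (Asymptotics.isLittleO_norm_pow_id one_lt_two)
  have h0 : ContDiffOn ℝ ((0 : ℕ) : ℕ∞ω) u (Metric.ball 0 r) :=
    contDiffOn_zero.2 fun p hp => (hder p hp).continuousAt.continuousWithinAt
  have h1 := contDiffOn_of_hasFDerivAt hr0 hA hder (by norm_num) h0
  have h2 := contDiffOn_of_hasFDerivAt (half_pos hr0) hA
    (fun p hp => hder p (Metric.ball_subset_ball (by linarith) hp)) (n := 1) le_rfl h1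
  refine ⟨u, h2.contDiffAt (Metric.ball_mem_nhds _ (by positivity)), fun t =>
    hU.zero_left hK t (right_mem_Icc.2 zero_le_one), ?_⟩
  filter_upwards [Metric.ball_mem_nhds (0 : ℂ × ℝ) hr0] with p hp
  rw [(hder p hp).fderiv]
  simp only [leafDifferential_apply]
  exact ⟨fun ζ => by simp, by simp [Real.exp_pos]⟩

/-- Multiplication by a bump function leaves `a` unchanged near the origin, so the local conclusion
is unaffected. -/
theorem exists_leaf_height {a : ℂ × ℝ → ℂ} (ha : ContDiffAt ℝ 2 a 0)
    (hint : ∀ᶠ p in 𝓝 0, IsIntegrableAt a p) :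
    ∃ u : ℂ × ℝ → ℝ, ContDiffAt ℝ 2 u 0 ∧ (∀ t, u (0, t) = t) ∧
      ∀ᶠ p in 𝓝 0, (∀ ζ, fderiv ℝ u p (ζ, 0) = (a (p.1, u p) * ζ).re) ∧
        0 < fderiv ℝ u p (0, 1) := by
  obtain ⟨R, hR, hball⟩ := Metric.eventually_nhds_iff_ball.1 (ha.eventually (by simp))
  let χ : ContDiffBump (0 : ℂ × ℝ) := ⟨R / 3, R / 2, by positivity, by linarith⟩
  set A : ℂ × ℝ → ℂ := fun p => χ p • a p with hA
  have hAa : A =ᶠ[𝓝 0] a := by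
    filter_upwards [χ.eventuallyEq_one] with p hp
    simp [hA, hp]
  have hA2 : ContDiff ℝ 2 A := by
    rw [contDiff_iff_contDiffAt]
    intro p
    by_cases hp : p ∈ Metric.ball (0 : ℂ × ℝ) R
    · exact χ.contDiff.contDiffAt.smul (hball p hp)
    · have h1 : ∀ᶠ q in 𝓝 p, q ∉ Metric.closedBall (0 : ℂ × ℝ) (R / 2) :=
        Metric.isClosed_closedBall.isOpen_compl.mem_nhds fun h =>
          hp (Metric.closedBall_subset_ball (by linarith) h)
      refine (contDiffAt_const (c := (0 : ℂ))).congr_of_eventuallyEq ?_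
      filter_upwards [h1] with q hq
      have : χ q = 0 := χ.zero_of_le_dist (by
        by_contra! h
        exact hq (Metric.mem_closedBall.2 h.le))
      simp [hA, this]
  have hAc : HasCompactSupport A := χ.hasCompactSupport.smul_right
  have hAint : ∀ᶠ p in 𝓝 0, IsIntegrableAt A p := by
    filter_upwards [hint, hAa.eventually_nhds] with p hp he
    have he' : A =ᶠ[𝓝 p] a := he
    rw [IsIntegrableAt, he'.fderiv_eq, he'.self_of_nhds]
    exact hp
  obtain ⟨u, hu, hu0, hder⟩ := exists_leaf_height_of_compactSupport hA2 hAc hAint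
  refine ⟨u, hu, hu0, ?_⟩
  have hc : Tendsto (fun p : ℂ × ℝ => (p.1, u p)) (𝓝 0) (𝓝 0) := by
    have h1 : ContinuousAt (fun p : ℂ × ℝ => (p.1, u p)) 0 := continuousAt_fst.prodMk hu.continuousAt
    have h2 : u 0 = 0 := hu0 0
    have h3 := h1.tendsto
    rw [h2] at h3
    exact h3
  filter_upwards [hder, hc.eventually hAa] with p hp he
  refine ⟨fun ζ => ?_, hp.2⟩
  rw [hp.1, he]

end LeviFlat

/-! ### Upgrading the family of leaves from `C²` to `C³`. -/

namespace LeviFlat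

/-- The transverse derivative of a family of holomorphic functions is holomorphic. -/
theorem fderiv_transverse_smul {f : ℂ × ℝ → ℂ} {p : ℂ × ℝ} (hf : ContDiffAt ℝ 2 f p)
    (hol : ∀ᶠ q in 𝓝 p, ∀ ζ, fderiv ℝ f q (ζ, 0) = ζ * fderiv ℝ f q (1, 0)) (ζ : ℂ) :
    fderiv ℝ (fun q => fderiv ℝ f q (0, 1)) p (ζ, 0) =
      ζ * fderiv ℝ (fun q => fderiv ℝ f q (0, 1)) p (1, 0) := by
  have hdf := hf.differentiableAt_fderiv
  rw [← fderiv_fderiv_apply hdf, ← fderiv_fderiv_apply hdf, hf.fderiv_fderiv_symm,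
    hf.fderiv_fderiv_symm (1, 0), fderiv_fderiv_apply hdf, fderiv_fderiv_apply hdf]
  have e : (fun x => fderiv ℝ f x (ζ, 0)) =ᶠ[𝓝 p] fun x => ζ * fderiv ℝ f x (1, 0) :=
    hol.mono fun q hq => hq ζ
  have h3 : DifferentiableAt ℝ (fun x => fderiv ℝ f x (1, 0)) p :=
    hdf.clm_apply (differentiableAt_const _)
  rw [e.fderiv_eq, (h3.hasFDerivAt.const_mul ζ).fderiv]
  simp

theorem differentiableAt_slice_complex {f : ℂ × ℝ → ℂ} {z : ℂ} {t : ℝ}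
    (hf : DifferentiableAt ℝ f (z, t))
    (hol : ∀ ζ : ℂ, fderiv ℝ f (z, t) (ζ, 0) = ζ * fderiv ℝ f (z, t) (1, 0)) :
    DifferentiableAt ℂ (fun z => f (z, t)) z := by
  have h1 : HasFDerivAt (fun z => f (z, t)) _ z :=
    hf.hasFDerivAt.comp z (hasFDerivAt_prodMk_left (𝕜 := ℝ) z t)
  rw [differentiableAt_complex_iff_differentiableAt_real]
  refine ⟨h1.differentiableAt, ?_⟩
  rw [h1.fderiv]
  simpa using hol Complex.I

/-- A family of holomorphic functions inherits regularity from its imaginary part and its values at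
the origin. -/
theorem contDiffAt_of_im {H : ℂ × ℝ → ℂ} {n : ℕ∞}
    (hH : ∀ᶠ p in 𝓝 (0 : ℂ × ℝ), DifferentiableAt ℂ (fun z => H (z, p.2)) p.1)
    (him : ContDiffAt ℝ n (fun p => (H p).im) 0) (h0 : ContDiffAt ℝ n (fun t : ℝ => H (0, t)) 0)
    (hn : (n : ℕ∞ω) ≠ (∞ : ℕ∞ω)) : ContDiffAt ℝ n H 0 := by
  obtain ⟨r, hr, hball⟩ := Metric.eventually_nhds_iff_ball.1 (hH.and (him.eventually hn))
  rw [ball_zero_prod] at hball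
  have hslice : ∀ t ∈ Metric.ball (0 : ℝ) r,
      DifferentiableOn ℂ (fun z => H (z, t)) (Metric.ball 0 r) := fun t ht z hz =>
    (hball (z, t) ⟨hz, ht⟩).1.differentiableWithinAt
  set G : ℂ × ℝ → ℂ := fun p => ∫ x in (0 : ℝ)..2 * Real.pi,
    ((H (circleMap p.1 (r / 4) x, p.2)).im : ℂ) *
      (Complex.I / (Real.pi * (r / 4 : ℝ)) * Complex.exp (-(x * Complex.I))) with hG
  have hderiv : ∀ p ∈ Metric.ball (0 : ℂ × ℝ) (r / 2), deriv (fun z => H (z, p.2)) p.1 = G p := by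
    rintro ⟨z, t⟩ hp
    rw [ball_zero_prod] at hp
    refine deriv_eq_integral_im Metric.isOpen_ball (by positivity) ?_
      (hslice t (Metric.ball_subset_ball (by linarith) hp.2))
    refine Metric.closedBall_subset_ball' ?_
    have := Metric.mem_ball.1 hp.1
    linarith
  have hGc : ContDiffOn ℝ n G (Metric.ball 0 (r / 2)) := by
    refine contDiffOn_intervalIntegral (n := n) (J := univ) (G := fun q : (ℂ × ℝ) × ℝ =>
      ((H (circleMap q.1.1 (r / 4) q.2, q.1.2)).im : ℂ) * (Complex.I / (Real.pi * (r / 4 : ℝ)) *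
        Complex.exp (-(q.2 * Complex.I)))) Metric.isOpen_ball isOpen_univ (by positivity)
      (subset_univ _) ?_
    have hx : ContDiff ℝ n fun q : (ℂ × ℝ) × ℝ => (q.2 : ℂ) :=
      Complex.ofRealCLM.contDiff.comp contDiff_snd
    have hcm : ContDiff ℝ n fun q : (ℂ × ℝ) × ℝ => circleMap q.1.1 (r / 4) q.2 := by
      unfold circleMap
      have h1 : ContDiff ℝ n fun q : (ℂ × ℝ) × ℝ => Complex.exp (q.2 * Complex.I) :=
        (hx.mul contDiff_const).cexp
      exact (contDiff_fst.comp contDiff_fst).add (contDiff_const.mul h1)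
    have hexp : ContDiff ℝ n fun q : (ℂ × ℝ) × ℝ => Complex.exp (-(q.2 * Complex.I)) :=
      (hx.mul contDiff_const).neg.cexp
    have himc : ContDiffOn ℝ n (fun q : (ℂ × ℝ) × ℝ => (H (circleMap q.1.1 (r / 4) q.2, q.1.2)).im)
        (Metric.ball 0 (r / 2) ×ˢ univ) := by
      rintro ⟨⟨z, t⟩, x⟩ ⟨hp, -⟩
      rw [ball_zero_prod] at hp
      refine ContDiffAt.contDiffWithinAt ?_
      refine ContDiffAt.comp (g := fun p => (H p).im) (((z, t), x) : (ℂ × ℝ) × ℝ) ?_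
        (hcm.contDiffAt.prodMk (contDiff_snd.comp contDiff_fst).contDiffAt)
      refine (hball (circleMap z (r / 4) x, t)
        ⟨?_, Metric.ball_subset_ball (by linarith) hp.2⟩).2
      have h1 := Metric.mem_ball.1 hp.1
      have h2 := circleMap_mem_closedBall z (by positivity : 0 ≤ r / 4) x
      exact Metric.closedBall_subset_ball' (by linarith) h2
    exact (Complex.ofRealCLM.contDiff.comp_contDiffOn himc).mul
      (contDiff_const.mul hexp).contDiffOn
  -- Integrate the `z`-derivative along the ray from the axis `z = 0`. That derivative is `G`, which
  -- involves only the imaginary part of `H`.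
  have hrep : ∀ p ∈ Metric.ball (0 : ℂ × ℝ) (r / 2),
      H p = H (0, p.2) + ∫ x in (0 : ℝ)..1, p.1 * G (x * p.1, p.2) := by
    rintro ⟨z, t⟩ hp
    have hp' := hp
    rw [ball_zero_prod] at hp'
    have hz : ‖z‖ < r / 2 := by simpa using hp'.1
    have hxz : ∀ x ∈ Icc (0 : ℝ) 1, ‖(x : ℂ) * z‖ < r / 2 := by
      intro x hx
      rw [norm_mul, Complex.norm_real, Real.norm_eq_abs, abs_of_nonneg hx.1]
      exact (mul_le_of_le_one_left (norm_nonneg _) hx.2).trans_lt hz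
    have hd : ∀ x ∈ uIcc (0 : ℝ) 1, HasDerivAt (fun x : ℝ => H (x * z, t)) (z * G (x * z, t)) x := by
      intro x hx
      rw [uIcc_of_le zero_le_one] at hx
      have h1 : HasDerivAt (fun z => H (z, t)) (G (x * z, t)) (x * z) := by
        rw [← hderiv (x * z, t) (by
          rw [ball_zero_prod]
          exact ⟨by simpa using hxz x hx, hp'.2⟩)]
        refine ((hslice t (Metric.ball_subset_ball (by linarith) hp'.2)).differentiableAt
          (Metric.isOpen_ball.mem_nhds ?_)).hasDerivAt
        rw [mem_ball_zero_iff]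
        exact (hxz x hx).trans (by linarith)
      have h2 : HasDerivAt (fun x : ℝ => (x : ℂ) * z) z x := by
        simpa using (Complex.ofRealCLM.hasDerivAt (x := x)).mul_const z
      have h3 := HasDerivAt.comp x h1 h2
      rwa [mul_comm] at h3
    have hcont : ContinuousOn (fun x : ℝ => z * G (x * z, t)) (uIcc 0 1) := by
      rw [uIcc_of_le zero_le_one]
      refine continuousOn_const.mul (hGc.continuousOn.comp (Continuous.continuousOn (by fun_prop)) ?_)
      intro x hx
      rw [ball_zero_prod]
      exact ⟨by simpa using hxz x hx, hp'.2⟩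
    have h3 := intervalIntegral.integral_eq_sub_of_hasDerivAt hd hcont.intervalIntegrable
    rw [h3]
    simp
  have hI : ContDiffOn ℝ n (fun p : ℂ × ℝ => ∫ x in (0 : ℝ)..1, p.1 * G (x * p.1, p.2))
      (Metric.ball 0 (r / 4)) := by
    refine contDiffOn_intervalIntegral (n := n) (J := Ioo (-2) 2) (G := fun q : (ℂ × ℝ) × ℝ =>
      q.1.1 * G (q.2 * q.1.1, q.1.2)) Metric.isOpen_ball isOpen_Ioo zero_le_one
      (fun x hx => ⟨by linarith [hx.1], by linarith [hx.2]⟩) ?_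
    have h3 : ContDiff ℝ n fun x : (ℂ × ℝ) × ℝ => (x.2 : ℂ) * x.1.1 :=
      (Complex.ofRealCLM.contDiff.comp contDiff_snd).mul (contDiff_fst.comp contDiff_fst)
    refine (contDiff_fst.comp contDiff_fst).contDiffOn.mul
      (hGc.comp (h3.prodMk (contDiff_snd.comp contDiff_fst)).contDiffOn ?_)
    rintro ⟨⟨z, t⟩, s⟩ ⟨hz, hs⟩
    rw [ball_zero_prod] at hz ⊢
    obtain ⟨hz, ht⟩ := hz
    simp only [Metric.mem_ball, dist_zero_right] at hz ht
    refine ⟨?_, ?_⟩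
    · simp only [Metric.mem_ball, dist_zero_right, norm_mul, Complex.norm_real, Real.norm_eq_abs]
      have : |s| ≤ 2 := abs_le.2 ⟨hs.1.le, hs.2.le⟩
      nlinarith [norm_nonneg z, abs_nonneg s]
    · simp only [Metric.mem_ball, dist_zero_right]
      exact ht.trans (by linarith)
  have h0' : ContDiffAt ℝ n (fun p : ℂ × ℝ => H (0, p.2)) 0 :=
    ContDiffAt.comp (g := fun t : ℝ => H (0, t)) (0 : ℂ × ℝ) h0 contDiffAt_snd
  refine (h0'.add (hI.contDiffAt (Metric.ball_mem_nhds _ (by positivity)))).congr_of_eventuallyEq ?_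
  filter_upwards [Metric.ball_mem_nhds (0 : ℂ × ℝ) (by positivity : 0 < r / 2)] with p hp
  exact hrep p hp

theorem arg_eq_arctan {w : ℂ} (hw : 0 < w.re) : w.arg = Real.arctan (w.im / w.re) := by
  have h1 := abs_lt.1 (Complex.abs_arg_lt_pi_div_two_iff.2 (Or.inl hw))
  rw [← Complex.tan_arg, Real.arctan_tan h1.1 h1.2]

/-- The leaves of a Levi-flat graph `Im w = F(z, Re w)` of class `C³` form a `C³` family. -/
theorem exists_leaf_family {F : ℂ × ℝ → ℝ} {a : ℂ × ℝ → ℂ} (hF : ContDiffAt ℝ 3 F 0)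
    (ha : ContDiffAt ℝ 2 a 0)
    (hFa : ∀ᶠ p in 𝓝 0, ∀ ζ, fderiv ℝ F p (ζ, (a p * ζ).re) = (a p * ζ).im)
    (hint : ∀ᶠ p in 𝓝 0, IsIntegrableAt a p) :
    ∃ f : ℂ × ℝ → ℂ, ContDiffAt ℝ 3 f 0 ∧ (∀ t, (f (0, t)).re = t) ∧
      (∀ p, (f p).im = F (p.1, (f p).re)) ∧
      ∀ᶠ p in 𝓝 0, ∀ ζ, fderiv ℝ f p (ζ, 0) = ζ * fderiv ℝ f p (1, 0) := by
  obtain ⟨u, hu, hu0, hder⟩ := exists_leaf_height ha hint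
  have hg0 : ((0 : ℂ × ℝ).1, u 0) = 0 := by
    have : u 0 = 0 := hu0 0
    rw [this]; rfl
  have hg : ContDiffAt ℝ 2 (fun p : ℂ × ℝ => (p.1, u p)) 0 := contDiffAt_fst.prodMk hu
  have hgt : Tendsto (fun p : ℂ × ℝ => (p.1, u p)) (𝓝 0) (𝓝 0) := by
    have := hg.continuousAt.tendsto
    rwa [hg0] at this
  have hFg : ContDiffAt ℝ 2 (fun p : ℂ × ℝ => F (p.1, u p)) 0 :=
    ContDiffAt.comp (g := F) (0 : ℂ × ℝ) (by rw [hg0]; exact hF.of_le (by norm_num)) hg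
  set f : ℂ × ℝ → ℂ := fun p => (u p : ℂ) + (F (p.1, u p) : ℂ) * Complex.I with hf
  have hf2 : ContDiffAt ℝ 2 f 0 :=
    (Complex.ofRealCLM.contDiff.contDiffAt.comp (0 : ℂ × ℝ) hu).add
      ((Complex.ofRealCLM.contDiff.contDiffAt.comp (0 : ℂ × ℝ) hFg).mul contDiffAt_const)
  have hfd : ∀ᶠ p in 𝓝 0, ∀ q : ℂ × ℝ, fderiv ℝ f p q = (fderiv ℝ u p q : ℂ) +
      (fderiv ℝ F (p.1, u p) (q.1, fderiv ℝ u p q) : ℂ) * Complex.I := by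
    filter_upwards [hu.fderiv_eventually_hasFDerivAt (by norm_num),
      hgt.eventually (hF.fderiv_eventually_hasFDerivAt (by norm_num))] with p h1 h2 q
    have h3 : HasFDerivAt (fun p : ℂ × ℝ => F (p.1, u p)) _ p :=
      HasFDerivAt.comp (g := F) p h2.hasFDerivAt (hasFDerivAt_fst.prodMk h1.hasFDerivAt)
    have h4 : HasFDerivAt f _ p := (Complex.ofRealCLM.hasFDerivAt.comp p h1.hasFDerivAt).add
      ((Complex.ofRealCLM.hasFDerivAt.comp p h3).mul_const Complex.I)
    rw [h4.fderiv]
    simp [mul_comm]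
  have hfz : ∀ᶠ p in 𝓝 0, ∀ ζ, fderiv ℝ f p (ζ, 0) = a (p.1, u p) * ζ := by
    filter_upwards [hfd, hder, hgt.eventually hFa] with p h1 h2 h3 ζ
    rw [h1, h2.1, h3]
    exact Complex.re_add_im _
  have hhol : ∀ᶠ p in 𝓝 0, ∀ ζ, fderiv ℝ f p (ζ, 0) = ζ * fderiv ℝ f p (1, 0) := by
    filter_upwards [hfz] with p hp ζ
    rw [hp, hp, mul_one, mul_comm]
  set Fx : ℂ × ℝ → ℝ := fun p => fderiv ℝ F p (0, 1) with hFx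
  have hFx2 : ContDiffAt ℝ 2 Fx 0 :=
    (hF.fderiv_right (m := 2) (by norm_num)).clm_apply contDiffAt_const
  -- The factor `u_t` is real and positive but only `C¹`; it does not affect the argument, which is
  -- therefore `arctan` of the `C²` function `F_x(z, u)`.
  have hft : ∀ᶠ p in 𝓝 0, fderiv ℝ f p (0, 1) =
      (fderiv ℝ u p (0, 1) : ℂ) * (1 + Fx (p.1, u p) * Complex.I) := by
    filter_upwards [hfd] with p hp
    rw [hp]
    have e : ((0 : ℂ), fderiv ℝ u p (0, 1)) = fderiv ℝ u p (0, 1) • ((0 : ℂ), (1 : ℝ)) := by simp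
    rw [e, map_smul, smul_eq_mul]
    push_cast
    ring
  have hpos : ∀ᶠ p in 𝓝 0, 0 < (fderiv ℝ f p (0, 1)).re := by
    filter_upwards [hft, hder] with p h1 h2
    rw [h1]
    simpa using h2.2
  set H : ℂ × ℝ → ℂ := fun p => Complex.log (fderiv ℝ f p (0, 1)) with hH
  have hHhol : ∀ᶠ p in 𝓝 (0 : ℂ × ℝ), DifferentiableAt ℂ (fun z => H (z, p.2)) p.1 := by
    filter_upwards [hpos, hf2.eventually (by simp), hhol.eventually_nhds] with p h1 h2 h3
    have h4 : DifferentiableAt ℂ (fun z => fderiv ℝ f (z, p.2) (0, 1)) p.1 :=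
      differentiableAt_slice_complex (f := fun q => fderiv ℝ f q (0, 1))
        (h2.differentiableAt_fderiv.clm_apply (differentiableAt_const _))
        (fderiv_transverse_smul h2 h3)
    exact h4.clog (Complex.mem_slitPlane_iff.2 (Or.inl h1))
  have hHim : ContDiffAt ℝ 2 (fun p => (H p).im) 0 := by
    have h1 : ContDiffAt ℝ 2 (fun p : ℂ × ℝ => Real.arctan (Fx (p.1, u p))) 0 :=
      Real.contDiff_arctan.contDiffAt.comp (0 : ℂ × ℝ)
        (ContDiffAt.comp (g := Fx) (0 : ℂ × ℝ) (by rw [hg0]; exact hFx2) hg)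
    refine h1.congr_of_eventuallyEq ?_
    filter_upwards [hft, hpos, hder] with p h2 h3 h4
    rw [hH, Complex.log_im, arg_eq_arctan h3, h2]
    have := h4.2.ne'
    simp
    field_simp
  -- On the axis `u(0, t) = t`, so `u_t = 1` and the logarithm there is explicit.
  have hH0 : ContDiffAt ℝ 2 (fun t : ℝ => H (0, t)) 0 := by
    have hemb : ContDiffAt ℝ 2 (fun t : ℝ => ((0 : ℂ), t)) 0 := contDiffAt_const.prodMk contDiffAt_id
    have h1 : ContDiffAt ℝ 2 (fun t : ℝ => (1 : ℂ) + Fx (0, t) * Complex.I) 0 := by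
      have h2 : ContDiffAt ℝ 2 (fun t : ℝ => Fx (0, t)) 0 :=
        ContDiffAt.comp (g := Fx) (0 : ℝ) hFx2 hemb
      exact contDiffAt_const.add
        ((Complex.ofRealCLM.contDiff.contDiffAt.comp (0 : ℝ) h2).mul contDiffAt_const)
    have h2 : ContDiffAt ℝ 2 (fun t : ℝ => Complex.log (1 + Fx (0, t) * Complex.I)) 0 := by
      refine ContDiffAt.comp (g := Complex.log) (0 : ℝ)
        ((Complex.contDiffAt_log (Complex.mem_slitPlane_iff.2 (Or.inl ?_))).restrict_scalars ℝ) h1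
      simp
    refine h2.congr_of_eventuallyEq ?_
    have h3 : Tendsto (fun t : ℝ => ((0 : ℂ), t)) (𝓝 0) (𝓝 0) := hemb.continuousAt
    filter_upwards [h3.eventually hft, h3.eventually
      (hu.fderiv_eventually_hasFDerivAt (by norm_num))] with t h4 h5
    have h6 : HasFDerivAt (fun t : ℝ => u (0, t)) _ t :=
      HasFDerivAt.comp (g := u) t h5.hasFDerivAt (hasFDerivAt_prodMk_right (𝕜 := ℝ) (0 : ℂ) t)
    simp only [hu0] at h6
    have h7 := h6.hasDerivAt.unique (hasDerivAt_id t)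
    have h8 : fderiv ℝ u (0, t) (0, 1) = 1 := by simpa using h7
    simp only [hH]
    rw [h4, h8, hu0]
    simp
  have hHc : ContDiffAt ℝ (2 : ℕ∞) H 0 := contDiffAt_of_im hHhol (by exact_mod_cast hHim)
    (by exact_mod_cast hH0) (by exact_mod_cast (by simp : (2 : ℕ∞) ≠ ⊤))
  have hftc : ContDiffAt ℝ 2 (fun p => fderiv ℝ f p (0, 1)) 0 := by
    have h1 : ContDiffAt ℝ 2 (fun p => Complex.exp (H p)) 0 := ContDiffAt.cexp (by exact_mod_cast hHc)
    refine h1.congr_of_eventuallyEq ?_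
    filter_upwards [hpos] with p hp
    rw [hH, Complex.exp_log]
    rintro h0
    rw [h0] at hp
    simp at hp
  have hac : ContDiffAt ℝ 2 (fun p : ℂ × ℝ => a (p.1, u p)) 0 :=
    ContDiffAt.comp (g := a) (0 : ℂ × ℝ) (by rw [hg0]; exact ha) hg
  refine ⟨f, ?_, fun t => by simp [hf, hu0], fun p => by simp [hf], hhol⟩
  -- The differential is assembled from `f_z = a(z, u)` and `f_t = exp H`, both of class `C²`.
  refine (contDiffAt_succ_iff_hasFDerivAt (n := 2)).2 ⟨fun p =>
    (ContinuousLinearMap.mul ℝ ℂ (a (p.1, u p))).comp (ContinuousLinearMap.fst ℝ ℂ ℝ) +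
      (ContinuousLinearMap.snd ℝ ℂ ℝ).smulRight (fderiv ℝ f p (0, 1)), ?_, ?_⟩
  · have hev := hfz.and (hf2.fderiv_eventually_hasFDerivAt (by norm_num))
    refine ⟨_, hev, fun p hp => ?_⟩
    refine hp.2.hasFDerivAt.congr_fderiv ?_
    refine ContinuousLinearMap.ext fun q => ?_
    have e : q = (q.1, 0) + q.2 • ((0 : ℂ), (1 : ℝ)) := by ext <;> simp
    conv_lhs => rw [e, map_add, map_smul, hp.1]
    simp
  · refine ContDiffAt.add ?_ ?_
    · exact ((ContinuousLinearMap.mul ℝ ℂ).contDiff.contDiffAt.comp (0 : ℂ × ℝ) hac).clm_comp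
        contDiffAt_const
    · exact ((ContinuousLinearMap.smulRightL ℝ (ℂ × ℝ) ℂ
        (ContinuousLinearMap.snd ℝ ℂ ℝ)).contDiff.contDiffAt.comp (0 : ℂ × ℝ) hftc)

end LeviFlat

/-! ### Graphs and complexified differentials. -/

namespace LeviFlat

/-- A local `C^n` inverse of a map with bijective derivative. -/
theorem exists_local_inverse {E F : Type*} [NormedAddCommGroup E] [NormedSpace ℝ E] [CompleteSpace E]
    [NormedAddCommGroup F] [NormedSpace ℝ F] [CompleteSpace F] {f : E → F} {a : E} {n : ℕ∞ω}
    (hf : ContDiffAt ℝ n f a) (hn : n ≠ 0) (hb : Function.Bijective (fderiv ℝ f a)) :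
    ∃ e : OpenPartialHomeomorph E F, a ∈ e.source ∧ (e : E → F) = f ∧
      ContDiffAt ℝ n e.symm (f a) := by
  let L : E ≃L[ℝ] F := ContinuousLinearEquiv.ofBijective (fderiv ℝ f a)
    (LinearMap.ker_eq_bot.2 hb.1) (LinearMap.range_eq_top.2 hb.2)
  have hL : HasFDerivAt f (L : E →L[ℝ] F) a := by
    have : (L : E →L[ℝ] F) = fderiv ℝ f a := ContinuousLinearEquiv.coe_ofBijective _ _ _
    rw [this]
    exact (hf.differentiableAt hn).hasFDerivAt
  refine ⟨hf.toOpenPartialHomeomorph f hL hn, hf.mem_toOpenPartialHomeomorph_source hL hn,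
    hf.toOpenPartialHomeomorph_coe hL hn, hf.to_localInverse hL hn⟩

/-- The complex linear extension `v ↦ ℓ v - i ℓ (iv)` of a real linear form. -/
noncomputable def complexify (l : (ℂ × ℂ) →L[ℝ] ℝ) (v : ℂ × ℂ) : ℂ := l v - Complex.I * l (Complex.I • v)

theorem complexify_smul (l : (ℂ × ℂ) →L[ℝ] ℝ) (ζ : ℂ) (v : ℂ × ℂ) :
    complexify l (ζ • v) = ζ * complexify l v := by
  have h1 : ∀ v, l (ζ • v) = ζ.re * l v + ζ.im * l (Complex.I • v) := by
    intro v
    conv_lhs => rw [← Complex.re_add_im ζ]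
    rw [add_smul, mul_smul, Complex.coe_smul, Complex.coe_smul, map_add, map_smul, map_smul]
    rfl
  unfold complexify
  rw [smul_comm, h1, h1]
  have : Complex.I • Complex.I • v = -v := by rw [smul_smul, Complex.I_mul_I, neg_one_smul]
  rw [this, map_neg]
  conv_rhs => rw [← Complex.re_add_im ζ]
  push_cast
  linear_combination ((ζ.im : ℂ) * l (Complex.I • v)) * Complex.I_sq

theorem complexify_add (l : (ℂ × ℂ) →L[ℝ] ℝ) (v w : ℂ × ℂ) :
    complexify l (v + w) = complexify l v + complexify l w := by
  unfold complexify
  rw [smul_add, map_add, map_add]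
  push_cast
  ring

theorem complexify_eq_zero_iff (l : (ℂ × ℂ) →L[ℝ] ℝ) (v : ℂ × ℂ) :
    complexify l v = 0 ↔ l v = 0 ∧ l (Complex.I • v) = 0 := by
  unfold complexify
  rw [Complex.ext_iff]
  simp

/-- Solving `R(z, w) = 0` for the imaginary part of `w`. -/
theorem exists_graph {R : ℂ × ℂ → ℝ} (hR : ContDiffAt ℝ 3 R 0) (h0 : R 0 = 0)
    (hv : fderiv ℝ R 0 (0, Complex.I) ≠ 0) :
    ∃ F : ℂ × ℝ → ℝ, ContDiffAt ℝ 3 F 0 ∧ F 0 = 0 ∧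
      ∀ᶠ q : ℂ × ℂ in 𝓝 0, R q = 0 ↔ q.2.im = F (q.1, q.2.re) := by
  -- Replacing the coordinate `Im w` by `R` is a local diffeomorphism, since `R` has a non-zero
  -- derivative in the direction of `Im w`.
  set Ψ : ℂ × ℂ → (ℂ × ℝ) × ℝ := fun q => ((q.1, q.2.re), R q) with hΨ
  have hΨ3 : ContDiffAt ℝ 3 Ψ 0 :=
    (contDiffAt_fst.prodMk (Complex.reCLM.contDiff.contDiffAt.comp (0 : ℂ × ℂ) contDiffAt_snd)).prodMk hR
  have hd : ∀ v, fderiv ℝ Ψ 0 v = ((v.1, v.2.re), fderiv ℝ R 0 v) := by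
    intro v
    have h1 : HasFDerivAt Ψ _ 0 := (hasFDerivAt_fst.prodMk
      (Complex.reCLM.hasFDerivAt.comp (0 : ℂ × ℂ) hasFDerivAt_snd)).prodMk
        (hR.differentiableAt (by simp)).hasFDerivAt
    rw [h1.fderiv]
    simp
  have hI : ∀ y : ℝ, fderiv ℝ R 0 (0, y * Complex.I) = y * fderiv ℝ R 0 (0, Complex.I) := by
    intro y
    have : ((0 : ℂ), (y : ℂ) * Complex.I) = y • ((0 : ℂ), Complex.I) := by simp
    rw [this, map_smul, smul_eq_mul]
  have hb : Function.Bijective (fderiv ℝ Ψ 0) := by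
    constructor
    · refine (injective_iff_map_eq_zero _).2 fun v hv0 => ?_
      rw [hd] at hv0
      simp only [Prod.mk_eq_zero] at hv0
      obtain ⟨⟨h1, h2⟩, h3⟩ := hv0
      have e : v = (0, (v.2.im : ℂ) * Complex.I) := Prod.ext h1 (by
        conv_lhs => rw [← Complex.re_add_im v.2, h2]
        simp)
      rw [e, hI] at h3
      have h4 := (mul_eq_zero.1 h3).resolve_right hv
      rw [e, h4]
      simp
    · rintro ⟨⟨h, k⟩, l⟩
      set y := (l - fderiv ℝ R 0 (h, k)) / fderiv ℝ R 0 (0, Complex.I) with hy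
      refine ⟨((h, (k : ℂ)) : ℂ × ℂ) + (0, y * Complex.I), ?_⟩
      rw [hd, map_add, hI, hy]
      ext
      · simp
      · simp
      · simp [div_mul_cancel₀ _ hv]
  obtain ⟨e, he0, heq, hsymm⟩ := exists_local_inverse hΨ3 (by simp) hb
  have hΨ0 : Ψ 0 = 0 := by simp [hΨ, h0]
  rw [hΨ0] at hsymm
  have hs0 : e.symm 0 = 0 := by
    have := e.left_inv he0
    rwa [heq, hΨ0] at this
  have hmem0 : (0 : (ℂ × ℝ) × ℝ) ∈ e.target := by
    have := e.map_source he0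
    rwa [heq, hΨ0] at this
  refine ⟨fun p => (e.symm (p, 0)).2.im, ?_, by simp [Prod.mk_zero_zero, hs0], ?_⟩
  · have h1 : ContDiffAt ℝ 3 (fun p : ℂ × ℝ => e.symm (p, 0)) 0 :=
      ContDiffAt.comp (g := e.symm) (0 : ℂ × ℝ) hsymm (contDiffAt_id.prodMk contDiffAt_const)
    exact Complex.imCLM.contDiff.contDiffAt.comp (0 : ℂ × ℝ) (contDiffAt_snd.comp (0 : ℂ × ℝ) h1)
  · have hc : ContinuousAt (fun q : ℂ × ℂ => (((q.1, q.2.re), (0 : ℝ)) : (ℂ × ℝ) × ℝ)) 0 := by fun_prop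
    have h1 : ∀ᶠ q : ℂ × ℂ in 𝓝 0, (((q.1, q.2.re), (0 : ℝ)) : (ℂ × ℝ) × ℝ) ∈ e.target :=
      hc.eventually (e.open_target.mem_nhds hmem0)
    filter_upwards [h1, e.open_source.mem_nhds he0] with q hq1 hq2
    have h2 := e.right_inv hq1
    rw [heq] at h2
    simp only [hΨ, Prod.mk.injEq] at h2
    constructor
    · intro hRq
      have h3 := e.left_inv hq2
      rw [heq] at h3
      simp only [hΨ, hRq] at h3
      rw [h3]
    · intro h3
      have h4 : q = e.symm ((q.1, q.2.re), 0) := Prod.ext h2.1.1.symm (Complex.ext h2.1.2.symm h3)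
      rw [h4]
      exact h2.2

end LeviFlat

/-! ### Levi-flatness as complete integrability. -/

namespace LeviFlat

/-- The slope of the complex tangent lines of the graph `Im w = F(z, Re w)` in the zero set of
`R`. -/
noncomputable def tangentSlope (R : ℂ × ℂ → ℝ) (N : ℂ × ℝ → ℂ × ℂ) (p : ℂ × ℝ) : ℂ :=
  -(complexify (fderiv ℝ R (N p)) (1, 0) / complexify (fderiv ℝ R (N p)) (0, 1))

theorem contDiffAt_complexify {E : Type*} [NormedAddCommGroup E] [NormedSpace ℝ E] {n : ℕ∞ω}
    {l : E → (ℂ × ℂ) →L[ℝ] ℝ} {v : E → ℂ × ℂ} {x : E} (hl : ContDiffAt ℝ n l x)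
    (hv : ContDiffAt ℝ n v x) : ContDiffAt ℝ n (fun y => complexify (l y) (v y)) x := by
  unfold complexify
  have h1 : ContDiffAt ℝ n (fun y => l y (v y)) x := hl.clm_apply hv
  have h2 : ContDiffAt ℝ n (fun y => l y (Complex.I • v y)) x := hl.clm_apply (hv.const_smul Complex.I)
  exact (Complex.ofRealCLM.contDiff.contDiffAt.comp x h1).sub
    (contDiffAt_const.mul (Complex.ofRealCLM.contDiff.contDiffAt.comp x h2))

theorem complexify_snd (l : (ℂ × ℂ) →L[ℝ] ℝ) (c : ℂ) : complexify l (0, c) = c * complexify l (0, 1) := by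
  have := complexify_smul l c (0, 1)
  simpa using this

theorem complexify_tangentSlope {R : ℂ × ℂ → ℝ} {N : ℂ × ℝ → ℂ × ℂ} {p : ℂ × ℝ}
    (h : complexify (fderiv ℝ R (N p)) (0, 1) ≠ 0) :
    complexify (fderiv ℝ R (N p)) (1, tangentSlope R N p) = 0 := by
  have e : ((1 : ℂ), tangentSlope R N p) = (1, 0) + (0, tangentSlope R N p) := by simp
  rw [e, complexify_add, complexify_snd, tangentSlope]
  field_simp
  ring

/-- A Levi-flat hypersurface transverse to the imaginary `w` axis is foliated by a `C³` family of
graphs of holomorphic functions. -/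
theorem exists_leaf_family_of_leviFlat {R : ℂ × ℂ → ℝ} (hR : ContDiffAt ℝ 3 R 0) (h0 : R 0 = 0)
    (hv : fderiv ℝ R 0 (0, Complex.I) ≠ 0)
    (hflat : ∀ᶠ q in 𝓝 0, R q = 0 → ∀ v, fderiv ℝ R q v = 0 →
      fderiv ℝ R q (Complex.I • v) = 0 → leviBilin R q v v = 0) :
    ∃ f : ℂ × ℝ → ℂ, ContDiffAt ℝ 3 f 0 ∧ f 0 = 0 ∧ (∀ t, (f (0, t)).re = t) ∧
      (∀ᶠ x : (ℂ × ℝ) × ℝ in 𝓝 0, R (x.1.1, f x.1 + x.2 * Complex.I) = 0 ↔ x.2 = 0) ∧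
      ∀ᶠ p in 𝓝 0, ∀ ζ, fderiv ℝ f p (ζ, 0) = ζ * fderiv ℝ f p (1, 0) := by
  obtain ⟨F, hF, hF0, hgraph⟩ := exists_graph hR h0 hv
  set N : ℂ × ℝ → ℂ × ℂ := fun p => (p.1, p.2 + F p * Complex.I) with hN
  have hN3 : ContDiffAt ℝ 3 N 0 := contDiffAt_fst.prodMk
    ((Complex.ofRealCLM.contDiff.contDiffAt.comp (0 : ℂ × ℝ) contDiffAt_snd).add
      ((Complex.ofRealCLM.contDiff.contDiffAt.comp (0 : ℂ × ℝ) hF).mul contDiffAt_const))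
  have hN0 : N 0 = 0 := by simp [hN, hF0]
  have hNt : Tendsto N (𝓝 0) (𝓝 0) := by
    have := hN3.continuousAt.tendsto
    rwa [hN0] at this
  have hNd : ∀ᶠ p in 𝓝 0, ∀ q : ℂ × ℝ, fderiv ℝ N p q = (q.1, q.2 + fderiv ℝ F p q * Complex.I) := by
    filter_upwards [hF.fderiv_eventually_hasFDerivAt (by norm_num)] with p hp q
    have h1 : HasFDerivAt N _ p := hasFDerivAt_fst.prodMk
      ((Complex.ofRealCLM.hasFDerivAt.comp p hasFDerivAt_snd).add
        ((Complex.ofRealCLM.hasFDerivAt.comp p hp.hasFDerivAt).mul_const Complex.I))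
    rw [h1.fderiv]
    simp [mul_comm]
  have hNR : ∀ᶠ p in 𝓝 0, R (N p) = 0 := by
    filter_upwards [hNt.eventually hgraph] with p hp
    rw [hp]
    simp [hN]
  have hl2 : ContDiffAt ℝ 2 (fun p => fderiv ℝ R (N p)) 0 :=
    ContDiffAt.comp (g := fderiv ℝ R) (0 : ℂ × ℝ)
      (by rw [hN0]; exact hR.fderiv_right (m := 2) (by norm_num)) (hN3.of_le (by norm_num))
  have hv0 : ∀ᶠ p in 𝓝 0, fderiv ℝ R (N p) (0, Complex.I) ≠ 0 := by
    have h1 : ContinuousAt (fun p => fderiv ℝ R (N p) (0, Complex.I)) 0 :=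
      hl2.continuousAt.clm_apply continuousAt_const
    refine h1.eventually_ne ?_
    rwa [hN0]
  have hcv : ∀ {l : (ℂ × ℂ) →L[ℝ] ℝ}, l (0, Complex.I) ≠ 0 → complexify l (0, 1) ≠ 0 := by
    intro l hl h
    have := ((complexify_eq_zero_iff l _).1 h).2
    simp only [Prod.smul_mk, smul_eq_mul, mul_zero, mul_one] at this
    exact hl this
  set a : ℂ × ℝ → ℂ := tangentSlope R N with ha
  have ha2 : ContDiffAt ℝ 2 a 0 := by
    have n1 : ContDiffAt ℝ 2 (fun p => complexify (fderiv ℝ R (N p)) (1, 0)) 0 :=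
      contDiffAt_complexify hl2 contDiffAt_const
    have n2 : ContDiffAt ℝ 2 (fun p => complexify (fderiv ℝ R (N p)) (0, 1)) 0 :=
      contDiffAt_complexify hl2 contDiffAt_const
    have n3 : complexify (fderiv ℝ R (N 0)) (0, 1) ≠ 0 := hcv (by rwa [hN0])
    exact (n1.mul (n2.inv n3)).neg
  have htan : ∀ᶠ p in 𝓝 0, ∀ ζ : ℂ, fderiv ℝ R (N p) (ζ, a p * ζ) = 0 := by
    filter_upwards [hv0] with p hp ζ
    have h1 := complexify_smul (fderiv ℝ R (N p)) ζ (1, a p)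
    rw [complexify_tangentSlope (hcv hp), mul_zero] at h1
    have h2 := ((complexify_eq_zero_iff _ _).1 h1).1
    simpa [mul_comm] using h2
  -- Both the graph's tangent vector over `(ζ, Re (a ζ))` and `(ζ, a ζ)` are killed by `dR`; they
  -- differ by a multiple of `(0, i)`, which is not.
  have hFa : ∀ᶠ p in 𝓝 0, ∀ ζ, fderiv ℝ F p (ζ, (a p * ζ).re) = (a p * ζ).im := by
    filter_upwards [hNd, htan, hv0, hNR.eventually_nhds, hN3.fderiv_eventually_hasFDerivAt (by norm_num),
      hNt.eventually (hR.fderiv_eventually_hasFDerivAt (by norm_num))] with p h1 h2 h3 h4 h5 h6 ζ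
    have h7 : fderiv ℝ R (N p) (fderiv ℝ N p (ζ, (a p * ζ).re)) = 0 := by
      have h8 : (R ∘ N) =ᶠ[𝓝 p] fun _ => (0 : ℝ) := h4
      have h9 := fderiv_comp p h6 h5
      rw [h8.fderiv_eq] at h9
      simpa using (congrArg (fun L => L (ζ, (a p * ζ).re)) h9).symm
    rw [h1] at h7
    set y := fderiv ℝ F p (ζ, (a p * ζ).re) with hy
    have e : ((ζ, ((a p * ζ).re : ℂ) + y * Complex.I) : ℂ × ℂ) =
        (ζ, a p * ζ) + (y - (a p * ζ).im) • ((0 : ℂ), Complex.I) := by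
      refine Prod.ext (by simp) ?_
      simp only [Prod.snd_add, Prod.smul_snd, Complex.real_smul]
      conv_rhs => rw [← Complex.re_add_im (a p * ζ)]
      push_cast
      simp
      ring
    rw [e, map_add, h2, zero_add, map_smul, smul_eq_mul] at h7
    exact sub_eq_zero.1 ((mul_eq_zero.1 h7).resolve_right h3)
  -- Differentiate the equation of the complex tangent line in the directions `V` and `iV` of that
  -- line. The combination measuring failure of integrability is a multiple of the Levi form of `R`
  -- on `V`, which vanishes.
  have hint : ∀ᶠ p in 𝓝 0, IsIntegrableAt a p := by
    filter_upwards [hNd, hFa, hv0.eventually_nhds, hNR, hNt.eventually hflat,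
      hNt.eventually (hR.eventually (by simp)), ha2.fderiv_eventually_hasFDerivAt (by norm_num),
      hN3.fderiv_eventually_hasFDerivAt (by norm_num)]
      with p h1 h2 h3 h4 h5 h6 h7 h8
    set V : ℂ × ℂ := (1, a p) with hV
    set l := fderiv ℝ R (N p) with hl
    set B := fderiv ℝ (fderiv ℝ R) (N p) with hB
    have hlc := hcv h3.self_of_nhds
    have hlV : complexify l V = 0 := complexify_tangentSlope hlc
    obtain ⟨hV1, hV2⟩ := (complexify_eq_zero_iff l V).1 hlV
    have hlevi : leviBilin R (N p) V V = 0 := h5 h4 V hV1 hV2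
    have hR2 : ContDiffAt ℝ 2 R (N p) := h6.of_le (by norm_num)
    -- differentiate the equation of the complex tangent line
    have key : ∀ ζ : ℂ, (B (ζ • V) V : ℂ) - Complex.I * B (ζ • V) (Complex.I • V) +
        fderiv ℝ a p (ζ, (a p * ζ).re) * complexify l (0, 1) = 0 := by
      intro ζ
      set q : ℂ × ℝ := (ζ, (a p * ζ).re) with hq
      have hNq : fderiv ℝ N p q = ζ • V := by
        rw [h1, h2, hV]
        refine Prod.ext (by simp [hq]) ?_
        simp only [Prod.smul_snd, smul_eq_mul, hq]
        rw [Complex.re_add_im, mul_comm]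
      have h9 : (fun q => complexify (fderiv ℝ R (N q)) (1, a q)) =ᶠ[𝓝 p] fun _ => (0 : ℂ) :=
        h3.mono fun q hq => complexify_tangentSlope (hcv hq)
      have hl' : HasFDerivAt (fun q => fderiv ℝ R (N q)) (B.comp (fderiv ℝ N p)) p :=
        HasFDerivAt.comp (g := fderiv ℝ R) p hR2.differentiableAt_fderiv.hasFDerivAt h8.hasFDerivAt
      have hv' : HasFDerivAt (fun q => ((1 : ℂ), a q)) _ p :=
        (hasFDerivAt_const (1 : ℂ) p).prodMk h7.hasFDerivAt
      have hv'' : HasFDerivAt (fun q => Complex.I • ((1 : ℂ), a q)) _ p := hv'.const_smul Complex.I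
      have h10 : HasFDerivAt (fun q => complexify (fderiv ℝ R (N q)) (1, a q)) _ p :=
        (Complex.ofRealCLM.hasFDerivAt.comp p (hl'.clm_apply hv')).sub
          ((Complex.ofRealCLM.hasFDerivAt.comp p (hl'.clm_apply hv'')).const_mul Complex.I)
      have h11 := h10.fderiv
      rw [h9.fderiv_eq] at h11
      have h12 := congrArg (fun L => L q) h11
      simp [hNq, ← hl] at h12
      rw [← complexify_snd, complexify]
      have e1 : B (ζ • V) V = B (ζ • V) (1, a p) := rfl
      have e2 : Complex.I • V = (Complex.I, Complex.I * a p) := by simp [hV]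
      have e3 : Complex.I • ((0 : ℂ), fderiv ℝ a p q) = (0, Complex.I * fderiv ℝ a p q) := by simp
      rw [e1, e2, e3]
      linear_combination -h12
    have kI := key Complex.I
    have k1 := key 1
    rw [one_smul] at k1
    rw [leviBilin, ← hB] at hlevi
    have hs : B (Complex.I • V) V = B V (Complex.I • V) := hR2.fderiv_fderiv_symm _ _
    have hlevi' : (B V V : ℂ) + B (Complex.I • V) (Complex.I • V) = 0 := by exact_mod_cast hlevi
    rw [hs] at kI
    rw [mul_one] at k1
    rw [IsIntegrableAt]
    refine mul_right_cancel₀ hlc ?_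
    linear_combination kI - Complex.I * k1 + Complex.I * hlevi' - (B V (Complex.I • V) : ℂ) * Complex.I_sq
  obtain ⟨f, hf3, hf0, hfim, hfhol⟩ := exists_leaf_family hF ha2 hFa hint
  have hf00 : f 0 = 0 := by
    have h1 : (f 0).re = 0 := hf0 0
    refine Complex.ext h1 ?_
    rw [hfim, h1]
    exact hF0
  refine ⟨f, hf3, hf00, hf0, ?_, hfhol⟩
  have hc : Tendsto (fun x : (ℂ × ℝ) × ℝ => ((x.1.1, f x.1 + x.2 * Complex.I) : ℂ × ℂ)) (𝓝 0) (𝓝 0) := by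
    have h1 : ContinuousAt (fun x : (ℂ × ℝ) × ℝ => f x.1) 0 :=
      ContinuousAt.comp (g := f) (f := Prod.fst) hf3.continuousAt continuousAt_fst
    have h2 : ContinuousAt (fun x : (ℂ × ℝ) × ℝ => ((x.1.1, f x.1 + x.2 * Complex.I) : ℂ × ℂ)) 0 := by
      fun_prop
    have h3 := h2.tendsto
    have h4 : (((0 : (ℂ × ℝ) × ℝ).1.1, f (0 : (ℂ × ℝ) × ℝ).1 + ((0 : (ℂ × ℝ) × ℝ).2 : ℂ) * Complex.I) : ℂ × ℂ) = 0 := by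
      simp [hf00]
    rwa [h4] at h3
  filter_upwards [hc.eventually hgraph] with x hx
  rw [hx]
  simp [hfim]

end LeviFlat

/-! ### Straightening coordinates near a boundary point. -/

namespace LeviFlat

/-- The two vectors are Hermitian orthogonal with determinant `-(|n.1|² + |n.2|²)`. -/
theorem eq_zero_of_smul_add_smul_conj {n : ℂ × ℂ} (hn : n ≠ 0) {z w : ℂ}
    (h : z • ((-(starRingEnd ℂ) n.2, (starRingEnd ℂ) n.1) : ℂ × ℂ) + w • n = 0) : z = 0 ∧ w = 0 := by
  have h1 := congrArg Prod.fst h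
  have h2 := congrArg Prod.snd h
  simp only [Prod.fst_add, Prod.smul_fst, smul_eq_mul, Prod.fst_zero, Prod.snd_add, Prod.smul_snd,
    Prod.snd_zero] at h1 h2
  have h3 : z * ((Complex.normSq n.1 + Complex.normSq n.2 : ℝ) : ℂ) = 0 := by
    push_cast
    rw [Complex.normSq_eq_conj_mul_self, Complex.normSq_eq_conj_mul_self]
    linear_combination n.1 * h2 - n.2 * h1
  have hz : z = 0 := by
    refine (mul_eq_zero.1 h3).resolve_right fun h4 => hn ?_
    have h5 : Complex.normSq n.1 + Complex.normSq n.2 = 0 := by exact_mod_cast h4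
    have p1 := Complex.normSq_nonneg n.1
    have p2 := Complex.normSq_nonneg n.2
    exact Prod.ext (Complex.normSq_eq_zero.1 (by linarith)) (Complex.normSq_eq_zero.1 (by linarith))
  refine ⟨hz, ?_⟩
  rw [hz, zero_smul, zero_add] at h
  exact (smul_eq_zero.1 h).resolve_right hn

/-- Local coordinates `((z, t), s)` that straighten a Levi-flat hypersurface and its foliation. -/
theorem exists_foliation_coordinates {R : ℂ × ℂ → ℝ} {q₀ : ℂ × ℂ} (hR : ContDiffAt ℝ 3 R q₀)
    (h0 : R q₀ = 0) (hd : fderiv ℝ R q₀ ≠ 0)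
    (hflat : ∀ᶠ q in 𝓝 q₀, R q = 0 → ∀ v, fderiv ℝ R q v = 0 →
      fderiv ℝ R q (Complex.I • v) = 0 → leviBilin R q v v = 0) :
    ∃ Φ : (ℂ × ℝ) × ℝ → ℂ × ℂ, ContDiffAt ℝ 3 Φ 0 ∧ Φ 0 = q₀ ∧
      Function.Bijective (fderiv ℝ Φ 0) ∧ (∀ᶠ x in 𝓝 0, R (Φ x) = 0 ↔ x.2 = 0) ∧
      ∀ᶠ p in 𝓝 (0 : ℂ × ℝ), ∀ ζ, fderiv ℝ (fun p => Φ (p, 0)) p (ζ, 0) =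
        ζ • fderiv ℝ (fun p => Φ (p, 0)) p (1, 0) := by
  obtain ⟨v, hv⟩ : ∃ v, fderiv ℝ R q₀ v ≠ 0 := by
    by_contra! h
    exact hd (ContinuousLinearMap.ext h)
  -- The complex affine change of coordinates sends `(0, i)` to `i n = v`, so the hypersurface
  -- becomes transverse to the imaginary `w` axis.
  set n : ℂ × ℂ := -(Complex.I • v) with hn
  have hIn : Complex.I • n = v := by rw [hn, smul_neg, smul_smul, Complex.I_mul_I, neg_one_smul, neg_neg]
  have hn0 : n ≠ 0 := by
    intro h
    rw [h, smul_zero] at hIn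
    rw [← hIn, map_zero] at hv
    exact hv rfl
  set m : ℂ × ℂ := (-(starRingEnd ℂ) n.2, (starRingEnd ℂ) n.1) with hm
  set L : (ℂ × ℂ) →L[ℂ] (ℂ × ℂ) := (ContinuousLinearMap.fst ℂ ℂ ℂ).smulRight m +
    (ContinuousLinearMap.snd ℂ ℂ ℂ).smulRight n with hL
  have hLa : ∀ q, L q = q.1 • m + q.2 • n := fun q => by simp [hL]
  have hLinj : ∀ q, L q = 0 → q = 0 := by
    intro q hq
    rw [hLa] at hq
    obtain ⟨h1, h2⟩ := eq_zero_of_smul_add_smul_conj hn0 hq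
    exact Prod.ext h1 h2
  set T : ℂ × ℂ → ℂ × ℂ := fun q => q₀ + L q with hT
  have hTC : ∀ q, HasFDerivAt T L q := fun q => L.hasFDerivAt.const_add q₀
  have hTR : ∀ q, HasFDerivAt T (L.restrictScalars ℝ) q := fun q => (hTC q).restrictScalars ℝ
  have hTs : ContDiff ℝ 3 T := contDiff_const.add (L.restrictScalars ℝ).contDiff
  have hT0 : T 0 = q₀ := by simp [hT]
  have hTt : Tendsto T (𝓝 0) (𝓝 q₀) := by
    have := hTs.continuous.tendsto 0
    rwa [hT0] at this
  have hcd : ∀ q, DifferentiableAt ℝ R (T q) → ∀ w, fderiv ℝ (R ∘ T) q w = fderiv ℝ R (T q) (L w) := by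
    intro q hq w
    rw [(hq.hasFDerivAt.comp q (hTR q)).fderiv]
    rfl
  have hR' : ContDiffAt ℝ 3 (R ∘ T) 0 := ContDiffAt.comp (0 : ℂ × ℂ) (by rwa [hT0]) hTs.contDiffAt
  obtain ⟨f, hf3, hf0, hfre, hfz, hfhol⟩ := exists_leaf_family_of_leviFlat (R := R ∘ T) hR'
    (by simp [hT0, h0])
    (by
      rw [hcd 0 (by rw [hT0]; exact hR.differentiableAt (by simp)), hT0, hLa]
      simpa [hIn] using hv)
    (by
      filter_upwards [hTt.eventually hflat, hTt.eventually (hR.eventually (by simp))]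
        with q h1 h2 h3 w h4 h5
      have hq := h2.differentiableAt (by simp)
      rw [hcd q hq] at h4 h5
      rw [map_smul] at h5
      rw [leviBilin_comp (h2.of_le (by norm_num))
        (Eventually.of_forall fun x => (hTC x).differentiableAt) (hTs.contDiffAt.of_le (by norm_num)),
        (hTR q).fderiv]
      exact h1 h3 (L w) h4 h5)
  set Ψ : (ℂ × ℝ) × ℝ → ℂ × ℂ := fun x => (x.1.1, f x.1 + x.2 * Complex.I) with hΨ
  have hf3' : ContDiffAt ℝ 3 (fun x : (ℂ × ℝ) × ℝ => f x.1) 0 :=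
    ContDiffAt.comp (g := f) (0 : (ℂ × ℝ) × ℝ) hf3 contDiffAt_fst
  have hΨ3 : ContDiffAt ℝ 3 Ψ 0 :=
    (contDiffAt_fst.fst).prodMk (hf3'.add
      ((Complex.ofRealCLM.contDiff.contDiffAt.comp (0 : (ℂ × ℝ) × ℝ) contDiffAt_snd).mul contDiffAt_const))
  have hΨ0 : Ψ 0 = 0 := by simp [hΨ, hf0]
  have hfd : HasFDerivAt f (fderiv ℝ f 0) (0 : (ℂ × ℝ) × ℝ).1 := (hf3.differentiableAt (by simp)).hasFDerivAt
  have hΨd : ∀ x, fderiv ℝ Ψ 0 x = (x.1.1, fderiv ℝ f 0 x.1 + x.2 * Complex.I) := by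
    intro x
    have h1 : HasFDerivAt Ψ _ 0 := ((hasFDerivAt_fst (𝕜 := ℝ)).comp (0 : (ℂ × ℝ) × ℝ) hasFDerivAt_fst).prodMk
      ((hfd.comp (0 : (ℂ × ℝ) × ℝ) hasFDerivAt_fst).add
      ((Complex.ofRealCLM.hasFDerivAt.comp (0 : (ℂ × ℝ) × ℝ) hasFDerivAt_snd).mul_const Complex.I))
    rw [h1.fderiv]
    simp [mul_comm]
  have hre : ∀ t : ℝ, (fderiv ℝ f 0 (0, t)).re = t := by
    intro t
    have h1 : HasFDerivAt (fun t : ℝ => (f (0, t)).re)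
        (Complex.reCLM.comp ((fderiv ℝ f 0).comp (ContinuousLinearMap.inr ℝ ℂ ℝ))) 0 :=
      Complex.reCLM.hasFDerivAt.comp (0 : ℝ)
        (HasFDerivAt.comp (g := f) (0 : ℝ) hfd (ContinuousLinearMap.inr ℝ ℂ ℝ).hasFDerivAt)
    have h2 : (fun t : ℝ => (f (0, t)).re) = id := funext hfre
    rw [h2] at h1
    have := congrArg (fun K => K t) (h1.unique (hasFDerivAt_id 0))
    simpa using this
  have hΦd : fderiv ℝ (T ∘ Ψ) 0 = (L.restrictScalars ℝ).comp (fderiv ℝ Ψ 0) :=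
    ((hTR (Ψ 0)).comp 0 (hΨ3.differentiableAt (by simp)).hasFDerivAt).fderiv
  have hinj : Function.Injective (fderiv ℝ (T ∘ Ψ) 0) := by
    refine (injective_iff_map_eq_zero _).2 fun x hx => ?_
    rw [hΦd] at hx
    have h1 : fderiv ℝ Ψ 0 x = 0 := hLinj _ hx
    rw [hΨd, Prod.mk_eq_zero] at h1
    obtain ⟨h1, h2⟩ := h1
    have e : x.1 = (0, x.1.2) := Prod.ext h1 rfl
    have h3 := congrArg Complex.re h2
    rw [e] at h2 h3
    simp only [Complex.add_re, hre, Complex.zero_re] at h3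
    have h4 : x.1.2 = 0 := by simpa using h3
    rw [h4, Prod.mk_zero_zero, map_zero, zero_add] at h2
    have h5 : x.2 = 0 := by simpa using h2
    exact Prod.ext (Prod.ext h1 h4) h5
  refine ⟨T ∘ Ψ, hTs.contDiffAt.comp 0 hΨ3, by simp [hΨ0, hT0], ⟨hinj, ?_⟩, hfz, ?_⟩
  · refine (LinearMap.injective_iff_surjective_of_finrank_eq_finrank
      (f := (fderiv ℝ (T ∘ Ψ) 0 : ((ℂ × ℝ) × ℝ) →ₗ[ℝ] (ℂ × ℂ))) ?_).1 hinj
    simp [Module.finrank_prod]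
  · filter_upwards [hfhol, hf3.eventually (by simp)] with p hp hp3 ζ
    have e : (fun p : ℂ × ℝ => (T ∘ Ψ) (p, 0)) = fun p => T (p.1, f p) := by
      funext p
      simp [hΨ]
    have h1 : HasFDerivAt (fun p : ℂ × ℝ => T (p.1, f p)) _ p := HasFDerivAt.comp (g := T) p (hTR (p.1, f p))
      (hasFDerivAt_fst.prodMk (hp3.differentiableAt (by simp)).hasFDerivAt)
    rw [e, h1.fderiv]
    change L (ζ, fderiv ℝ f p (ζ, 0)) = ζ • L (1, fderiv ℝ f p (1, 0))
    rw [hp, ← map_smul]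
    simp

end LeviFlat

/-! ### Foliated charts from straightening coordinates. -/

namespace LeviFlat

/-- The slice `{x | x.2 = 0}` of a chart that straightens `M`. -/
theorem exists_slice {X Y : Type*} [TopologicalSpace X] [TopologicalSpace Y]
    (H : OpenPartialHomeomorph X (Y × ℝ)) {M : Set X} {B : Set Y} (hM : M.Nonempty) (hBo : IsOpen B)
    (h1 : ∀ y ∈ B, (y, (0 : ℝ)) ∈ H.target) (h2 : ∀ x ∈ H.target, x.1 ∈ B)
    (h3 : ∀ x ∈ H.target, H.symm x ∈ M ↔ x.2 = 0) :
    ∃ K : OpenPartialHomeomorph M Y, K.target = B ∧ ∀ y ∈ B, (K.symm y : X) = H.symm (y, 0) := by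
  classical
  obtain ⟨p, hp⟩ := hM
  have hmem : ∀ y ∈ B, H.symm (y, 0) ∈ M := fun y hy => (h3 _ (h1 y hy)).2 rfl
  -- The point `p` is a default value off `B`; it never matters.
  set inv : Y → M := fun y => if h : H.symm (y, 0) ∈ M then ⟨_, h⟩ else ⟨p, hp⟩ with hinv
  have hval : ∀ y ∈ B, (inv y : X) = H.symm (y, 0) := fun y hy => by simp [hinv, hmem y hy]
  refine ⟨{ toFun := fun m => (H m).1
            invFun := inv
            source := Subtype.val ⁻¹' H.source
            target := B
            map_source' := fun m hm => h2 _ (H.map_source hm)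
            map_target' := fun y hy => by
              rw [mem_preimage, hval y hy]
              exact H.map_target (h1 y hy)
            left_inv' := fun m hm => by
              have e2 : (H m).2 = 0 := (h3 _ (H.map_source hm)).1 (by rw [H.left_inv hm]; exact m.2)
              apply Subtype.ext
              rw [hval _ (h2 _ (H.map_source hm)), ← e2, Prod.mk.eta, H.left_inv hm]
            right_inv' := fun y hy => by
              rw [hval y hy, H.right_inv (h1 y hy)]
            open_source := H.open_source.preimage continuous_subtype_val
            open_target := hBo
            continuousOn_toFun := continuousOn_fst.comp
              (H.continuousOn.comp continuous_subtype_val.continuousOn fun _ h => h) (mapsTo_univ _ _) |>.mono (fun _ h => h)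
            continuousOn_invFun := by
              rw [Topology.IsInducing.subtypeVal.continuousOn_iff]
              refine (H.continuousOn_symm.comp (Continuous.continuousOn (by fun_prop)) h1).congr hval },
    rfl, hval⟩

end LeviFlat

namespace LeviFlat

variable {X : Type*} [TopologicalSpace X] [ChartedSpace (ℂ × ℂ) X] [IsManifold 𝓘(ℂ, ℂ × ℂ) ω X]

/-- Straightening coordinates give a foliated chart. -/
theorem exists_foliatedChart_of_coordinates {M : Set X} {p : X} (hp : p ∈ M)
    {Φ : (ℂ × ℝ) × ℝ → ℂ × ℂ} (hΦ : ContDiffAt ℝ 3 Φ 0) (hΦ0 : Φ 0 = chartAt (ℂ × ℂ) p p)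
    (hb : Function.Bijective (fderiv ℝ Φ 0))
    (hM : ∀ᶠ x in 𝓝 0, (chartAt (ℂ × ℂ) p).symm (Φ x) ∈ M ↔ x.2 = 0)
    (hhol : ∀ᶠ y in 𝓝 (0 : ℂ × ℝ), ∀ ζ, fderiv ℝ (fun y => Φ (y, 0)) y (ζ, 0) =
      ζ • fderiv ℝ (fun y => Φ (y, 0)) y (1, 0)) :
    ∃ c : FoliatedChart M, p ∈ c.dom := by
  have := isManifold_real X
  set e := chartAt (ℂ × ℂ) p with he
  have hpe : p ∈ e.source := mem_chart_source _ p
  obtain ⟨E, hE0, hEΦ, hEs⟩ := exists_local_inverse hΦ (by simp) hb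
  -- Bijectivity is known only at the origin; the differentiable local inverse supplies left
  -- inverses of the nearby differentials.
  have hinj : ∀ᶠ x in 𝓝 0, Function.Injective (fderiv ℝ Φ x) := by
    have hEt : ∀ᶠ x in 𝓝 0, ContDiffAt ℝ 3 E.symm (Φ x) :=
      hΦ.continuousAt.eventually (hEs.eventually (by simp))
    filter_upwards [hEt, hΦ.eventually (by simp), E.open_source.mem_nhds hE0] with x h1 h2 h3
    have h4 := (h1.differentiableAt (by simp)).hasFDerivAt.comp x (h2.differentiableAt (by simp)).hasFDerivAt
    have h5 : E.symm ∘ Φ =ᶠ[𝓝 x] id := by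
      filter_upwards [E.open_source.mem_nhds h3] with y hy
      rw [← hEΦ]
      exact E.left_inv hy
    have h6 := h4.unique ((hasFDerivAt_id x).congr_of_eventuallyEq h5)
    intro v w hvw
    have h7 := congrArg (fun L => L v) h6
    have h8 := congrArg (fun L => L w) h6
    simp only [ContinuousLinearMap.comp_apply, ContinuousLinearMap.id_apply] at h7 h8
    rw [← h7, ← h8, hvw]
  have hΦe : ∀ᶠ x in 𝓝 0, Φ x ∈ e.target :=
    hΦ.continuousAt.eventually (by rw [hΦ0]; exact e.open_target.mem_nhds (e.map_source hpe))
  have hy : Tendsto (Prod.fst : (ℂ × ℝ) × ℝ → ℂ × ℝ) (𝓝 0) (𝓝 0) := continuous_fst.tendsto _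
  obtain ⟨ε, hε, hball⟩ := Metric.eventually_nhds_iff_ball.1 ((((hM.and hinj).and
    (hΦ.eventually (by simp))).and (hΦe.and (E.open_source.mem_nhds hE0))).and (hy.eventually hhol))
  set W : Set ((ℂ × ℝ) × ℝ) := Metric.ball 0 ε with hW
  set B : Set (ℂ × ℝ) := Metric.ball 0 ε with hB
  have hWB : W = B ×ˢ Metric.ball (0 : ℝ) ε := (ball_prod_same _ _ _).symm
  have hBW : ∀ y ∈ B, (y, (0 : ℝ)) ∈ W := fun y hy => by
    rw [hWB]
    exact ⟨hy, Metric.mem_ball_self hε⟩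
  set H : OpenPartialHomeomorph X ((ℂ × ℝ) × ℝ) :=
    (e.trans E.symm).trans (OpenPartialHomeomorph.ofSet W Metric.isOpen_ball) with hH
  have hHt : ∀ x, x ∈ H.target ↔ x ∈ W := by
    intro x
    constructor
    · intro hx
      simp [hH] at hx
      exact hx.1
    · intro hx
      have h1 := (hball x hx).1.2
      simp [hH, hEΦ]
      exact ⟨hx, h1.2, h1.1⟩
  have hHs : ∀ x, H.symm x = e.symm (Φ x) := fun x => by simp [hH, hEΦ]
  obtain ⟨K, hKt, hK⟩ := exists_slice H (M := M) (B := B) ⟨p, hp⟩ Metric.isOpen_ball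
    (fun y hy => (hHt _).2 (hBW y hy))
    (fun x hx => by
      have := (hHt x).1 hx
      rw [hWB] at this
      exact this.1)
    (fun x hx => by
      rw [hHs]
      exact (hball x ((hHt x).1 hx)).1.1.1.1)
  have hKe : ∀ y ∈ B, (K.symm y : X) = e.symm (Φ (y, 0)) := fun y hy => by rw [hK y hy, hHs]
  have hDT : Metric.ball (0 : ℂ) ε ×ˢ Metric.ball (0 : ℝ) ε = B := ball_prod_same _ _ _
  have hι : ∀ y ∈ B, ContDiffAt ℝ 3 (fun y : ℂ × ℝ => Φ (y, 0)) y := fun y hy =>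
    ContDiffAt.comp (g := Φ) y (hball _ (hBW y hy)).1.1.2 (contDiffAt_id.prodMk contDiffAt_const)
  have hιt : ∀ y ∈ B, Φ (y, 0) ∈ e.target := fun y hy => (hball _ (hBW y hy)).1.2.1
  have hsm : ContMDiffOn 𝓘(ℝ, ℂ × ℝ) 𝓘(ℝ, ℂ × ℂ) 3 (fun y : ℂ × ℝ => (K.symm y : X)) B := by
    refine ContMDiffOn.congr ?_ hKe
    exact (contMDiffOn_chart_symm (I := 𝓘(ℝ, ℂ × ℂ)) (n := 3) (x := p)).comp
      (ContDiffOn.contMDiffOn fun y hy => (hι y hy).contDiffWithinAt) hιt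
  let c : FoliatedChart M :=
    { toHomeo := K
      D := Metric.ball 0 ε
      T := Metric.ball 0 ε
      isOpen_D := Metric.isOpen_ball
      isConnected_D := ⟨⟨0, Metric.mem_ball_self hε⟩, (convex_ball _ _).isPreconnected⟩
      isOpen_T := Metric.isOpen_ball
      isConnected_T := ⟨⟨0, Metric.mem_ball_self hε⟩, (convex_ball _ _).isPreconnected⟩
      target_eq := hKt.trans hDT.symm
      smooth := by rwa [hDT]
      immersion := by
        intro y hy v w hvw
        rw [hDT] at hy
        have hmd : MDifferentiableAt 𝓘(ℝ, ℂ × ℝ) 𝓘(ℝ, ℂ × ℂ) (fun y : ℂ × ℝ => (K.symm y : X)) y :=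
          (hsm.contMDiffAt (Metric.isOpen_ball.mem_nhds hy)).mdifferentiableAt (by simp)
        have hys : (K.symm y : X) ∈ e.source := by
          rw [hKe y hy]
          exact e.map_target (hιt y hy)
        have h1 : e ∘ (fun y : ℂ × ℝ => (K.symm y : X)) =ᶠ[𝓝 y] fun y => Φ (y, 0) := by
          filter_upwards [Metric.isOpen_ball.mem_nhds hy] with y' hy'
          simp only [Function.comp_apply]
          rw [hKe y' hy', e.right_inv (hιt y' hy')]
        have h2 : fderiv ℝ (e ∘ fun y : ℂ × ℝ => (K.symm y : X)) y v =
            fderiv ℝ (e ∘ fun y : ℂ × ℝ => (K.symm y : X)) y w :=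
          (fderiv_chart_comp hmd hys v).trans
            ((congrArg (chartDeriv p (K.symm y : X)) hvw).trans (fderiv_chart_comp hmd hys w).symm)
        rw [h1.fderiv_eq] at h2
        have h3 : HasFDerivAt (fun y : ℂ × ℝ => Φ (y, 0)) _ y := HasFDerivAt.comp (g := Φ) y
          ((hball _ (hBW y hy)).1.1.2.differentiableAt (by simp)).hasFDerivAt
          ((hasFDerivAt_id y).prodMk (hasFDerivAt_const (0 : ℝ) y))
        rw [h3.fderiv] at h2
        have h4 := (hball _ (hBW y hy)).1.1.1.2 h2
        exact congrArg Prod.fst h4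
      holomorphic := by
        intro t ht
        have hmem : ∀ z ∈ Metric.ball (0 : ℂ) ε, (z, t) ∈ B := fun z hz => by
          rw [← hDT]
          exact ⟨hz, ht⟩
        refine MDifferentiableOn.congr ?_ fun z hz => hKe _ (hmem z hz)
        refine MDifferentiableOn.comp (g := e.symm)
          ((contMDiffOn_chart_symm (I := 𝓘(ℂ, ℂ × ℂ)) (n := ω) (x := p)).mdifferentiableOn (by simp))
          (DifferentiableOn.mdifferentiableOn ?_) fun z hz => hιt _ (hmem z hz)
        intro z hz
        have h1 : HasFDerivAt (fun z : ℂ => Φ ((z, t), 0)) _ z :=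
          HasFDerivAt.comp (g := fun y : ℂ × ℝ => Φ (y, 0)) z
            ((hι _ (hmem z hz)).differentiableAt (by simp)).hasFDerivAt
            ((hasFDerivAt_id z).prodMk (hasFDerivAt_const t z))
        refine (hasFDerivAt_of_restrictScalars ℝ h1 (f' := (ContinuousLinearMap.id ℂ ℂ).smulRight
          (fderiv ℝ (fun y : ℂ × ℝ => Φ (y, 0)) (z, t) (1, 0))) ?_).differentiableAt.differentiableWithinAt
        ext ζ : 1
        exact ((hball _ (hBW _ (hmem z hz))).2 ζ).symm }
  refine ⟨c, (0, 0), ⟨Metric.mem_ball_self hε, Metric.mem_ball_self hε⟩, ?_⟩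
  change (K.symm (0 : ℂ × ℝ) : X) = p
  rw [hKe 0 (Metric.mem_ball_self hε)]
  change e.symm (Φ 0) = p
  rw [hΦ0, e.left_inv hpe]

end LeviFlat

/-! ### Foliated charts of a Levi-flat boundary. -/

namespace LeviFlat

variable {X : Type*} [TopologicalSpace X] [ChartedSpace (ℂ × ℂ) X] [IsManifold 𝓘(ℂ, ℂ × ℂ) ω X]

theorem diff_eq_zero_of_isLocalMin {f : X → ℝ} {x : X} (hf : C3At f x) (h : IsLocalMin f x) :
    diff f x = 0 := by
  have h1 : IsLocalMin (f ∘ (chartAt (ℂ × ℂ) x).symm) (chartAt (ℂ × ℂ) x x) := by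
    have h2 := (chartAt (ℂ × ℂ) x).continuousAt_symm
      ((chartAt (ℂ × ℂ) x).map_source (mem_chart_source _ x))
    rw [ContinuousAt, (chartAt (ℂ × ℂ) x).left_inv (mem_chart_source _ x)] at h2
    filter_upwards [h2.eventually h] with y hy
    simpa using hy
  refine ContinuousLinearMap.ext fun v => ?_
  rw [diff_eq hf (mem_chart_source _ x), h1.fderiv_eq_zero]
  rfl

/-- Near its smooth points the boundary of `Ω = {ρ < 0}` is the zero set of `ρ`. -/
theorem mem_frontier_iff_eq_zero {Ω U : Set X} {ρ : X → ℝ} (hΩ : IsOpen Ω) (hU : IsOpen U)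
    (hρ : ∀ q ∈ U, C3At ρ q ∧ diff ρ q ≠ 0 ∧ (q ∈ Ω ↔ ρ q < 0)) {q : X} (hq : q ∈ U) :
    q ∈ frontier Ω ↔ ρ q = 0 := by
  obtain ⟨h1, h2, h3⟩ := hρ q hq
  rw [hΩ.frontier_eq, Set.mem_sdiff, h3, not_lt]
  have hUq : ∀ᶠ y in 𝓝 q, y ∈ U := hU.mem_nhds hq
  constructor
  · rintro ⟨h4, h5⟩
    by_contra h6
    have h7 : ∀ᶠ y in 𝓝 q, 0 < ρ y :=
      (ContMDiffAt.continuousAt h1).eventually (lt_mem_nhds (lt_of_le_of_ne h5 (Ne.symm h6)))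
    obtain ⟨y, hy1, hy2, hy3⟩ := ((mem_closure_iff_frequently.1 h4).and_eventually (h7.and hUq)).exists
    exact absurd (((hρ y hy3).2.2).1 hy1) (not_lt.2 hy2.le)
  · intro h4
    refine ⟨?_, h4.ge⟩
    by_contra h5
    -- A zero of `ρ` away from the closure of `Ω` would be a local minimum, hence a critical point.
    refine h2 (diff_eq_zero_of_isLocalMin h1 ?_)
    have h6 : ∀ᶠ y in 𝓝 q, y ∉ closure Ω := isClosed_closure.isOpen_compl.mem_nhds h5
    filter_upwards [h6, hUq] with y hy1 hy2
    rw [h4]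
    exact not_lt.1 fun h => hy1 (subset_closure (((hρ y hy2).2.2).2 h))

/-- The boundary of a Levi-flat domain is covered by foliated charts. -/
theorem exists_foliatedChart {Ω : Set X} (hΩ : IsOpen Ω) (hflat : HasLeviFlatBoundary Ω) {p : X}
    (hp : p ∈ frontier Ω) : ∃ c : FoliatedChart (frontier Ω), p ∈ c.dom := by
  obtain ⟨U, ρ, hU, hpU, hρ, hlevi⟩ := hflat p hp
  have hfr := fun q (hq : q ∈ U) => mem_frontier_iff_eq_zero hΩ hU hρ hq
  set e := chartAt (ℂ × ℂ) p with he
  have hpe : p ∈ e.source := mem_chart_source _ p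
  have hse : e.symm (e p) = p := e.left_inv hpe
  have hR : ContDiffAt ℝ 3 (ρ ∘ e.symm) (e p) := (hρ p hpU).1.contDiffAt hpe
  have hev : ∀ᶠ q in 𝓝 (e p), q ∈ e.target ∧ e.symm q ∈ U := by
    have ht : ∀ᶠ q in 𝓝 (e p), q ∈ e.target := e.open_target.mem_nhds (e.map_source hpe)
    refine ht.and ?_
    refine (e.continuousAt_symm (e.map_source hpe)).eventually ?_
    rw [hse]
    exact hU.mem_nhds hpU
  obtain ⟨Φ, h1, h2, h3, h4, h5⟩ := exists_foliation_coordinates hR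
    (by rw [Function.comp_apply, hse]; exact (hfr p hpU).1 hp)
    (by
      intro h
      refine (hρ p hpU).2.1 (ContinuousLinearMap.ext fun v => ?_)
      rw [diff_eq (hρ p hpU).1 hpe, h]
      rfl)
    (by
      filter_upwards [hev] with q hq hq0 v hv1 hv2
      have hx : e.symm q ∈ e.source := e.map_target hq.1
      have hex : e (e.symm q) = q := e.right_inv hq.1
      obtain ⟨hC, -, -⟩ := hρ _ hq.2
      obtain ⟨w, rfl⟩ := chartDeriv_surjective hx v
      have k1 := leviForm_eq (f := ρ) hx ((hC.contDiffAt hx).of_le (by norm_num)) w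
      rw [hlevi _ ⟨hq.2, (hfr _ hq.2).2 hq0⟩ w
        (by rw [diff_eq hC hx, hex]; exact hv1)
        (by rw [diff_eq hC hx, hex, map_smul]; exact hv2), hex] at k1
      linarith)
  refine exists_foliatedChart_of_coordinates hp h1 h2 h3 ?_ h5
  have h6 : ∀ᶠ x in 𝓝 0, Φ x ∈ e.target ∧ e.symm (Φ x) ∈ U :=
    h1.continuousAt.eventually (by rw [h2]; exact hev)
  filter_upwards [h4, h6] with x hx hx'
  rw [hfr _ hx'.2, ← hx]
  rfl

end LeviFlat

/-! ### Bounded charts and finite covers. -/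

namespace LeviFlat

variable {X : Type*} [TopologicalSpace X] [ChartedSpace (ℂ × ℂ) X] {M S : Set X}

/-- The restriction of a foliated chart to a smaller product. -/
noncomputable def FoliatedChart.shrink (c : FoliatedChart M) {D : Set ℂ} {T : Set ℝ} (hD : IsOpen D)
    (hDc : IsConnected D) (hDs : D ⊆ c.D) (hT : IsOpen T) (hTc : IsConnected T) (hTs : T ⊆ c.T) :
    FoliatedChart M where
  toHomeo := (c.toHomeo.symm.restrOpen (D ×ˢ T) (hD.prod hT)).symm
  D := D
  T := T
  isOpen_D := hD
  isConnected_D := hDc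
  isOpen_T := hT
  isConnected_T := hTc
  target_eq := by
    rw [OpenPartialHomeomorph.symm_target, OpenPartialHomeomorph.restrOpen_source,
      OpenPartialHomeomorph.symm_source, c.target_eq]
    exact inter_eq_right.2 (prod_mono hDs hTs)
  smooth := c.smooth.mono (prod_mono hDs hTs)
  immersion := fun p hp => c.immersion p (prod_mono hDs hTs hp)
  holomorphic := fun t ht => (c.holomorphic t (hTs ht)).mono hDs

variable [IsManifold 𝓘(ℂ, ℂ × ℂ) ω X] [MeasurableSpace X] [BorelSpace X]

/-- Every point of a foliated chart has a smaller foliated chart with finite transverse measure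
and bounded density. -/
theorem FoliatedChart.exists_bounded_chart (g : LeafwiseMetric M) {δ : X → ℝ} {α : ℝ}
    (hS : IsSaturated M S) (hSc : IsClosed S) (hfin : HasPosFiniteTransversals M S α)
    (hδ : ∀ x ∈ M, C3At δ x) (h0 : ∀ x ∈ M, δ x = 0) (hd : ∀ x ∈ M, diff δ x ≠ 0) (hα : 0 ≤ α)
    (c : FoliatedChart M) {x : X} (hx : x ∈ c.dom) :
    ∃ c' : FoliatedChart M, x ∈ c'.dom ∧
      IsFiniteMeasure ((Measure.hausdorffMeasure α).restrict (c'.transversal S)) ∧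
      Integrable (fun p => c'.normalMetric δ p ^ α)
        (g.volProd c' ((Measure.hausdorffMeasure α).restrict (c'.transversal S))) ∧
      ∃ C : ℝ, ∀ p ∈ c'.D ×ˢ c'.T, |Real.log (c'.normalMetric δ p ^ α)| ≤ C := by
  obtain ⟨⟨z, t⟩, hp, rfl⟩ := hx
  obtain ⟨r, hr, hball⟩ := Metric.nhds_basis_closedBall.mem_iff.1 (c.prod_mem_nhds hp)
  rw [← closedBall_prod_same] at hball
  -- The smaller chart is relatively compact in the larger one, so the densities and their
  -- logarithms are bounded and the compact-set hypothesis bounds the Hausdorff measure.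
  set K := Metric.closedBall z r ×ˢ Metric.closedBall t r with hK
  have hKc : IsCompact K := (isCompact_closedBall z r).prod (isCompact_closedBall t r)
  have hD : Metric.ball z r ⊆ c.D := fun w hw =>
    (hball (show (w, t) ∈ K from ⟨Metric.ball_subset_closedBall hw, Metric.mem_closedBall_self hr.le⟩)).1
  have hTK : Metric.closedBall t r ⊆ c.T := fun w hw =>
    (hball (show (z, w) ∈ K from ⟨Metric.mem_closedBall_self hr.le, hw⟩)).2
  have hT : Metric.ball t r ⊆ c.T := Metric.ball_subset_closedBall.trans hTK
  set c' := c.shrink Metric.isOpen_ball ⟨⟨z, Metric.mem_ball_self hr⟩, (convex_ball z r).isPreconnected⟩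
    hD Metric.isOpen_ball ⟨⟨t, Metric.mem_ball_self hr⟩, (convex_ball t r).isPreconnected⟩ hT with hc'
  have hsub : c'.D ×ˢ c'.T ⊆ K := prod_mono Metric.ball_subset_closedBall Metric.ball_subset_closedBall
  have hcont : ContinuousOn (fun p => c.normalMetric δ p ^ α) K :=
    (continuousOn_normalMetric_rpow hδ hα).mono hball
  have hpos : ∀ p ∈ K, 0 < c.normalMetric δ p ^ α := fun p hp =>
    Real.rpow_pos_of_pos (normalMetric_pos hδ h0 hd (hball hp)) α
  obtain ⟨C₁, hC₁⟩ := hKc.exists_bound_of_continuousOn hcont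
  obtain ⟨C₂, hC₂⟩ := hKc.exists_bound_of_continuousOn (hcont.log fun p hp => (hpos p hp).ne')
  obtain ⟨C₃, hC₃⟩ := hKc.exists_bound_of_continuousOn ((g.continuousOn_density c).mono hball)
  have htr : c'.transversal S ⊆ c.transversal S ∩ Metric.closedBall t r := by
    rintro s ⟨hs, w, hw, h⟩
    exact ⟨⟨hT hs, w, hD hw, h⟩, Metric.ball_subset_closedBall hs⟩
  have hν : IsFiniteMeasure ((Measure.hausdorffMeasure α : Measure ℝ).restrict (c'.transversal S)) := by
    refine ⟨?_⟩
    rw [Measure.restrict_apply_univ]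
    exact (measure_mono htr).trans_lt ((hfin c).2 _ hTK (isCompact_closedBall t r))
  have hνT := restrict_transversal_compl (c := c') (α := α) hS hSc
  refine ⟨c', ⟨(z, t), ⟨Metric.mem_ball_self hr, Metric.mem_ball_self hr⟩, rfl⟩, hν, ?_,
    C₂, fun p hp => hC₂ p (hsub hp)⟩
  set ν := (Measure.hausdorffMeasure α : Measure ℝ).restrict (c'.transversal S) with hνdef
  have hae := ae_mem_prod c' hνT
  have hDfin : IsFiniteMeasure ((volume : Measure ℂ).restrict c'.D) := by
    refine ⟨?_⟩
    rw [Measure.restrict_apply_univ]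
    exact measure_ball_lt_top
  have hvol : IsFiniteMeasure (g.volProd c' ν) := by
    refine isFiniteMeasure_withDensity (ne_of_lt ?_)
    calc ∫⁻ p, ENNReal.ofReal (g.density c' p) ∂((volume.restrict c'.D).prod ν)
        ≤ ∫⁻ _, ENNReal.ofReal C₃ ∂((volume.restrict c'.D).prod ν) :=
          lintegral_mono_ae (hae.mono fun p hp =>
            ENNReal.ofReal_le_ofReal ((le_abs_self _).trans (hC₃ p (hsub hp))))
      _ < ⊤ := by
          rw [lintegral_const]
          exact ENNReal.mul_lt_top ENNReal.ofReal_lt_top (measure_lt_top _ _)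
  have hac : g.volProd c' ν ≪ (volume.restrict c'.D).prod ν := withDensity_absolutelyContinuous _ _
  refine Integrable.of_bound (C := C₁) ?_ (hac.ae_le (hae.mono fun p hp => hC₁ p (hsub hp)))
  exact ((aemeasurable_of_continuousOn c' hνT
    (continuousOn_normalMetric_rpow hδ hα)).mono_ac hac).aestronglyMeasurable

/-- A compact foliated set is covered by finitely many foliated charts of any kind that exists
around each of its points. -/
theorem exists_finite_cover (hM : IsCompact M) {P : FoliatedChart M → Prop}
    (h : ∀ x ∈ M, ∃ c : FoliatedChart M, x ∈ c.dom ∧ P c) :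
    ∃ (n : ℕ) (c : Fin n → FoliatedChart M), M = (⋃ i, (c i).dom) ∧ ∀ i, P (c i) := by
  have := isCompact_iff_compactSpace.1 hM
  choose c hc hP using fun m : M => h m m.2
  obtain ⟨s, hs⟩ := CompactSpace.elim_nhds_subcover (fun m => (c m).toHomeo.source) fun m =>
    (c m).toHomeo.open_source.mem_nhds ((c m).symm_mem_source_iff.1 (hc m))
  refine ⟨s.card, fun i => c (s.equivFin.symm i), ?_, fun i => hP _⟩
  refine Subset.antisymm (fun x hx => ?_) (iUnion_subset fun i => (c _).dom_subset)
  have h1 : (⟨x, hx⟩ : M) ∈ ⋃ m ∈ s, (c m).toHomeo.source := by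
    rw [hs]
    trivial
  simp only [mem_iUnion] at h1
  obtain ⟨m, hm, h2⟩ := h1
  refine mem_iUnion.2 ⟨s.equivFin ⟨m, hm⟩, ?_⟩
  simp only [Equiv.symm_apply_apply]
  exact (c m).symm_mem_source_iff.2 h2

end LeviFlat

/-! ### The conformal harmonic measure. -/

theorem proposition1p3 {X : Type*} [TopologicalSpace X] [T2Space X] [SecondCountableTopology X]
    [ChartedSpace (ℂ × ℂ) X] [IsManifold 𝓘(ℂ, ℂ × ℂ) ω X] [MeasurableSpace X] [BorelSpace X]
    (Ω : Set X) (hΩ_open : IsOpen Ω) (hΩ_conn : IsConnected Ω) (hΩ_cpt : IsCompact (closure Ω))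
    (hΩ_flat : LeviFlat.HasLeviFlatBoundary Ω)
    (g : LeviFlat.LeafwiseMetric (frontier Ω))
    (δ : X → ℝ) (hδ : LeviFlat.IsBoundaryDistance Ω δ)
    (S : Set X) (hS_ne : S.Nonempty) (hS_cpt : IsCompact S)
    (hS_sat : LeviFlat.IsSaturated (frontier Ω) S)
    (η : ℝ) (hη0 : 0 < η) (hη1 : η < 1)
    (hη : ∀ p ∈ S, LeviFlat.localDFExponent Ω δ p = η)
    (α : ℝ) (hα : α = (η⁻¹ - 1)⁻¹)
    (hS_haus : LeviFlat.HasPosFiniteTransversals (frontier Ω) S α) :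
    ∃ μ : Measure X, μ ≠ 0 ∧
      LeviFlat.IsConformalHarmonicMeasure g S α μ ∧
      ∀ c : LeviFlat.FoliatedChart (frontier Ω),
        μ.restrict c.dom =
          g.localMeasure c ((Measure.hausdorffMeasure α).restrict (c.transversal S))
            (fun p => c.normalMetric δ p ^ α) := by
  have hδ3 : ∀ x ∈ frontier Ω, LeviFlat.C3At δ x := fun x hx => hδ.smooth x (frontier_subset_closure hx)
  have hδ0 : ∀ x ∈ frontier Ω, δ x = 0 := fun x hx => hδ.eq_zero hΩ_open hx
  have hS_closed : IsClosed S := hS_cpt.isClosed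
  have hα0 : 0 < α := by
    rw [hα]
    exact inv_pos.2 (sub_pos.2 ((one_lt_inv₀ hη0).2 hη1))
  have hM_cpt : IsCompact (frontier Ω) := hΩ_cpt.of_isClosed_subset isClosed_frontier frontier_subset_closure
  obtain ⟨n, c, hcov, hc⟩ := LeviFlat.exists_finite_cover hM_cpt fun x hx => by
    obtain ⟨c, hxc⟩ := LeviFlat.exists_foliatedChart hΩ_open hΩ_flat hx
    exact c.exists_bounded_chart g hS_sat hS_closed hS_haus hδ3 hδ0 hδ.diff_ne_zero hα0.le hxc
  obtain ⟨μ, hμM, hμ⟩ := LeviFlat.exists_measure_restrict_dom_eq_chartMeasure g hS_sat hS_closed hS_haus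
    hδ3 hδ0 hα0.le c hcov
  have hpos : ∀ (c : LeviFlat.FoliatedChart (frontier Ω)), ∀ p ∈ c.D ×ˢ c.T, 0 < c.normalMetric δ p ^ α :=
    fun c p hp => Real.rpow_pos_of_pos
      (LeviFlat.FoliatedChart.normalMetric_pos hδ3 hδ0 hδ.diff_ne_zero hp) α
  refine ⟨μ, ?_, ⟨?_, n, c, fun i => (Measure.hausdorffMeasure α).restrict ((c i).transversal S),
    fun i p => (c i).normalMetric δ p ^ α, hcov, fun i => hμ (c i), ?_, ?_, ?_, ?_⟩, hμ⟩
  · rintro rfl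
    obtain ⟨x, hx⟩ := hS_ne
    obtain ⟨c', p, hp, rfl⟩ := LeviFlat.exists_foliatedChart hΩ_open hΩ_flat (hS_sat.1 hx)
    refine LeviFlat.chartMeasure_ne_zero g hS_sat hS_closed hS_haus hδ3 hδ0 hδ.diff_ne_zero hα0.le c'
      ⟨p.2, hp.2, p.1, hp.1, hx⟩ ?_
    rw [← hμ c', Measure.restrict_zero]
  -- Outside the boundary the glued measure is null by construction; on the boundary each chart
  -- contributes only over the transversal of `S`.
  · refine measure_mono_null (t := (frontier Ω)ᶜ ∪ ⋃ i, Sᶜ ∩ (c i).dom) (fun x hx => ?_)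
      (measure_union_null hμM (measure_iUnion_null fun i => ?_))
    · by_cases h : x ∈ frontier Ω
      · rw [hcov] at h
        obtain ⟨i, hi⟩ := mem_iUnion.1 h
        exact Or.inr (mem_iUnion.2 ⟨i, hx, hi⟩)
      · exact Or.inl h
    · rw [← Measure.restrict_apply hS_closed.measurableSet.compl, hμ]
      exact LeviFlat.chartMeasure_compl g hS_sat hS_closed hS_haus hδ3 hα0.le (c i)
  · refine ⟨hα0, fun i => (hc i).1, fun i => ?_, fun i j z B hz hBT hBm hBV hinj => ?_⟩
    · rw [Measure.restrict_apply'
        (LeviFlat.FoliatedChart.measurableSet_transversal hS_sat hS_closed), compl_inter_self,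
        measure_empty]
    · exact LeviFlat.FoliatedChart.hausdorffMeasure_transition hS_sat hS_closed hα0.le hBm
        (fun t ht => ⟨⟨hz, hBT ht⟩, hBV t ht⟩) hinj
  · exact fun i => ⟨fun p hp => (hpos (c i) p hp).le, (hc i).2.1⟩
  · intro i
    obtain ⟨C, hC⟩ := (hc i).2.2
    have hsub : (c i).D ×ˢ (c i).transversal S ⊆ (c i).D ×ˢ (c i).T :=
      prod_mono subset_rfl LeviFlat.FoliatedChart.transversal_subset
    exact ⟨C, fun p hp => ⟨hpos (c i) p (hsub hp), hC p (hsub hp)⟩⟩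
  · intro i
    -- The restricted measure only sees points of the transversal, and harmonicity holds at every
    -- one of them.
    rw [ae_restrict_iff' (LeviFlat.FoliatedChart.measurableSet_transversal hS_sat hS_closed)]
    exact Eventually.of_forall fun t ht => ⟨fun z hz => hpos (c i) _ ⟨hz, ht.1⟩,
      LeviFlat.FoliatedChart.harmonicOnNhd_normalMetric hΩ_open hδ hS_sat hη hη0 hη1 hα ht⟩
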